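/- Let $r\ge 5$ and $m\ge 3$ be integers, let $h$ be an integer, and let $F(x,y)\in\mathbb{Z}[x,y]$ be a diagonalizable form of degree $r$, that is, $$F(x,y)=(\alpha x+\beta y)^r-(\gamma x+\delta y)^r,\qquad j=\alpha\delta-\beta\gamma\neq 0,$$ with complex constants $\alpha,\beta,\gamma,\delta$. Then there are $A,B,C\in\mathbb{Z}$ and a constant $\chi\in\mathbb{C}$ with $$(\alpha x+\beta y)(\gamma x+\delta y)=\chi\,(Ax^2+Bxy+Cy^2);$$ for any such $A,B,C,\chi$ put $D=B^2-4AC$. Let $H(x,y)=F_{xx}F_{yy}-F_{xy}^2$ be the Hessian of $F$, and let $$H_L=r^{i_4}h^{i_5}|j|^{i_6},\qquad i_4=5+\frac{11r-3}{(r-1)^{m-1}},\qquad i_5=2+\frac{2(r-3)}{(r-1)^{m-1}},$$ $$i_6=2\ \text{ if } |j|\ge 1,\qquad i_6=\frac{2}{(r-3)(r-1)^{m-1}}\ \text{ if } |j|<1 .$$ Call $F$ definite if $F>0$ on all of $\mathbb{R}^2\setminus\{(0,0)\}$ or $F<0$ on all of $\mathbb{R}^2\setminus\{(0,0)\}$,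 and indefinite if it takes both positive and negative values on $\mathbb{R}^2$. Then the number of primitive solutions of $0<|F(x,y)|\le h$, that is, pairs $(x,y)\in\mathbb{Z}^2$ with $\gcd(x,y)=1$ satisfying the inequality, for which $|H(x,y)|\ge H_L$, where $(x,y)$ and $(-x,-y)$ are counted as one solution, is at most $$\begin{cases} rm & \text{if } D<0,\\ 2m & \text{if } D>0,\ r \text{ is even and } F \text{ is indefinite},\\ m & \text{if } D>0,\ r\text{ is odd and } F \text{ is indefinite},\\ 1 & \text{if } D>0 \text{ and } F \text{ is definite}.\end{cases}$$ (For $h\le 0$ there are no solutions, and nothing is claimed about $H_L$.) -/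

import Mathlib

namespace DiagThue

open MvPolynomial

/-- Binary forms are polynomials in the two variables `x = X 0` and `y = X 1`.
`linForm a b` is the linear form `a x + b y` with complex coefficients. -/
noncomputable def linForm (a b : ℂ) : MvPolynomial (Fin 2) ℂ := C a * X 0 + C b * X 1

/-- `F(x, y) = (α x + β y) ^ r - (γ x + δ y) ^ r` as polynomials, and `j = α δ - β γ ≠ 0`:
the integral form `F` is diagonalizable of degree `r`, by means of `α, β, γ, δ`. -/
def IsDiagonalizedBy (F : MvPolynomial (Fin 2) ℤ) (r : ℕ) (α β γ δ : ℂ) : Prop :=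
  map (Int.castRingHom ℂ) F = linForm α β ^ r - linForm γ δ ^ r ∧ α * δ - β * γ ≠ 0

/-- `(α x + β y) (γ x + δ y) = χ (A x ^ 2 + B x y + C y ^ 2)` as polynomials. -/
def IsAssociatedQuadratic (α β γ δ χ : ℂ) (a b c : ℤ) : Prop :=
  linForm α β * linForm γ δ =
    C χ * (C (a : ℂ) * X 0 ^ 2 + C (b : ℂ) * (X 0 * X 1) + C (c : ℂ) * X 1 ^ 2)

/-- The value of `F` at an integer point. -/
noncomputable def value (F : MvPolynomial (Fin 2) ℤ) (p : ℤ × ℤ) : ℤ :=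
  eval ![p.1, p.2] F

/-- The value of `F` at a real point. -/
noncomputable def realValue (F : MvPolynomial (Fin 2) ℤ) (p : ℝ × ℝ) : ℝ :=
  eval₂ (Int.castRingHom ℝ) ![p.1, p.2] F

/-- `F` is positive definite or negative definite. -/
def IsDefinite (F : MvPolynomial (Fin 2) ℤ) : Prop :=
  (∀ p : ℝ × ℝ, p ≠ 0 → 0 < realValue F p) ∨ (∀ p : ℝ × ℝ, p ≠ 0 → realValue F p < 0)

/-- `F` takes both positive and negative values. -/
def IsIndefinite (F : MvPolynomial (Fin 2) ℤ) : Prop :=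
  (∃ p : ℝ × ℝ, 0 < realValue F p) ∧ (∃ p : ℝ × ℝ, realValue F p < 0)

/-- The Hessian `F_xx F_yy - F_xy ^ 2`. -/
noncomputable def hessian (F : MvPolynomial (Fin 2) ℤ) : MvPolynomial (Fin 2) ℤ :=
  pderiv 0 (pderiv 0 F) * pderiv 1 (pderiv 1 F) - pderiv 0 (pderiv 1 F) ^ 2

/-- The exponent of `r` in the bound on the Hessian. -/
noncomputable def expR (r m : ℕ) : ℝ := 5 + (11 * (r : ℝ) - 3) / ((r : ℝ) - 1) ^ (m - 1)

/-- The exponent of `h` in the bound on the Hessian. -/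
noncomputable def expH (r m : ℕ) : ℝ := 2 + 2 * ((r : ℝ) - 3) / ((r : ℝ) - 1) ^ (m - 1)

open Classical in
/-- The exponent of `|j|` in the bound on the Hessian. -/
noncomputable def expJ (r m : ℕ) (j : ℂ) : ℝ :=
  if 1 ≤ ‖j‖ then 2 else 2 / (((r : ℝ) - 3) * ((r : ℝ) - 1) ^ (m - 1))

/-- The bound on the Hessian. -/
noncomputable def hessianBound (r m : ℕ) (h : ℤ) (j : ℂ) : ℝ :=
  (r : ℝ) ^ expR r m * (h : ℝ) ^ expH r m * ‖j‖ ^ expJ r m j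

/-- The primitive solutions of `0 < |F(x, y)| ≤ h` with `|H(x, y)| ≥ B`. -/
def largeSolutions (F : MvPolynomial (Fin 2) ℤ) (h : ℤ) (B : ℝ) : Set (ℤ × ℤ) :=
  {p | Int.gcd p.1 p.2 = 1 ∧ 0 < |value F p| ∧ |value F p| ≤ h ∧
    B ≤ ((|value (hessian F) p| : ℤ) : ℝ)}

/-- The number of elements of a set of integer points, where `(x, y)` and `(-x, -y)` count
as one: the number of unordered pairs `{p, -p}` with `p` in the set (infinite if there are
infinitely many). -/
noncomputable def countUpToSign (S : Set (ℤ × ℤ)) : ℕ∞ :=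
  ((fun p : ℤ × ℤ => s(p, -p)) '' S).encard

/-- The number, up to sign, of primitive solutions of `0 < |F(x, y)| ≤ h` whose Hessian is at
least `hessianBound r m h j` in absolute value. -/
noncomputable def numLargeSolutions (F : MvPolynomial (Fin 2) ℤ) (r m : ℕ) (h : ℤ) (j : ℂ) :
    ℕ∞ :=
  countUpToSign (largeSolutions F h (hessianBound r m h j))

/-- The discriminant of the quadratic form `a x ^ 2 + b x y + c y ^ 2`. -/
def quadDisc (a b c : ℤ) : ℤ := b ^ 2 - 4 * a * c

end DiagThue

/-! The method is that of Thue and Siegel, with Padé approximants. Put ξ = αx + βy and η = γx + δy,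
so that F = ξ^r − η^r, and ρ = √|ξη|. The Hessian measures ρ: |H| = (r(r−1))²|j|²ρ^(2(r−2)). At a
large solution ξ/η = ω e^L with ω^r = 1 and |L| of order h/(r ρ^r) (`exists_nearRoot`). It suffices
to show that each ω belongs to at most m solutions and to count the possible ω: there are r for D <
0, two opposite ones for D > 0, one of them if r is odd. For D > 0 and F definite a large solution
would force a real zero of F, so there is none.

Two solutions with the same ω satisfy the gap principle |j|ρ^(r−1) ≤ hρ' (`NearRoot.gap`), because
ξη' − ξ'η is a nonzero integer multiple of j and also small. In terms of w = (ρ^(r−2)|j|/h)² it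
reads w^(r−1) ≤ w'. The exponents in the bound on H are such that m − 1 gaps lead to ρ ≥ r^10 h
max(|j|, 1)^r (`le_of_sizeBound_pow_le`), and beyond such a point no further solution exists
(`no_large_pair`).

This last fact uses Padé approximants to z^(1/r) at z = 1 with integer coefficients. Evaluated at
(ξ^r, η^r) for the smaller solution and combined with the linear forms at both, they give a number Λ
which is, up to a known factor, a sum or difference of conjugates a ± b√D. So Λ is bounded below if
it is nonzero (`Setting.norm_disc_le`), and above by the remainder of the approximation
(`NearRoot.norm_combination_le`). The remainder is a divided difference of x ↦ e^(xL), which shows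
its order and its size. A second family, from the derivative of the remainder, secures Λ ≠ 0: the
determinant of the two families is a constant times (z − 1)^(2n). The inequality for n bounds ρ'
below by a power of ρ, which makes the inequality for n + 1 usable; hence ρ' would exceed every
power of ρ. The bounds on j and D that this needs come from `Setting.norm_root_pow_le`, once the
quadratic form is made primitive. -/

namespace DiagThue

/-! ### Divided differences of the exponential function -/

/-- The divided difference of `x ↦ exp (x L)` at the nodes `s`. -/
noncomputable def expDD (s : Finset ℝ) (L : ℂ) : ℂ :=
  ∑ x ∈ s, (((∏ y ∈ s.erase x, (x - y))⁻¹ : ℝ) : ℂ) * Complex.exp (x * L)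

/-- At L = 0 the function is the constant 1, and the sum is a coefficient of positive degree of its
interpolation polynomial. -/
theorem expDD_zero {s : Finset ℝ} (hs : 1 < s.card) : expDD s 0 = 0 := by
  have h := Lagrange.coeff_eq_sum (s := s) (v := (id : ℝ → ℝ)) Function.injective_id.injOn
    (P := 1) (by rw [Polynomial.degree_one]; exact_mod_cast (by omega : 0 < s.card))
  rw [Polynomial.coeff_one, if_neg (by omega)] at h
  simp only [id, Polynomial.eval_one, one_div] at h
  simp only [expDD, mul_zero, Complex.exp_zero, mul_one]
  rw [← Complex.ofReal_sum, ← h]; rfl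

/-- The factor x − a cancels the node a from the weights. -/
theorem sum_weight_mul_exp {s : Finset ℝ} {a : ℝ} (ha : a ∈ s) (L : ℂ) :
    ∑ x ∈ s, (((∏ y ∈ s.erase x, (x - y))⁻¹ : ℝ) : ℂ) * (x * Complex.exp (x * L)) =
      a * expDD s L + expDD (s.erase a) L := by
  have h : ∀ x ∈ s.erase a, (((∏ y ∈ (s.erase a).erase x, (x - y))⁻¹ : ℝ) : ℂ) =
      (((∏ y ∈ s.erase x, (x - y))⁻¹ : ℝ) : ℂ) * (x - a) := by
    intro x hx
    have hxa : x - a ≠ 0 := sub_ne_zero.2 (Finset.ne_of_mem_erase hx)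
    have hm : a ∈ s.erase x := Finset.mem_erase.2 ⟨(Finset.ne_of_mem_erase hx).symm, ha⟩
    rw [← Finset.mul_prod_erase _ _ hm, Finset.erase_right_comm, ← Complex.ofReal_sub,
      ← Complex.ofReal_mul]
    congr 1
    rw [mul_inv]
    field_simp
  have h' : expDD (s.erase a) L = ∑ x ∈ s, (((∏ y ∈ s.erase x, (x - y))⁻¹ : ℝ) : ℂ) * (x - a) *
      Complex.exp (x * L) := by
    rw [← Finset.sum_erase (a := a) s (by simp)]
    exact Finset.sum_congr rfl fun x hx => by rw [h x hx]
  rw [h', expDD, Finset.mul_sum, ← Finset.sum_add_distrib]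
  refine Finset.sum_congr rfl fun x _ => ?_
  ring

theorem hasDerivAt_expDD {s : Finset ℝ} {a : ℝ} (ha : a ∈ s) (L : ℂ) :
    HasDerivAt (expDD s) (a * expDD s L + expDD (s.erase a) L) L := by
  rw [← sum_weight_mul_exp ha]
  unfold expDD
  refine HasDerivAt.fun_sum fun x _ => ?_
  have h : HasDerivAt (fun L : ℂ => (x : ℂ) * L) x L := by
    simpa using (hasDerivAt_id L).const_mul (x : ℂ)
  have := (h.cexp).const_mul (((∏ y ∈ s.erase x, (x - y))⁻¹ : ℝ) : ℂ)
  rwa [mul_comm (Complex.exp _)] at this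

/-- The usual bound by a derivative of order n, obtained by removing one node at a time:
`hasDerivAt_expDD` is a linear differential equation in L along the segment from 0 to L. -/
theorem norm_expDD_le (n : ℕ) : ∀ {s : Finset ℝ} {R : ℝ}, s.card = n + 1 →
    (∀ x ∈ s, |x| ≤ R) → ∀ L : ℂ,
    ‖expDD s L‖ ≤ ‖L‖ ^ n / n.factorial * Real.exp (R * ‖L‖) := by
  induction n with
  | zero =>
    intro s R hs hR L
    obtain ⟨a, rfl⟩ := Finset.card_eq_one.1 hs
    simp only [expDD, Finset.sum_singleton, Finset.erase_singleton, Finset.prod_empty, inv_one,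
      Complex.ofReal_one, one_mul, pow_zero, Nat.factorial_zero, Nat.cast_one, div_one]
    rw [Complex.norm_exp]
    gcongr
    calc ((a : ℂ) * L).re ≤ ‖(a : ℂ) * L‖ := Complex.re_le_norm _
      _ ≤ R * ‖L‖ := by
        rw [norm_mul, Complex.norm_real]
        exact mul_le_mul_of_nonneg_right (hR a (by simp)) (norm_nonneg _)
  | succ n ih =>
    intro s R hs hR L
    obtain ⟨a, ha⟩ : s.Nonempty := Finset.card_pos.1 (by omega)
    have hc : (s.erase a).card = n + 1 := by rw [Finset.card_erase_of_mem ha]; omega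
    have ih' := ih hc (fun x hx => hR x (Finset.mem_of_mem_erase hx))
    -- The exponential is an integrating factor: it removes the term a · `expDD s` from the
    -- derivative.
    let f : ℝ → ℂ := fun t => Complex.exp (a * ((1 - t) * L)) * expDD s (t * L)
    have hf : ∀ t : ℝ, HasDerivAt f
        (L * (Complex.exp (a * ((1 - t) * L)) * expDD (s.erase a) (t * L))) t := by
      intro t
      have h1 : HasDerivAt (fun t : ℂ => (a : ℂ) * ((1 - t) * L)) (a * (-1 * L)) t := by
        have := (((hasDerivAt_id (t : ℂ)).const_sub 1).mul_const L).const_mul (a : ℂ)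
        simpa using this
      have h2 : HasDerivAt (fun t : ℂ => t * L) L t := by
        simpa using (hasDerivAt_id (t : ℂ)).mul_const L
      have h3 := (hasDerivAt_expDD ha ((t : ℂ) * L)).comp (t : ℂ) h2
      have h4 : HasDerivAt f _ t := (h1.cexp.mul h3).comp_ofReal
      refine h4.congr_deriv ?_
      simp only [Function.comp_apply]
      ring
    have hB : ∀ t : ℝ, HasDerivAt
        (fun t : ℝ => t ^ (n + 1) * (‖L‖ ^ (n + 1) / (n + 1).factorial * Real.exp (R * ‖L‖)))
        (((n + 1 : ℕ) : ℝ) * t ^ n *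
          (‖L‖ ^ (n + 1) / (n + 1).factorial * Real.exp (R * ‖L‖))) t := by
      intro t
      simpa using (hasDerivAt_pow (n + 1) t).mul_const _
    have key := image_norm_le_of_norm_deriv_right_le_deriv_boundary (a := 0) (b := 1)
      (f := f) (f' := _)
      (fun t _ => (hf t).continuousAt.continuousWithinAt)
      (fun t _ => (hf t).hasDerivWithinAt) (B := _) (B' := _) ?_ hB ?_
      (Set.right_mem_Icc.2 zero_le_one)
    · simpa [f] using key
    · simp [f, expDD_zero (show 1 < s.card by omega)]
    · intro t ht
      have h5 := ih' (t * L)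
      rw [norm_mul, norm_mul, Complex.norm_exp]
      have h6 : ((a : ℂ) * ((1 - t) * L)).re ≤ R * ((1 - t) * ‖L‖) := by
        refine (Complex.re_le_norm _).trans ?_
        rw [norm_mul, norm_mul, Complex.norm_real, ← Complex.ofReal_one, ← Complex.ofReal_sub,
          Complex.norm_real, Real.norm_of_nonneg (by linarith [ht.2] : (0 : ℝ) ≤ 1 - t)]
        exact mul_le_mul_of_nonneg_right (hR a ha)
          (mul_nonneg (by linarith [ht.2]) (norm_nonneg _))
      rw [norm_mul, Complex.norm_real, Real.norm_of_nonneg ht.1] at h5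
      calc ‖L‖ * (Real.exp _ * ‖expDD (s.erase a) (t * L)‖)
          ≤ ‖L‖ * (Real.exp (R * ((1 - t) * ‖L‖)) *
            ((t * ‖L‖) ^ n / n.factorial * Real.exp (R * (t * ‖L‖)))) := by gcongr
        _ = _ := by
          rw [mul_left_comm (Real.exp _), ← Real.exp_add, Nat.factorial_succ]
          have e : R * ((1 - t) * ‖L‖) + R * (t * ‖L‖) = R * ‖L‖ := by ring
          rw [e]
          push_cast
          field_simp
          ring

/-! ### Integrality and size of the Padé coefficients -/

open Finset

/-- The product of a progression with difference `r`, times a power of `r`, is divisible by a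
factorial. -/
theorem factorial_dvd_pow_mul_prod (r s : ℕ) (a : ℤ) :
    (s.factorial : ℤ) ∣ (r : ℤ) ^ s * ∏ i ∈ range s, (a + i * r) := by
  rw [Int.natCast_dvd, Nat.dvd_iff_prime_pow_dvd_dvd]
  intro p k hp hk
  rw [← Int.natCast_dvd]
  -- If p divides r, the power r ^ s suffices, as s! has p-adic valuation at most s. Otherwise the
  -- inverse t of r modulo p ^ k turns the progression into consecutive integers.
  by_cases hpr : p ∣ r
  · have : Fact p.Prime := ⟨hp⟩
    have hks : k ≤ s := by
      have h1 := (padicValNat_dvd_iff_le s.factorial_ne_zero).1 hk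
      have h2 := sub_one_mul_padicValNat_factorial (p := p) s
      have h3 : 1 * padicValNat p s.factorial ≤ (p - 1) * padicValNat p s.factorial :=
        Nat.mul_le_mul_right _ (by have := hp.two_le; omega)
      omega
    have : p ^ k ∣ r ^ s := (pow_dvd_pow_of_dvd hpr k).trans (pow_dvd_pow r hks)
    exact Dvd.dvd.mul_right (by exact_mod_cast this) _
  · have hcop : r.Coprime (p ^ k) := ((hp.coprime_iff_not_dvd.2 hpr).symm).pow_right k
    obtain ⟨t, ht⟩ := Int.mod_coprime hcop
    have h1 : t ^ s * ∏ i ∈ range s, (a + i * r) ≡ ∏ i ∈ range s, (t * a + i)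
        [ZMOD (p ^ k : ℕ)] := by
      have e : t ^ s = ∏ i ∈ range s, t := by simp
      rw [e, ← Finset.prod_mul_distrib]
      refine Int.ModEq.prod fun i _ => ?_
      have := (ht.mul_left (i : ℤ)).add_left (t * a)
      calc t * (a + i * r) = t * a + i * (r * t) := by ring
        _ ≡ t * a + i * 1 [ZMOD (p ^ k : ℕ)] := this
        _ = t * a + i := by ring
    have h2 : ((p ^ k : ℕ) : ℤ) ∣ ∏ i ∈ range s, (t * a + i) :=
      (Int.natCast_dvd_natCast.2 hk).trans (Nat.factorial_coe_dvd_prod s _)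
    have h3 : ((p ^ k : ℕ) : ℤ) ∣ t ^ s * ∏ i ∈ range s, (a + i * r) :=
      h1.dvd_iff.2 h2
    have h4 : IsCoprime ((p ^ k : ℕ) : ℤ) t := by
      obtain ⟨c, hc⟩ := ht.dvd
      exact ⟨c, r, by linarith⟩
    exact Dvd.dvd.mul_left (h4.pow_right.dvd_of_dvd_mul_left h3) _

/-- `∏_{i ≤ k} (i r - 1)`. -/
def progMinus (r k : ℕ) : ℝ := ∏ i ∈ range k, (((i : ℝ) + 1) * r - 1)

/-- `∏_{i ≤ k} (i r + 1)`. -/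
def progPlus (r k : ℕ) : ℝ := ∏ i ∈ range k, (((i : ℝ) + 1) * r + 1)

theorem progMinus_pos {r : ℕ} (hr : 2 ≤ r) (k : ℕ) : 0 < progMinus r k := by
  refine Finset.prod_pos fun i _ => ?_
  have : (2 : ℝ) ≤ r := by exact_mod_cast hr
  nlinarith [(Nat.cast_nonneg i : (0 : ℝ) ≤ i)]

theorem progPlus_pos (r k : ℕ) : 0 < progPlus r k :=
  Finset.prod_pos fun i _ => by positivity

/-- The coefficients of the Padé approximants to `z ^ (1 / r)`, cleared of denominators. -/
def padeCoeff (r n k : ℕ) : ℤ :=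
  (r : ℤ) ^ n * (∏ i ∈ range (n - k), (((k : ℤ) + 1) * r - 1 + i * r)) *
    (∏ i ∈ range k, (((n - k : ℕ) + 1 : ℤ) * r + 1 + i * r)) /
    ((k.factorial : ℤ) * (n - k).factorial)

/-- The integer division in `padeCoeff` is exact: r ^ n supplies r ^ k and r ^ (n − k) for the two
progressions. -/
theorem padeCoeff_mul {r n k : ℕ} (hk : k ≤ n) :
    padeCoeff r n k * ((k.factorial : ℤ) * (n - k).factorial) =
      (r : ℤ) ^ n * (∏ i ∈ range (n - k), (((k : ℤ) + 1) * r - 1 + i * r)) *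
        (∏ i ∈ range k, (((n - k : ℕ) + 1 : ℤ) * r + 1 + i * r)) := by
  refine Int.ediv_mul_cancel ?_
  have h1 := factorial_dvd_pow_mul_prod r (n - k) (((k : ℤ) + 1) * r - 1)
  have h2 := factorial_dvd_pow_mul_prod r k (((n - k : ℕ) + 1 : ℤ) * r + 1)
  have h3 := mul_dvd_mul h2 h1
  have : (r : ℤ) ^ n = (r : ℤ) ^ k * (r : ℤ) ^ (n - k) := by rw [← pow_add]; congr 1; omega
  rw [this]
  refine h3.trans (dvd_of_eq ?_)
  ring

theorem padeCoeff_eq {r n k : ℕ} (hr : 2 ≤ r) (hk : k ≤ n) :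
    (padeCoeff r n k : ℝ) = r ^ n / (k.factorial * (n - k).factorial) *
      (progMinus r n / progMinus r k) * (progPlus r n / progPlus r (n - k)) := by
  have h := congrArg (Int.cast : ℤ → ℝ) (padeCoeff_mul (r := r) hk)
  push_cast at h
  have hm : progMinus r n = progMinus r k *
      ∏ i ∈ range (n - k), (((k : ℝ) + 1) * r - 1 + i * r) := by
    obtain ⟨m, rfl⟩ := Nat.exists_eq_add_of_le hk
    rw [progMinus, Finset.prod_range_add, progMinus, Nat.add_sub_cancel_left]
    congr 1
    refine Finset.prod_congr rfl fun i _ => ?_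
    push_cast; ring
  have hp : progPlus r n = progPlus r (n - k) *
      ∏ i ∈ range k, (((n - k : ℕ) + 1 : ℝ) * r + 1 + i * r) := by
    obtain ⟨m, rfl⟩ := Nat.exists_eq_add_of_le' hk
    rw [progPlus, Nat.add_sub_cancel, Finset.prod_range_add, progPlus]
    congr 1
    refine Finset.prod_congr rfl fun i _ => ?_
    push_cast; ring
  rw [hm, hp, mul_div_cancel_left₀ _ (progMinus_pos hr k).ne',
    mul_div_cancel_left₀ _ (progPlus_pos r _).ne']
  have : ((k.factorial : ℝ) * (n - k).factorial) ≠ 0 := by positivity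
  rw [← mul_right_cancel_iff_of_pos (lt_of_le_of_ne (by positivity) this.symm), h]
  field_simp

theorem padeCoeff_pos {r n k : ℕ} (hr : 2 ≤ r) (hk : k ≤ n) : 0 < padeCoeff r n k := by
  have h : (0 : ℝ) < padeCoeff r n k := by
    rw [padeCoeff_eq hr hk]
    have := progMinus_pos hr n
    have := progMinus_pos hr k
    have := progPlus_pos r n
    have := progPlus_pos r (n - k)
    positivity
  exact_mod_cast h

/-- Factor by factor, (k+1+i)r − 1 ≤ (k+1+i)r and (n−k+1+i)r + 1 ≤ (n−k+2+i)r; what remains is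
powers of r and binomial coefficients. -/
theorem padeCoeff_le {r n k : ℕ} (hr : 2 ≤ r) (hk : k ≤ n) :
    padeCoeff r n k ≤ (r : ℤ) ^ (2 * n) * n.choose k * (n + 1).choose k := by
  have hpos : (0 : ℤ) < (k.factorial : ℤ) * (n - k).factorial := by positivity
  refine le_of_mul_le_mul_right ?_ hpos
  rw [padeCoeff_mul hk]
  have hr' : (2 : ℤ) ≤ r := by exact_mod_cast hr
  have h1 : ∏ i ∈ range (n - k), (((k : ℤ) + 1) * r - 1 + i * r) ≤
      (r : ℤ) ^ (n - k) * (n.choose k * (n - k).factorial) := by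
    have : (n.choose k * (n - k).factorial : ℤ) = ∏ i ∈ range (n - k), ((k : ℤ) + 1 + i) := by
      obtain ⟨m, rfl⟩ := Nat.exists_eq_add_of_le hk
      rw [Nat.add_sub_cancel_left]
      have := Nat.ascFactorial_eq_prod_range (k + 1) m
      have h2 : (k + m).choose k * m.factorial = (k + 1).ascFactorial m := by
        rw [Nat.ascFactorial_eq_factorial_mul_choose, Nat.choose_symm_add, mul_comm]
      have h3 := h2.trans this
      exact_mod_cast h3
    have e : (r : ℤ) ^ (n - k) = ∏ i ∈ range (n - k), (r : ℤ) := by simp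
    rw [this, e, ← Finset.prod_mul_distrib]
    refine Finset.prod_le_prod (fun i _ => ?_) fun i _ => ?_
    · nlinarith [(Nat.cast_nonneg i : (0 : ℤ) ≤ i), (Nat.cast_nonneg k : (0 : ℤ) ≤ k)]
    · nlinarith
  have h2 : ∏ i ∈ range k, (((n - k : ℕ) + 1 : ℤ) * r + 1 + i * r) ≤
      (r : ℤ) ^ k * ((n + 1).choose k * k.factorial) := by
    have : ((n + 1).choose k * k.factorial : ℤ) =
        ∏ i ∈ range k, (((n - k : ℕ) : ℤ) + 1 + 1 + i) := by
      obtain ⟨m, rfl⟩ := Nat.exists_eq_add_of_le' hk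
      rw [Nat.add_sub_cancel]
      have := Nat.ascFactorial_eq_prod_range (m + 1 + 1) k
      have h2 : (m + k + 1).choose k * k.factorial = (m + 1 + 1).ascFactorial k := by
        rw [Nat.ascFactorial_eq_factorial_mul_choose, mul_comm, add_right_comm]
      have h3 := h2.trans this
      exact_mod_cast h3
    have e : (r : ℤ) ^ k = ∏ i ∈ range k, (r : ℤ) := by simp
    rw [this, e, ← Finset.prod_mul_distrib]
    refine Finset.prod_le_prod (fun i _ => by positivity) fun i _ => ?_
    nlinarith
  have h3 : (0 : ℤ) ≤ ∏ i ∈ range k, (((n - k : ℕ) + 1 : ℤ) * r + 1 + i * r) :=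
    Finset.prod_nonneg fun i _ => by positivity
  calc _ ≤ (r : ℤ) ^ n * ((r : ℤ) ^ (n - k) * (n.choose k * (n - k).factorial)) *
      ((r : ℤ) ^ k * ((n + 1).choose k * k.factorial)) := by gcongr
    _ = _ := by
      have : (r : ℤ) ^ (2 * n) = (r : ℤ) ^ n * ((r : ℤ) ^ (n - k) * (r : ℤ) ^ k) := by
        rw [← pow_add, ← pow_add]; congr 1; omega
      rw [this]; ring

theorem sum_padeCoeff_le {r n : ℕ} (hr : 2 ≤ r) :
    ∑ k ∈ range (n + 1), padeCoeff r n k ≤ 2 * (4 * (r : ℤ) ^ 2) ^ n := by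
  calc ∑ k ∈ range (n + 1), padeCoeff r n k
      ≤ ∑ k ∈ range (n + 1), (r : ℤ) ^ (2 * n) * 2 ^ (n + 1) * n.choose k := by
        refine Finset.sum_le_sum fun k hk => (padeCoeff_le hr (by simpa [Nat.lt_succ_iff] using hk)).trans ?_
        have : ((n + 1).choose k : ℤ) ≤ 2 ^ (n + 1) := by exact_mod_cast Nat.choose_le_two_pow _ _
        calc _ ≤ (r : ℤ) ^ (2 * n) * n.choose k * 2 ^ (n + 1) := by gcongr
          _ = _ := by ring
    _ = _ := by
      rw [← Finset.mul_sum]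
      have : ∑ k ∈ range (n + 1), (n.choose k : ℤ) = 2 ^ n := by
        exact_mod_cast Nat.sum_range_choose n
      rw [this, mul_pow, ← pow_mul, show (4 : ℤ) = 2 * 2 by norm_num, mul_pow]
      ring

/-! ### Nodes and weights of the approximants -/

/-- The smaller nodes `k r - (n r + 1) / 2`. The nodes are these and these plus one. -/
noncomputable def node (r n k : ℕ) : ℝ := k * r - (n * r + 1) / 2

/-- The nodes of the Padé approximants. -/
noncomputable def nodes (r n : ℕ) : Finset ℝ :=
  (range (n + 1)).image (node r n) ∪ (range (n + 1)).image (fun k => node r n k + 1)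

theorem node_sub (r n k l : ℕ) : node r n k - node r n l = ((k : ℤ) - l : ℤ) * r := by
  simp only [node]; push_cast; ring

theorem node_injective {r : ℕ} (hr : 2 ≤ r) (n : ℕ) : Function.Injective (node r n) := by
  intro k l h
  have h' : ((k : ℝ) - l) * r = 0 := by
    have := node_sub r n k l
    rw [h, sub_self] at this
    push_cast at this
    exact this.symm
  have hr' : (r : ℝ) ≠ 0 := by positivity
  have := (mul_eq_zero.1 h').resolve_right hr'
  exact_mod_cast sub_eq_zero.1 this

theorem node_ne {r : ℕ} (hr : 2 ≤ r) (n k l : ℕ) : node r n k ≠ node r n l + 1 := by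
  intro h
  have h' : (((k : ℤ) - l : ℤ) : ℝ) * r = 1 := by
    rw [← node_sub r n k l]; linarith
  have h2 : ((k : ℤ) - l) * r = 1 := by exact_mod_cast h'
  have := Int.isUnit_iff.1 (IsUnit.of_mul_eq_one _ ((mul_comm _ _).trans h2))
  omega

theorem disjoint_nodes {r : ℕ} (hr : 2 ≤ r) (n : ℕ) :
    Disjoint ((range (n + 1)).image (node r n))
      ((range (n + 1)).image (fun k => node r n k + 1)) := by
  rw [Finset.disjoint_left]
  intro x hx hx'
  obtain ⟨k, _, rfl⟩ := Finset.mem_image.1 hx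
  obtain ⟨l, _, h⟩ := Finset.mem_image.1 hx'
  exact node_ne hr n k l h.symm

theorem node_add_one_injective {r : ℕ} (hr : 2 ≤ r) (n : ℕ) :
    Function.Injective (fun k => node r n k + 1) :=
  fun _ _ h => node_injective hr n (add_right_cancel h)

theorem card_nodes {r : ℕ} (hr : 2 ≤ r) (n : ℕ) : (nodes r n).card = 2 * n + 1 + 1 := by
  rw [nodes, Finset.card_union_of_disjoint (disjoint_nodes hr n),
    Finset.card_image_of_injective _ (node_injective hr n),
    Finset.card_image_of_injective _ (node_add_one_injective hr n), Finset.card_range]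
  ring

theorem abs_le_of_mem_nodes {r n : ℕ} {x : ℝ} (hx : x ∈ nodes r n) :
    |x| ≤ ((n : ℝ) * r + 1) / 2 := by
  have h : ∀ k ∈ range (n + 1), (0 : ℝ) ≤ k * r ∧ (k * r : ℝ) ≤ n * r := by
    intro k hk
    have : (k : ℝ) ≤ n := by exact_mod_cast Nat.lt_succ_iff.1 (Finset.mem_range.1 hk)
    exact ⟨by positivity, by gcongr⟩
  rw [nodes, Finset.mem_union, Finset.mem_image, Finset.mem_image] at hx
  rw [abs_le]
  obtain ⟨k, hk, rfl⟩ | ⟨k, hk, rfl⟩ := hx <;> have := h k hk <;> simp only [node] <;>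
    constructor <;> linarith

/-- Separates the positive, zero and negative differences k − l, so that products over nodes become
factorials, `progMinus` and `progPlus`. -/
theorem prod_range_int_sub (g : ℤ → ℝ) (k m : ℕ) :
    ∏ l ∈ range (k + (m + 1)), g ((k : ℤ) - l) =
      (∏ i ∈ range k, g (i + 1)) * (g 0 * ∏ i ∈ range m, g (-(i + 1))) := by
  rw [Finset.prod_range_add, Finset.prod_range_succ', ← Finset.prod_range_reflect, mul_comm (g 0)]
  congr 1
  · refine Finset.prod_congr rfl fun i hi => ?_
    have := Finset.mem_range.1 hi
    congr 1
    omega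
  · congr 1
    · refine Finset.prod_congr rfl fun i hi => ?_
      congr 1
      push_cast
      ring
    · simp

theorem prod_erase_node_sub {r : ℕ} (k m : ℕ) :
    ∏ l ∈ (range (k + (m + 1))).erase k, (node r (k + m) k - node r (k + m) l) =
      (-1) ^ m * r ^ (k + m) * (k.factorial * m.factorial) := by
  -- The value 1 at difference 0 stands for the omitted factor l = k.
  have h : ∏ l ∈ (range (k + (m + 1))).erase k, (node r (k + m) k - node r (k + m) l) =
      ∏ l ∈ range (k + (m + 1)), (fun z : ℤ => if z = 0 then (1 : ℝ) else z * r) ((k : ℤ) - l) := by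
    rw [← Finset.mul_prod_erase _ _ (Finset.mem_range.2 (by omega : k < k + (m + 1)))]
    simp only [sub_self, if_true, one_mul]
    refine Finset.prod_congr rfl fun l hl => ?_
    have : (k : ℤ) - l ≠ 0 := by
      have := Finset.ne_of_mem_erase hl
      omega
    rw [node_sub, if_neg this]
  have h1 : ∀ i : ℕ, ((i : ℤ) + 1) ≠ 0 := fun i => by omega
  have h2 : ∀ i : ℕ, (-((i : ℤ) + 1)) ≠ 0 := fun i => by omega
  rw [h, prod_range_int_sub (fun z : ℤ => if z = 0 then (1 : ℝ) else z * r) k m]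
  simp only [if_true, if_neg (h1 _), if_neg (h2 _), one_mul]
  push_cast
  have e1 : ∀ j : ℕ, ∏ i ∈ range j, ((i : ℝ) + 1) = j.factorial := by
    intro j
    rw [← Finset.prod_range_add_one_eq_factorial]
    push_cast
    rfl
  have e3 : ∏ i ∈ range m, (-((i : ℝ) + 1) * r) = ∏ i ∈ range m, (((-1) * r) * ((i : ℝ) + 1)) :=
    Finset.prod_congr rfl fun i _ => by ring
  simp only [e3, Finset.prod_mul_distrib, e1, Finset.prod_const, Finset.card_range]
  rw [pow_add]
  ring

theorem prod_node_sub_add_one {r : ℕ} (k m : ℕ) :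
    ∏ l ∈ range (k + (m + 1)), (node r (k + m) k - (node r (k + m) l + 1)) =
      -(-1) ^ m * (progMinus r k * progPlus r m) := by
  have h : ∏ l ∈ range (k + (m + 1)), (node r (k + m) k - (node r (k + m) l + 1)) =
      ∏ l ∈ range (k + (m + 1)), (fun z : ℤ => (z * r - 1 : ℝ)) ((k : ℤ) - l) :=
    Finset.prod_congr rfl fun l _ => by simp only [← node_sub r (k + m)]; ring
  have e : ∀ i : ℕ, ((-((i : ℤ) + 1) : ℤ) : ℝ) * r - 1 = (-1) * (((i : ℝ) + 1) * r + 1) := by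
    intro i; push_cast; ring
  rw [h, prod_range_int_sub (fun z : ℤ => (z * r - 1 : ℝ)) k m]
  simp only [e, Finset.prod_mul_distrib, Finset.prod_const, Finset.card_range]
  simp only [progMinus, progPlus]
  push_cast
  ring

theorem prod_node_add_one_sub {r : ℕ} (k m : ℕ) :
    ∏ l ∈ range (k + (m + 1)), (node r (k + m) k + 1 - node r (k + m) l) =
      (-1) ^ m * (progPlus r k * progMinus r m) := by
  have h : ∏ l ∈ range (k + (m + 1)), (node r (k + m) k + 1 - node r (k + m) l) =
      ∏ l ∈ range (k + (m + 1)), (fun z : ℤ => (z * r + 1 : ℝ)) ((k : ℤ) - l) :=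
    Finset.prod_congr rfl fun l _ => by simp only [← node_sub r (k + m)]; ring
  have e : ∀ i : ℕ, ((-((i : ℤ) + 1) : ℤ) : ℝ) * r + 1 = (-1) * (((i : ℝ) + 1) * r - 1) := by
    intro i; push_cast; ring
  rw [h, prod_range_int_sub (fun z : ℤ => (z * r + 1 : ℝ)) k m]
  simp only [e, Finset.prod_mul_distrib, Finset.prod_const, Finset.card_range]
  simp only [progMinus, progPlus]
  push_cast
  ring

/-- The common denominator of the weights at the nodes. -/
noncomputable def padeScale (r n : ℕ) : ℝ := r ^ (2 * n) * (progMinus r n * progPlus r n)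

theorem padeScale_mul_weight {r n k : ℕ} (hr : 2 ≤ r) (hk : k ≤ n) :
    padeScale r n * (∏ y ∈ (nodes r n).erase (node r n k), (node r n k - y))⁻¹ =
      -padeCoeff r n k := by
  have h : (nodes r n).erase (node r n k) = ((range (n + 1)).erase k).image (node r n) ∪
      (range (n + 1)).image (fun k => node r n k + 1) := by
    rw [nodes, Finset.erase_union_distrib, Finset.image_erase (node_injective hr n)]
    congr 1
    refine Finset.erase_eq_of_notMem fun hm => ?_
    obtain ⟨l, _, h⟩ := Finset.mem_image.1 hm
    exact node_ne hr n k l h.symm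
  rw [h, Finset.prod_union, Finset.prod_image ((node_injective hr n).injOn),
    Finset.prod_image ((node_add_one_injective hr n).injOn), padeCoeff_eq hr hk]
  · obtain ⟨m, rfl⟩ := Nat.exists_eq_add_of_le hk
    rw [add_assoc, prod_erase_node_sub, prod_node_sub_add_one, Nat.add_sub_cancel_left, padeScale]
    have := (progMinus_pos hr k).ne'
    have := (progPlus_pos r m).ne'
    have : (r : ℝ) ≠ 0 := by positivity
    have h1 : ((-1 : ℝ) ^ m) * (-1) ^ m = 1 := by rw [← mul_pow]; simp
    have h2 : ((-1 : ℝ) ^ m) ≠ 0 := by positivity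
    have e : (-1 : ℝ) ^ m * r ^ (k + m) * (k.factorial * m.factorial) *
      (-(-1) ^ m * (progMinus r k * progPlus r m)) = -(((-1 : ℝ) ^ m) * (-1) ^ m) * (r ^ (k + m) *
        (k.factorial * m.factorial) * (progMinus r k * progPlus r m)) := by ring
    rw [e, h1]
    field_simp
    ring
  · refine Finset.disjoint_of_subset_left (Finset.image_subset_image (Finset.erase_subset _ _))
      (disjoint_nodes hr n)

/-- The nodes are symmetric about 0, with `node r n k + 1` opposite to `node r n (n - k)`; hence the
reflected coefficient. -/
theorem padeScale_mul_weight' {r n k : ℕ} (hr : 2 ≤ r) (hk : k ≤ n) :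
    padeScale r n * (∏ y ∈ (nodes r n).erase (node r n k + 1), (node r n k + 1 - y))⁻¹ =
      padeCoeff r n (n - k) := by
  have h : (nodes r n).erase (node r n k + 1) = (range (n + 1)).image (node r n) ∪
      ((range (n + 1)).erase k).image (fun k => node r n k + 1) := by
    rw [nodes, Finset.erase_union_distrib, Finset.image_erase (node_add_one_injective hr n)]
    congr 1
    refine Finset.erase_eq_of_notMem fun hm => ?_
    obtain ⟨l, _, h⟩ := Finset.mem_image.1 hm
    exact node_ne hr n l k h
  rw [h, Finset.prod_union, Finset.prod_image ((node_injective hr n).injOn),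
    Finset.prod_image ((node_add_one_injective hr n).injOn), padeCoeff_eq hr (Nat.sub_le n k)]
  · obtain ⟨m, rfl⟩ := Nat.exists_eq_add_of_le hk
    simp only [add_sub_add_right_eq_sub]
    rw [add_assoc, prod_erase_node_sub, prod_node_add_one_sub, Nat.add_sub_cancel_left,
      Nat.add_sub_cancel, padeScale]
    have := (progMinus_pos hr m).ne'
    have := (progPlus_pos r k).ne'
    have : (r : ℝ) ≠ 0 := by positivity
    have h1 : ((-1 : ℝ) ^ m) * (-1) ^ m = 1 := by rw [← mul_pow]; simp
    have h2 : ((-1 : ℝ) ^ m) ≠ 0 := by positivity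
    have e : (-1 : ℝ) ^ m * (progPlus r k * progMinus r m) *
        ((-1 : ℝ) ^ m * r ^ (k + m) * (k.factorial * m.factorial)) =
      (((-1 : ℝ) ^ m) * (-1) ^ m) * (r ^ (k + m) *
        (k.factorial * m.factorial) * (progPlus r k * progMinus r m)) := by ring
    rw [e, h1]
    field_simp
    ring
  · refine Finset.disjoint_of_subset_right (Finset.image_subset_image (Finset.erase_subset _ _))
      (disjoint_nodes hr n)

/-- Identifies the Padé combination with a multiple of a divided difference. It is used for f(x) =
e^(xL) and f(x) = 2x e^(xL), one for each family. -/
theorem sum_padeCoeff_mul {r n : ℕ} (hr : 2 ≤ r) (f : ℝ → ℂ) :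
    ∑ k ∈ range (n + 1), (padeCoeff r n k : ℂ) * f (node r n k) -
      ∑ k ∈ range (n + 1), (padeCoeff r n (n - k) : ℂ) * f (node r n k + 1) =
    -((padeScale r n : ℂ) * ∑ x ∈ nodes r n,
      (((∏ y ∈ (nodes r n).erase x, (x - y))⁻¹ : ℝ) : ℂ) * f x) := by
  have h : ∀ x, (nodes r n).erase x = (nodes r n).erase x := fun _ => rfl
  nth_rewrite 1 [nodes]
  rw [Finset.sum_union (disjoint_nodes hr n),
    Finset.sum_image ((node_injective hr n).injOn),
    Finset.sum_image ((node_add_one_injective hr n).injOn), mul_add, neg_add, Finset.mul_sum,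
    Finset.mul_sum, ← Finset.sum_neg_distrib, sub_eq_add_neg]
  congr 1
  · refine Finset.sum_congr rfl fun k hk => ?_
    have := padeScale_mul_weight (n := n) hr (Nat.lt_succ_iff.1 (Finset.mem_range.1 hk))
    rw [← mul_assoc, ← Complex.ofReal_mul, this]
    push_cast
    ring
  · congr 1
    refine Finset.sum_congr rfl fun k hk => ?_
    have := padeScale_mul_weight' (n := n) hr (Nat.lt_succ_iff.1 (Finset.mem_range.1 hk))
    rw [← mul_assoc, ← Complex.ofReal_mul, this]
    push_cast
    ring

theorem padeScale_nonneg {r : ℕ} (hr : 2 ≤ r) (n : ℕ) : 0 ≤ padeScale r n := by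
  have := progMinus_pos hr n
  have := progPlus_pos r n
  unfold padeScale; positivity

/-- Uses (ir − 1)(ir + 1) ≤ (ir)². The factorial will cancel against the one in `norm_expDD_le`,
leaving only geometric growth. -/
theorem padeScale_le {r : ℕ} (hr : 2 ≤ r) (n : ℕ) :
    padeScale r n ≤ (r : ℝ) ^ (4 * n) * (2 * n).factorial := by
  have h1 : progMinus r n * progPlus r n ≤ r ^ (2 * n) * ((n.factorial : ℝ) * n.factorial) := by
    have e : (n.factorial : ℝ) = ∏ i ∈ range n, ((i : ℝ) + 1) := by
      rw [← Finset.prod_range_add_one_eq_factorial]; push_cast; rfl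
    have e' : (r : ℝ) ^ (2 * n) = ∏ i ∈ range n, (r : ℝ) ^ 2 := by simp [pow_mul]
    rw [e, e', progMinus, progPlus, ← Finset.prod_mul_distrib, ← Finset.prod_mul_distrib,
      ← Finset.prod_mul_distrib]
    have hr' : (2 : ℝ) ≤ r := by exact_mod_cast hr
    refine Finset.prod_le_prod (fun i _ => ?_) fun i _ => ?_
    · have : (0 : ℝ) ≤ ((i : ℝ) + 1) * r - 1 := by
        nlinarith [(Nat.cast_nonneg i : (0 : ℝ) ≤ i)]
      positivity
    · nlinarith
  have h2 : ((n.factorial : ℝ) * n.factorial) ≤ (2 * n).factorial := by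
    have := Nat.le_of_dvd (Nat.factorial_pos _) (Nat.factorial_mul_factorial_dvd_factorial_add n n)
    rw [← two_mul] at this
    exact_mod_cast this
  calc padeScale r n ≤ r ^ (2 * n) * (r ^ (2 * n) * ((2 * n).factorial : ℝ)) := by
        unfold padeScale
        exact mul_le_mul_of_nonneg_left (h1.trans (by gcongr)) (by positivity)
    _ = _ := by rw [← mul_assoc, ← pow_add]; congr 2; ring

/-! ### The two remainders -/

/-- The remainder `e ^ (-(n r + 1) L / 2) (A(z) - z ^ (1 / r) B(z))` at `z = e ^ (r L)`. -/
noncomputable def padeRem (r n : ℕ) (L : ℂ) : ℂ :=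
  ∑ k ∈ range (n + 1), (padeCoeff r n k : ℂ) * Complex.exp (node r n k * L) -
    ∑ k ∈ range (n + 1), (padeCoeff r n (n - k) : ℂ) * Complex.exp ((node r n k + 1 : ℝ) * L)

/-- Twice the derivative of `padeRem`. -/
noncomputable def padeRem' (r n : ℕ) (L : ℂ) : ℂ :=
  ∑ k ∈ range (n + 1), (padeCoeff r n k : ℂ) * ((2 * node r n k : ℝ) * Complex.exp (node r n k * L)) -
    ∑ k ∈ range (n + 1), (padeCoeff r n (n - k) : ℂ) *
      ((2 * (node r n k + 1) : ℝ) * Complex.exp ((node r n k + 1 : ℝ) * L))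

/-- A common bound for both remainders. -/
noncomputable def padeBound (r n : ℕ) (t : ℝ) : ℝ :=
  2 * r ^ (4 * n) * t ^ (2 * n) * (1 + (n * r + 1) * t) * Real.exp ((n * r + 1) / 2 * t)

theorem padeScale_div_le {r : ℕ} (hr : 2 ≤ r) (n : ℕ) :
    padeScale r n / (2 * n).factorial ≤ (r : ℝ) ^ (4 * n) := by
  rw [div_le_iff₀ (by positivity)]
  exact padeScale_le hr n

/-- A divided difference at 2n + 2 nodes has order 2n + 1 in L; the last power goes into the factor
1 + (nr + 1)t, so that `padeBound` serves both families. -/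
theorem norm_padeRem_le {r : ℕ} (hr : 2 ≤ r) (n : ℕ) (L : ℂ) :
    ‖padeRem r n L‖ ≤ padeBound r n ‖L‖ := by
  rw [padeRem, sum_padeCoeff_mul hr (fun x => Complex.exp (x * L)), norm_neg, norm_mul,
    Complex.norm_real, Real.norm_of_nonneg (padeScale_nonneg hr n)]
  have h := norm_expDD_le (2 * n + 1) (card_nodes hr n) (fun x hx => abs_le_of_mem_nodes hx) L
  rw [expDD] at h
  have h3 := padeScale_div_le hr n
  have h4 : (0 : ℝ) < (2 * n).factorial := by positivity
  calc _ ≤ padeScale r n * (‖L‖ ^ (2 * n + 1) / (2 * n + 1).factorial *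
        Real.exp (((n : ℝ) * r + 1) / 2 * ‖L‖)) :=
        mul_le_mul_of_nonneg_left h (padeScale_nonneg hr n)
    _ ≤ padeScale r n * (‖L‖ ^ (2 * n + 1) / (2 * n).factorial *
        Real.exp (((n : ℝ) * r + 1) / 2 * ‖L‖)) := by
        have := padeScale_nonneg hr n
        have : (2 * n).factorial ≤ (2 * n + 1).factorial := Nat.factorial_le (by omega)
        gcongr
    _ = padeScale r n / (2 * n).factorial * ‖L‖ ^ (2 * n) * ‖L‖ *
        Real.exp (((n : ℝ) * r + 1) / 2 * ‖L‖) := by ring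
    _ ≤ (r : ℝ) ^ (4 * n) * ‖L‖ ^ (2 * n) * (2 * (1 + (n * r + 1) * ‖L‖)) *
        Real.exp (((n : ℝ) * r + 1) / 2 * ‖L‖) := by
        gcongr
        nlinarith [norm_nonneg L, mul_nonneg (mul_nonneg (Nat.cast_nonneg (α := ℝ) n)
          (Nat.cast_nonneg (α := ℝ) r)) (norm_nonneg L)]
    _ = _ := by rw [padeBound]; ring

/-- The extra factor x costs one order: `sum_weight_mul_exp` brings in a divided difference with one
node fewer. -/
theorem norm_padeRem'_le {r : ℕ} (hr : 2 ≤ r) (n : ℕ) (L : ℂ) :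
    ‖padeRem' r n L‖ ≤ padeBound r n ‖L‖ := by
  obtain ⟨a, ha⟩ : (nodes r n).Nonempty := Finset.card_pos.1 (by rw [card_nodes hr n]; omega)
  have hM := fun x (hx : x ∈ nodes r n) => abs_le_of_mem_nodes hx
  have h1 := norm_expDD_le (2 * n + 1) (card_nodes hr n) hM L
  have h2 := norm_expDD_le (2 * n) (s := (nodes r n).erase a)
    (by rw [Finset.card_erase_of_mem ha, card_nodes hr n]; omega)
    (fun x hx => hM x (Finset.mem_of_mem_erase hx)) L
  have e : ∑ x ∈ nodes r n, (((∏ y ∈ (nodes r n).erase x, (x - y))⁻¹ : ℝ) : ℂ) *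
      ((2 * x : ℝ) * Complex.exp (x * L)) =
      2 * (a * expDD (nodes r n) L + expDD ((nodes r n).erase a) L) := by
    rw [← sum_weight_mul_exp ha, Finset.mul_sum]
    refine Finset.sum_congr rfl fun x _ => ?_
    push_cast; ring
  have h5 := padeScale_nonneg hr n
  rw [padeRem', sum_padeCoeff_mul hr (fun x => (2 * x : ℝ) * Complex.exp (x * L)), norm_neg, norm_mul,
    Complex.norm_real, Real.norm_of_nonneg h5, e, norm_mul, Complex.norm_ofNat]
  have h3 := padeScale_div_le hr n
  have h4 : (2 * n).factorial ≤ (2 * n + 1).factorial := Nat.factorial_le (by omega)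
  have h6 := hM a ha
  set M := ((n : ℝ) * r + 1) / 2 with hMdef
  have hMpos : 0 ≤ M := by positivity
  calc padeScale r n * (2 * ‖(a : ℂ) * expDD (nodes r n) L + expDD ((nodes r n).erase a) L‖)
      ≤ padeScale r n * (2 * (M * (‖L‖ ^ (2 * n + 1) / (2 * n).factorial * Real.exp (M * ‖L‖)) +
        ‖L‖ ^ (2 * n) / (2 * n).factorial * Real.exp (M * ‖L‖))) := by
        gcongr
        refine (norm_add_le _ _).trans (add_le_add ?_ h2)
        rw [norm_mul, Complex.norm_real, Real.norm_eq_abs]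
        gcongr
        exact h1.trans (by gcongr)
    _ = padeScale r n / (2 * n).factorial * (2 * ‖L‖ ^ (2 * n)) * (1 + M * ‖L‖) *
        Real.exp (M * ‖L‖) := by ring
    _ ≤ (r : ℝ) ^ (4 * n) * (2 * ‖L‖ ^ (2 * n)) * (1 + (n * r + 1) * ‖L‖) *
        Real.exp (M * ‖L‖) := by
        have : M ≤ n * r + 1 := by rw [hMdef]; linarith [show (0 : ℝ) ≤ n * r by positivity]
        gcongr
    _ = _ := by rw [padeBound]; ring

/-- The coefficients of the second family of approximants. -/
def padeCoeff' (r n k : ℕ) : ℤ := padeCoeff r n k * (2 * k * r - (n * r + 1))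

/-- The binary form of degree `n` with coefficients `c`. -/
noncomputable def formVal (c : ℕ → ℤ) (n : ℕ) (U V : ℂ) : ℂ :=
  ∑ k ∈ range (n + 1), (c k : ℂ) * (U ^ k * V ^ (n - k))

theorem padeCoeff'_eq (r n k : ℕ) :
    (padeCoeff' r n k : ℂ) = padeCoeff r n k * (2 * node r n k : ℝ) := by
  simp only [padeCoeff', node]; push_cast; ring

/-- The factor 2 · node is odd under the symmetry of the nodes. This is why the second family enters
with a plus sign. -/
theorem padeCoeff'_reflect {r n k : ℕ} (hk : k ≤ n) :
    (padeCoeff' r n (n - k) : ℂ) = -(padeCoeff r n (n - k) * (2 * (node r n k + 1) : ℝ)) := by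
  simp only [padeCoeff', node]; push_cast [Nat.cast_sub hk]; ring

theorem formVal_mul (c : ℕ → ℤ) (n : ℕ) (t U V : ℂ) :
    formVal c n (t * U) (t * V) = t ^ n * formVal c n U V := by
  rw [formVal, formVal, Finset.mul_sum]
  refine Finset.sum_congr rfl fun k hk => ?_
  have : t ^ n = t ^ k * t ^ (n - k) := by
    rw [← pow_add]; congr 1; have := Finset.mem_range.1 hk; omega
  rw [this]; ring

theorem formVal_swap (c : ℕ → ℤ) (n : ℕ) (U V : ℂ) :
    formVal c n V U = ∑ k ∈ range (n + 1), (c (n - k) : ℂ) * (U ^ k * V ^ (n - k)) := by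
  rw [formVal, ← Finset.sum_range_reflect]
  refine Finset.sum_congr rfl fun k hk => ?_
  have : k ≤ n := Nat.lt_succ_iff.1 (Finset.mem_range.1 hk)
  have e : n + 1 - 1 - k = n - k := by omega
  rw [e, show n - (n - k) = k by omega]
  ring

theorem exp_node (r n k : ℕ) (L : ℂ) : Complex.exp (node r n k * L) =
    Complex.exp (-((n * r + 1) / 2) * L) * Complex.exp (r * L) ^ k := by
  rw [← Complex.exp_nat_mul, ← Complex.exp_add]
  congr 1; simp only [node]; push_cast; ring

theorem exp_node_add_one (r n k : ℕ) (L : ℂ) : Complex.exp ((node r n k + 1 : ℝ) * L) =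
    Complex.exp (-((n * r + 1) / 2) * L) * Complex.exp L * Complex.exp (r * L) ^ k := by
  rw [← Complex.exp_nat_mul, ← Complex.exp_add, ← Complex.exp_add]
  congr 1; simp only [node]; push_cast; ring

theorem padeRem_eq (r n : ℕ) (L : ℂ) : padeRem r n L =
    Complex.exp (-((n * r + 1) / 2) * L) * (formVal (padeCoeff r n) n (Complex.exp (r * L)) 1 -
      Complex.exp L * formVal (padeCoeff r n) n 1 (Complex.exp (r * L))) := by
  rw [formVal_swap _ _ (Complex.exp (r * L)) 1, formVal, padeRem, mul_sub, Finset.mul_sum, Finset.mul_sum, Finset.mul_sum]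
  congr 1
  · refine Finset.sum_congr rfl fun k hk => ?_
    rw [exp_node]; ring
  · refine Finset.sum_congr rfl fun k hk => ?_
    rw [exp_node_add_one]; ring

theorem padeRem'_eq (r n : ℕ) (L : ℂ) : padeRem' r n L =
    Complex.exp (-((n * r + 1) / 2) * L) * (formVal (padeCoeff' r n) n (Complex.exp (r * L)) 1 +
      Complex.exp L * formVal (padeCoeff' r n) n 1 (Complex.exp (r * L))) := by
  rw [formVal_swap _ _ (Complex.exp (r * L)) 1, formVal, padeRem', mul_add, Finset.mul_sum, Finset.mul_sum, Finset.mul_sum,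
    sub_eq_add_neg, ← Finset.sum_neg_distrib]
  congr 1
  · refine Finset.sum_congr rfl fun k hk => ?_
    rw [exp_node, padeCoeff'_eq]; ring
  · refine Finset.sum_congr rfl fun k hk => ?_
    rw [exp_node_add_one, padeCoeff'_reflect (Nat.lt_succ_iff.1 (Finset.mem_range.1 hk))]; ring

/-! ### Nonvanishing of one of the two combinations -/

open Polynomial in
-- Were the exact power of X − 1 in R smaller than N, then, since e^(rt) − 1 ≥ t, the cofactor would
-- tend to 0 as t → 0 and vanish at 1.
theorem sub_one_pow_dvd_of_bound {R : ℂ[X]} {r N : ℕ} (hr : 1 ≤ r) {K : ℝ}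
    (hK : ∀ t ∈ Set.Ioc (0 : ℝ) 1, ‖R.eval (Complex.exp (r * t))‖ ≤ K * t ^ N) :
    (X - C 1) ^ N ∣ R := by
  by_cases hR : R = 0
  · simp [hR]
  obtain ⟨S, hS, hS'⟩ := exists_eq_pow_rootMultiplicity_mul_and_not_dvd R hR 1
  by_contra hdvd
  have hk : R.rootMultiplicity 1 < N := by
    by_contra h
    exact hdvd ((pow_dvd_pow _ (not_lt.1 h)).trans ⟨S, hS⟩)
  set k := R.rootMultiplicity 1
  apply hS'
  rw [dvd_iff_isRoot, IsRoot]
  have hcont : Continuous fun t : ℝ => S.eval (Complex.exp (r * t)) := by fun_prop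
  have hlim : Filter.Tendsto (fun t : ℝ => S.eval (Complex.exp (r * t)))
      (nhdsWithin 0 (Set.Ioi 0)) (nhds (S.eval 1)) := by
    have := (hcont.tendsto 0).mono_left (nhdsWithin_le_nhds (s := Set.Ioi 0))
    simpa using this
  have hlim0 : Filter.Tendsto (fun t : ℝ => S.eval (Complex.exp (r * t)))
      (nhdsWithin 0 (Set.Ioi 0)) (nhds 0) := by
    have h0 : Filter.Tendsto (fun t : ℝ => K * t) (nhdsWithin 0 (Set.Ioi 0)) (nhds 0) := by
      have : Continuous fun t : ℝ => K * t := by fun_prop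
      simpa using (this.tendsto 0).mono_left (nhdsWithin_le_nhds (s := Set.Ioi 0))
    refine squeeze_zero_norm' ?_ h0
    filter_upwards [Ioc_mem_nhdsGT (zero_lt_one' ℝ)] with t ht
    have h1 := hK t ht
    rw [hS, eval_mul, norm_mul, eval_pow, eval_sub, eval_X, eval_C, norm_pow] at h1
    have h2 : t ≤ ‖Complex.exp (r * t) - 1‖ := by
      have e : Complex.exp (r * t) - 1 = ((Real.exp (r * t) - 1 : ℝ) : ℂ) := by push_cast; rfl
      rw [e, Complex.norm_real, Real.norm_eq_abs]
      have := Real.add_one_le_exp ((r : ℝ) * t)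
      have hr' : (1 : ℝ) ≤ r := by exact_mod_cast hr
      refine le_trans ?_ (le_abs_self _)
      nlinarith [ht.1]
    have ht0 : 0 < t := ht.1
    have h3 : t ^ k * ‖S.eval (Complex.exp (r * t))‖ ≤ t ^ k * (K * t ^ (N - k)) := by
      calc _ ≤ ‖Complex.exp (r * t) - 1‖ ^ k * ‖S.eval (Complex.exp (r * t))‖ := by gcongr
        _ ≤ K * t ^ N := h1
        _ = _ := by rw [mul_left_comm, ← pow_add]; congr 2; omega
    have h4 := le_of_mul_le_mul_left h3 (by positivity)
    have hK0 : 0 ≤ K := by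
      have h5 := (norm_nonneg _).trans h4
      exact nonneg_of_mul_nonneg_left h5 (by positivity)
    refine h4.trans (mul_le_mul_of_nonneg_left ?_ hK0)
    exact pow_le_of_le_one ht0.le ht.2 (by omega)
  exact tendsto_nhds_unique hlim hlim0

open Polynomial in
/-- The polynomial `∑ c_k X ^ k`. -/
noncomputable def coeffPoly (c : ℕ → ℤ) (n : ℕ) : ℂ[X] :=
  ∑ k ∈ range (n + 1), C (c k : ℂ) * X ^ k

open Polynomial in
theorem eval_coeffPoly (c : ℕ → ℤ) (n : ℕ) (z : ℂ) :
    (coeffPoly c n).eval z = formVal c n z 1 := by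
  simp [coeffPoly, formVal, eval_finsetSum]

open Polynomial in
theorem eval_coeffPoly_reflect (c : ℕ → ℤ) (n : ℕ) (z : ℂ) :
    (coeffPoly (fun k => c (n - k)) n).eval z = formVal c n 1 z := by
  rw [formVal_swap, eval_coeffPoly, formVal]

open Polynomial in
theorem coeff_coeffPoly (c : ℕ → ℤ) (n : ℕ) : (coeffPoly c n).coeff n = c n := by
  simp [coeffPoly, finsetSum_coeff, coeff_X_pow]

open Polynomial in
theorem natDegree_coeffPoly_le (c : ℕ → ℤ) (n : ℕ) : (coeffPoly c n).natDegree ≤ n := by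
  refine natDegree_sum_le_of_forall_le _ _ fun k hk => ?_
  exact (natDegree_C_mul_X_pow_le _ _).trans (Nat.lt_succ_iff.1 (Finset.mem_range.1 hk))

open Polynomial in
/-- The determinant of the two families is a power of `z - 1`. -/
theorem exists_padeDet {r : ℕ} (hr : 2 ≤ r) (n : ℕ) : ∃ c : ℂ, c ≠ 0 ∧ ∀ z : ℂ,
    formVal (padeCoeff r n) n z 1 * formVal (padeCoeff' r n) n 1 z +
      formVal (padeCoeff' r n) n z 1 * formVal (padeCoeff r n) n 1 z = c * (z - 1) ^ (2 * n) := by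
  set A := coeffPoly (padeCoeff r n) n
  set B := coeffPoly (fun k => padeCoeff r n (n - k)) n
  set A' := coeffPoly (padeCoeff' r n) n
  set B' := coeffPoly (fun k => padeCoeff' r n (n - k)) n
  set R := A * B' + A' * B with hR
  have hAz : ∀ z, A.eval z = formVal (padeCoeff r n) n z 1 := eval_coeffPoly _ _
  have hAz' : ∀ z, A'.eval z = formVal (padeCoeff' r n) n z 1 := eval_coeffPoly _ _
  have hBz : ∀ z, B.eval z = formVal (padeCoeff r n) n 1 z := eval_coeffPoly_reflect _ _
  have hBz' : ∀ z, B'.eval z = formVal (padeCoeff' r n) n 1 z := eval_coeffPoly_reflect _ _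
  have hdvd : (X - C 1) ^ (2 * n) ∣ R := by
    have hc : Continuous fun t : ℝ => Complex.exp ((n * r + 1) / 2 * t) *
        ((‖B'.eval (Complex.exp (r * t))‖ + ‖B.eval (Complex.exp (r * t))‖ : ℝ) *
        (2 * r ^ (4 * n) * (1 + (n * r + 1) * t) * Real.exp ((n * r + 1) / 2 * t) : ℝ)) := by
      fun_prop
    obtain ⟨K, hK⟩ := (isCompact_Icc (a := (0 : ℝ)) (b := 1)).exists_bound_of_continuousOn
      hc.continuousOn
    refine sub_one_pow_dvd_of_bound (by omega : 1 ≤ r) (K := K) fun t ht => ?_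
    have h := hK t ⟨ht.1.le, ht.2⟩
    -- Eliminates z^(1/r) = e^t: AB' + A'B = (A − e^t B)B' + (A' + e^t B')B, and both brackets are
    -- remainders.
    have e : R.eval (Complex.exp (r * t)) = Complex.exp ((n * r + 1) / 2 * t) *
        (padeRem r n t * B'.eval (Complex.exp (r * t)) +
          padeRem' r n t * B.eval (Complex.exp (r * t))) := by
      rw [padeRem_eq, padeRem'_eq, hR, eval_add, eval_mul, eval_mul]
      rw [hAz, hBz, hAz', hBz']
      have : Complex.exp ((n * r + 1) / 2 * t) * Complex.exp (-((n * r + 1) / 2) * t) = 1 := by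
        rw [← Complex.exp_add, neg_mul, add_neg_cancel, Complex.exp_zero]
      linear_combination (-(formVal (padeCoeff r n) n (Complex.exp (r * t)) 1 *
        formVal (padeCoeff' r n) n 1 (Complex.exp (r * t)) +
        formVal (padeCoeff' r n) n (Complex.exp (r * t)) 1 *
        formVal (padeCoeff r n) n 1 (Complex.exp (r * t)))) * this
    have ht' : ‖(t : ℂ)‖ = t := by
      rw [Complex.norm_real, Real.norm_of_nonneg ht.1.le]
    have h1 := norm_padeRem_le hr n t
    have h2 := norm_padeRem'_le hr n t
    rw [ht'] at h1 h2
    have ht0 : 0 < t := ht.1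
    rw [norm_mul, norm_mul, Complex.norm_real, Complex.norm_real, Real.norm_of_nonneg (by positivity),
      Real.norm_of_nonneg (by positivity)] at h
    rw [e, norm_mul]
    calc _ ≤ ‖Complex.exp ((n * r + 1) / 2 * t)‖ *
        (padeBound r n t * ‖B'.eval (Complex.exp (r * t))‖ +
          padeBound r n t * ‖B.eval (Complex.exp (r * t))‖) := by
          gcongr
          refine (norm_add_le _ _).trans ?_
          rw [norm_mul, norm_mul]
          gcongr
      _ = ‖Complex.exp ((n * r + 1) / 2 * t)‖ *
        ((‖B'.eval (Complex.exp (r * t))‖ + ‖B.eval (Complex.exp (r * t))‖ : ℝ) *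
        (2 * r ^ (4 * n) * (1 + (n * r + 1) * t) * Real.exp ((n * r + 1) / 2 * t) : ℝ)) *
          t ^ (2 * n) := by rw [padeBound]; ring
      _ ≤ _ := by gcongr
  obtain ⟨S, hS⟩ := hdvd
  have hdeg : R.natDegree ≤ 2 * n := by
    refine (natDegree_add_le _ _).trans (max_le ?_ ?_) <;>
    · refine natDegree_mul_le.trans ?_
      have := natDegree_coeffPoly_le (padeCoeff r n) n
      have := natDegree_coeffPoly_le (padeCoeff' r n) n
      have := natDegree_coeffPoly_le (fun k => padeCoeff r n (n - k)) n
      have := natDegree_coeffPoly_le (fun k => padeCoeff' r n (n - k)) n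
      simp only [A, B, A', B']
      omega
  have hcoeff : R.coeff (2 * n) ≠ 0 := by
    have hA := natDegree_coeffPoly_le (padeCoeff r n) n
    have hA' := natDegree_coeffPoly_le (padeCoeff' r n) n
    have hB := natDegree_coeffPoly_le (fun k => padeCoeff r n (n - k)) n
    have hB' := natDegree_coeffPoly_le (fun k => padeCoeff' r n (n - k)) n
    rw [hR, coeff_add, two_mul, coeff_mul_add_eq_of_natDegree_le hA hB',
      coeff_mul_add_eq_of_natDegree_le hA' hB]
    simp only [coeff_coeffPoly, Nat.sub_self]
    have h1 := padeCoeff_pos (n := n) hr le_rfl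
    have h2 := padeCoeff_pos (n := n) hr (Nat.zero_le n)
    -- The factors −(nr + 1) and nr − 1 add up to −2, so the coefficient of degree 2n survives and
    -- the quotient by (X − 1)^(2n) is a nonzero constant.
    have : padeCoeff r n n * padeCoeff' r n 0 + padeCoeff' r n n * padeCoeff r n 0 =
        -2 * (padeCoeff r n n * padeCoeff r n 0) := by
      simp only [padeCoeff']; push_cast; ring
    have h3 := congrArg (Int.cast : ℤ → ℂ) this
    push_cast at h3
    rw [h3]
    have : (padeCoeff r n n : ℂ) ≠ 0 := by exact_mod_cast h1.ne'
    have : (padeCoeff r n 0 : ℂ) ≠ 0 := by exact_mod_cast h2.ne'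
    simp [*]
  have hS0 : S ≠ 0 := by
    rintro rfl
    rw [mul_zero] at hS
    exact hcoeff (by rw [hS, coeff_zero])
  have hSdeg : S.natDegree = 0 := by
    have := congrArg natDegree hS
    rw [natDegree_mul (pow_ne_zero _ (X_sub_C_ne_zero 1)) hS0, natDegree_pow, natDegree_X_sub_C]
      at this
    omega
  rw [natDegree_eq_zero] at hSdeg
  obtain ⟨c, rfl⟩ := hSdeg
  refine ⟨c, fun hc => hS0 (by rw [hc, C_0]), fun z => ?_⟩
  have := congrArg (eval z) hS
  simp only [hR, eval_add, eval_mul, hAz, hBz, hAz', hBz', eval_pow, eval_sub, eval_X,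
    eval_C] at this
  rw [this, mul_comm]

/-- One of the two approximants yields a nonzero combination. -/
theorem formVal_ne_zero {r : ℕ} (hr : 2 ≤ r) (n : ℕ) {U V p q : ℂ} (hUV : U ≠ V) (hV : V ≠ 0)
    (hp : p ≠ 0) :
    p * formVal (padeCoeff r n) n U V - q * formVal (padeCoeff r n) n V U ≠ 0 ∨
    p * formVal (padeCoeff' r n) n U V + q * formVal (padeCoeff' r n) n V U ≠ 0 := by
  obtain ⟨c, hc, h⟩ := exists_padeDet hr n
  by_contra! hcon
  obtain ⟨h1, h2⟩ := hcon
  have e : ∀ a : ℕ → ℤ, formVal a n U V = V ^ n * formVal a n (U / V) 1 ∧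
      formVal a n V U = V ^ n * formVal a n 1 (U / V) := by
    intro a
    rw [← formVal_mul, ← formVal_mul, mul_one, mul_div_cancel₀ _ hV]
    exact ⟨rfl, rfl⟩
  -- Eliminating q from the two vanishing combinations leaves p times the determinant.
  have h3 : V ^ n * (formVal (padeCoeff r n) n (U / V) 1 * formVal (padeCoeff' r n) n 1 (U / V) +
      formVal (padeCoeff' r n) n (U / V) 1 * formVal (padeCoeff r n) n 1 (U / V)) * (p * V ^ n) = 0 := by
    rw [(e _).1, (e _).2] at h1 h2
    linear_combination V ^ n * formVal (padeCoeff' r n) n 1 (U / V) * h1 +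
      V ^ n * formVal (padeCoeff r n) n 1 (U / V) * h2
  rw [h] at h3
  have h4 : U / V - 1 ≠ 0 := by
    rw [sub_ne_zero]
    intro h5
    exact hUV ((div_eq_one_iff_eq hV).1 h5)
  have h5 : V ^ n ≠ 0 := pow_ne_zero _ hV
  exact (mul_ne_zero (mul_ne_zero h5 (mul_ne_zero hc (pow_ne_zero _ h4))) (mul_ne_zero hp h5)) h3

/-- The sum of the absolute values of the coefficients is `O(C ^ n)`. -/
theorem sum_abs_padeCoeff_le {r n : ℕ} (hr : 2 ≤ r) :
    ∑ k ∈ range (n + 1), |padeCoeff r n k| ≤ (n * r + 1) * (2 * (4 * (r : ℤ) ^ 2) ^ n) ∧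
    ∑ k ∈ range (n + 1), |padeCoeff' r n k| ≤ (n * r + 1) * (2 * (4 * (r : ℤ) ^ 2) ^ n) := by
  have h1 : ∑ k ∈ range (n + 1), |padeCoeff r n k| ≤ 2 * (4 * (r : ℤ) ^ 2) ^ n := by
    refine le_trans (le_of_eq ?_) (sum_padeCoeff_le hr)
    exact Finset.sum_congr rfl fun k hk =>
      abs_of_pos (padeCoeff_pos hr (Nat.lt_succ_iff.1 (Finset.mem_range.1 hk)))
  have h0 : (0 : ℤ) ≤ 2 * (4 * (r : ℤ) ^ 2) ^ n := by positivity
  have hnr : (0 : ℤ) ≤ n * r := by positivity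
  constructor
  · nlinarith
  · refine le_trans ?_ (mul_le_mul_of_nonneg_left h1 (by positivity))
    rw [Finset.mul_sum]
    refine Finset.sum_le_sum fun k hk => ?_
    rw [padeCoeff', abs_mul, mul_comm]
    refine mul_le_mul_of_nonneg_right ?_ (abs_nonneg _)
    have hk' : (k : ℤ) ≤ n := by exact_mod_cast Nat.lt_succ_iff.1 (Finset.mem_range.1 hk)
    have h2 : (k : ℤ) * r ≤ n * r := by gcongr
    have h3 : (0 : ℤ) ≤ k * r := by positivity
    rw [abs_le]
    constructor <;> linarith

/-! ### Values of the form, its derivatives and its Hessian -/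

open MvPolynomial

/-- The value of a linear form at an integer point. -/
def lin (a b : ℂ) (p : ℤ × ℤ) : ℂ := a * p.1 + b * p.2

theorem value_cast (P : MvPolynomial (Fin 2) ℤ) (p : ℤ × ℤ) :
    (value P p : ℂ) = eval ![(p.1 : ℂ), (p.2 : ℂ)] (map (Int.castRingHom ℂ) P) := by
  rw [eval_map, value, ← eq_intCast (Int.castRingHom ℂ), ← eval₂_id, MvPolynomial.hom_eval₂,
    RingHom.comp_id]
  congr 1
  ext i
  fin_cases i <;> simp

theorem realValue_cast (P : MvPolynomial (Fin 2) ℤ) (p : ℝ × ℝ) :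
    (realValue P p : ℂ) = eval ![(p.1 : ℂ), (p.2 : ℂ)] (map (Int.castRingHom ℂ) P) := by
  rw [eval_map, realValue, ← Complex.ofRealHom_eq_coe, MvPolynomial.hom_eval₂]
  congr 1
  ext i
  fin_cases i <;> simp

theorem eval_linForm (a b x y : ℂ) : eval ![x, y] (linForm a b) = a * x + b * y := by
  simp [linForm]

theorem pderiv_zero_linForm_pow (a b : ℂ) (k : ℕ) :
    pderiv 0 (linForm a b ^ k) = C (k * a) * linForm a b ^ (k - 1) := by
  rw [pderiv_pow, linForm]
  simp [pderiv_X]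
  ring

theorem pderiv_one_linForm_pow (a b : ℂ) (k : ℕ) :
    pderiv 1 (linForm a b ^ k) = C (k * b) * linForm a b ^ (k - 1) := by
  rw [pderiv_pow, linForm]
  simp [pderiv_X]
  ring

section Values

variable {F : MvPolynomial (Fin 2) ℤ} {r : ℕ} {α β γ δ : ℂ}

theorem value_eq (hF : IsDiagonalizedBy F r α β γ δ) (p : ℤ × ℤ) :
    (value F p : ℂ) = lin α β p ^ r - lin γ δ p ^ r := by
  rw [value_cast, hF.1]
  simp [eval_linForm, lin]

theorem realValue_eq (hF : IsDiagonalizedBy F r α β γ δ) (p : ℝ × ℝ) :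
    (realValue F p : ℂ) = (α * p.1 + β * p.2) ^ r - (γ * p.1 + δ * p.2) ^ r := by
  rw [realValue_cast, hF.1]
  simp [eval_linForm]

theorem value_pderiv_zero (hF : IsDiagonalizedBy F r α β γ δ) (p : ℤ × ℤ) :
    (value (pderiv 0 F) p : ℂ) = r * (α * lin α β p ^ (r - 1) - γ * lin γ δ p ^ (r - 1)) := by
  rw [value_cast, ← pderiv_map, hF.1, map_sub, pderiv_zero_linForm_pow, pderiv_zero_linForm_pow]
  simp [eval_linForm, lin]
  ring

theorem value_pderiv_one (hF : IsDiagonalizedBy F r α β γ δ) (p : ℤ × ℤ) :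
    (value (pderiv 1 F) p : ℂ) = r * (β * lin α β p ^ (r - 1) - δ * lin γ δ p ^ (r - 1)) := by
  rw [value_cast, ← pderiv_map, hF.1, map_sub, pderiv_one_linForm_pow, pderiv_one_linForm_pow]
  simp [eval_linForm, lin]
  ring

theorem value_pderiv_one_one (hF : IsDiagonalizedBy F r α β γ δ) (p : ℤ × ℤ) :
    (value (pderiv 1 (pderiv 1 F)) p : ℂ) =
      r * (r - 1 : ℕ) * (β ^ 2 * lin α β p ^ (r - 2) - δ ^ 2 * lin γ δ p ^ (r - 2)) := by
  rw [value_cast, ← pderiv_map, ← pderiv_map, hF.1]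
  simp only [map_sub, pderiv_one_linForm_pow, pderiv_C_mul]
  simp [eval_linForm, lin, Nat.sub_sub]
  ring

theorem value_pderiv_one_one_one (hF : IsDiagonalizedBy F r α β γ δ) (p : ℤ × ℤ) :
    (value (pderiv 1 (pderiv 1 (pderiv 1 F))) p : ℂ) =
      r * (r - 1 : ℕ) * (r - 2 : ℕ) *
        (β ^ 3 * lin α β p ^ (r - 3) - δ ^ 3 * lin γ δ p ^ (r - 3)) := by
  rw [value_cast, ← pderiv_map, ← pderiv_map, ← pderiv_map, hF.1]
  simp only [map_sub, pderiv_one_linForm_pow, pderiv_C_mul]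
  simp [eval_linForm, lin, Nat.sub_sub]
  ring

theorem value_hessian (hF : IsDiagonalizedBy F r α β γ δ) (p : ℤ × ℤ) :
    (value (hessian F) p : ℂ) = -((r * (r - 1 : ℕ)) ^ 2 * (α * δ - β * γ) ^ 2 *
      (lin α β p * lin γ δ p) ^ (r - 2)) := by
  rw [mul_pow _ (lin γ δ p), value_cast, hessian]
  simp only [map_sub, map_mul, map_pow]
  simp only [← pderiv_map, hF.1]
  simp only [map_sub, pderiv_one_linForm_pow, pderiv_zero_linForm_pow, pderiv_C_mul]
  simp [eval_linForm, lin, Nat.sub_sub]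
  ring

end Values

section Quadratic

variable {α β γ δ χ : ℂ} {A B C : ℤ}

theorem isAssociatedQuadratic_iff :
    IsAssociatedQuadratic α β γ δ χ A B C ↔
      α * γ = χ * A ∧ α * δ + β * γ = χ * B ∧ β * δ = χ * C := by
  constructor
  · intro h
    have h' : ∀ x y : ℂ, (α * x + β * y) * (γ * x + δ * y) =
        χ * (A * x ^ 2 + B * (x * y) + C * y ^ 2) := by
      intro x y
      have := congrArg (eval ![x, y]) h
      simpa [eval_linForm] using this
    have h1 := h' 1 0
    have h2 := h' 0 1
    have h3 := h' 1 1
    refine ⟨by linear_combination h1, ?_, by linear_combination h2⟩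
    linear_combination h3 - h1 - h2
  · rintro ⟨h1, h2, h3⟩
    have h1' := congrArg (MvPolynomial.C (σ := Fin 2)) h1
    have h2' := congrArg (MvPolynomial.C (σ := Fin 2)) h2
    have h3' := congrArg (MvPolynomial.C (σ := Fin 2)) h3
    simp only [map_mul, map_add] at h1' h2' h3'
    rw [IsAssociatedQuadratic, linForm, linForm]
    linear_combination X 0 ^ 2 * h1' + X 0 * X 1 * h2' + X 1 ^ 2 * h3'

theorem sq_eq_of_quadratic (h : IsAssociatedQuadratic α β γ δ χ A B C) :
    (α * δ - β * γ) ^ 2 = χ ^ 2 * quadDisc A B C := by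
  obtain ⟨h1, h2, h3⟩ := isAssociatedQuadratic_iff.1 h
  rw [quadDisc]; push_cast
  linear_combination (α * δ + β * γ + χ * B) * h2 - 4 * β * δ * h1 - 4 * χ * A * h3

end Quadratic

/-! ### Conjugate elements and the arithmetic lower bound -/

/-- An integral form `F` diagonalized over `ℂ`, with its quadratic form. -/
structure Setting (F : MvPolynomial (Fin 2) ℤ) (r : ℕ) (α β γ δ χ : ℂ) (A B C : ℤ) : Prop where
  diag : IsDiagonalizedBy F r α β γ δ
  quad : IsAssociatedQuadratic α β γ δ χ A B C
  five_le : 5 ≤ r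

/-- `X` and `Y` are conjugate elements `a ± b d` of `ℤ[d]`. -/
def ConjPair (d X Y : ℂ) : Prop := ∃ a b : ℤ, X = a + d * b ∧ Y = a - d * b

namespace ConjPair

variable {d X Y X' Y' : ℂ} {D : ℤ}

theorem mul (hd : d ^ 2 = D) (h : ConjPair d X Y) (h' : ConjPair d X' Y') :
    ConjPair d (X * X') (Y * Y') := by
  obtain ⟨a, b, rfl, rfl⟩ := h
  obtain ⟨a', b', rfl, rfl⟩ := h'
  refine ⟨a * a' + D * (b * b'), a * b' + a' * b, ?_, ?_⟩ <;> push_cast <;>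
    linear_combination (b * b' : ℂ) * hd

theorem add (h : ConjPair d X Y) (h' : ConjPair d X' Y') : ConjPair d (X + X') (Y + Y') := by
  obtain ⟨a, b, rfl, rfl⟩ := h
  obtain ⟨a', b', rfl, rfl⟩ := h'
  refine ⟨a + a', b + b', ?_, ?_⟩ <;> push_cast <;> ring

theorem intCast (d : ℂ) (n : ℤ) : ConjPair d n n := ⟨n, 0, by simp, by simp⟩

theorem symm (h : ConjPair d X Y) : ConjPair d Y X := by
  obtain ⟨a, b, rfl, rfl⟩ := h
  exact ⟨a, -b, by push_cast; ring, by push_cast; ring⟩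

theorem pow (hd : d ^ 2 = D) (h : ConjPair d X Y) (n : ℕ) : ConjPair d (X ^ n) (Y ^ n) := by
  induction n with
  | zero => simpa using intCast d 1
  | succ n ih => rw [pow_succ, pow_succ]; exact ih.mul hd h

theorem formVal (hd : d ^ 2 = D) (h : ConjPair d X Y) (c : ℕ → ℤ) (n : ℕ) :
    ConjPair d (formVal c n X Y) (formVal c n Y X) := by
  unfold DiagThue.formVal
  induction Finset.range (n + 1) using Finset.induction_on with
  | empty => simpa using intCast d 0
  | insert k s hk ih =>
    rw [Finset.sum_insert hk, Finset.sum_insert hk]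
    exact ((intCast d _).mul hd ((h.pow hd k).mul hd (h.symm.pow hd (n - k)))).add ih

theorem two_le_norm_add (h : ConjPair d X Y) (h0 : X + Y ≠ 0) : 2 ≤ ‖X + Y‖ := by
  obtain ⟨a, b, rfl, rfl⟩ := h
  have e : (a + d * b + (a - d * b) : ℂ) = ((2 * a : ℤ) : ℂ) := by push_cast; ring
  rw [e] at h0 ⊢
  have h1 : a ≠ 0 := by rintro rfl; simp at h0
  rw [Complex.norm_intCast]
  have : 1 ≤ |a| := Int.one_le_abs h1
  rw [← Int.cast_abs, abs_mul]
  norm_cast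
  norm_num
  omega

theorem two_le_norm_sub (hd : 1 ≤ ‖d‖) (h : ConjPair d X Y) (h0 : X - Y ≠ 0) : 2 ≤ ‖X - Y‖ := by
  obtain ⟨a, b, rfl, rfl⟩ := h
  have e : (a + d * b - (a - d * b) : ℂ) = d * ((2 * b : ℤ) : ℂ) := by push_cast; ring
  rw [e] at h0 ⊢
  have h1 : b ≠ 0 := by rintro rfl; simp at h0
  rw [norm_mul, Complex.norm_intCast]
  have : 1 ≤ |b| := Int.one_le_abs h1
  have : (2 : ℝ) ≤ |((2 * b : ℤ) : ℝ)| := by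
    rw [← Int.cast_abs, abs_mul]
    norm_cast
    norm_num
    omega
  nlinarith

end ConjPair

namespace Setting

variable {F : MvPolynomial (Fin 2) ℤ} {r : ℕ} {α β γ δ χ : ℂ} {A B C : ℤ}

theorem chi_ne_zero (S : Setting F r α β γ δ χ A B C) : χ ≠ 0 := by
  rintro rfl
  have := sq_eq_of_quadratic S.quad
  exact S.diag.2 (by simpa using this)

theorem root_sq (S : Setting F r α β γ δ χ A B C) :
    ((α * δ - β * γ) / χ) ^ 2 = (quadDisc A B C : ℤ) := by
  have := S.chi_ne_zero
  rw [div_pow, sq_eq_of_quadratic S.quad]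
  field_simp

theorem disc_ne_zero (S : Setting F r α β γ δ χ A B C) : quadDisc A B C ≠ 0 := by
  intro h
  have := S.root_sq
  rw [h, Int.cast_zero] at this
  exact div_ne_zero S.diag.2 S.chi_ne_zero (pow_eq_zero_iff two_ne_zero |>.1 this)

theorem one_le_norm_root (S : Setting F r α β γ δ χ A B C) : 1 ≤ ‖(α * δ - β * γ) / χ‖ := by
  have h := congrArg norm S.root_sq
  rw [norm_pow, Complex.norm_intCast, ← Int.cast_abs] at h
  have h1 : (1 : ℝ) ≤ (|quadDisc A B C| : ℤ) := by exact_mod_cast Int.one_le_abs S.disc_ne_zero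
  rw [← h] at h1
  nlinarith [norm_nonneg ((α * δ - β * γ) / χ)]

theorem lin_mul_lin (S : Setting F r α β γ δ χ A B C) (p : ℤ × ℤ) :
    lin α β p * lin γ δ p = χ * ((A * p.1 ^ 2 + B * (p.1 * p.2) + C * p.2 ^ 2 : ℤ) : ℂ) := by
  obtain ⟨h1, h2, h3⟩ := isAssociatedQuadratic_iff.1 S.quad
  simp only [lin]; push_cast
  linear_combination (p.1 ^ 2 : ℂ) * h1 + (p.1 * p.2 : ℂ) * h2 + (p.2 ^ 2 : ℂ) * h3

/-- The sum of the two powers is an integer over `r d`, where `d = j / χ`. -/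
theorem exists_sum_eq (S : Setting F r α β γ δ χ A B C) (p : ℤ × ℤ) :
    ∃ s : ℤ, r * ((α * δ - β * γ) / χ) * (lin α β p ^ r + lin γ δ p ^ r) = s := by
  obtain ⟨h1, h2, h3⟩ := isAssociatedQuadratic_iff.1 S.quad
  have hχ := S.chi_ne_zero
  obtain ⟨k, rfl⟩ : ∃ k, r = k + 1 := ⟨r - 1, by have := S.five_le; omega⟩
  -- The Jacobian Q_y F_x − Q_x F_y, where Q = Ax² + Bxy + Cy².
  refine ⟨(B * p.1 + 2 * C * p.2) * value (pderiv 0 F) p -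
    (2 * A * p.1 + B * p.2) * value (pderiv 1 F) p, ?_⟩
  push_cast
  rw [value_pderiv_zero S.diag, value_pderiv_one S.diag]
  have h4 : (B * p.1 + 2 * C * p.2 : ℂ) = (lin α β p * δ + lin γ δ p * β) / χ := by
    rw [eq_div_iff hχ]; simp only [lin]; linear_combination -(p.1 : ℂ) * h2 - 2 * (p.2 : ℂ) * h3
  have h5 : (2 * A * p.1 + B * p.2 : ℂ) = (lin α β p * γ + lin γ δ p * α) / χ := by
    rw [eq_div_iff hχ]; simp only [lin]; linear_combination -(p.2 : ℂ) * h2 - 2 * (p.1 : ℂ) * h1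
  rw [h4, h5, Nat.add_sub_cancel]
  push_cast
  field_simp
  ring

/-- Half the sum is the integer of `exists_sum_eq`, half the difference is d · rF. Since d may be
rational, conjugation is recorded by the pair (a, b) and not by a field automorphism. -/
theorem conjPair_pow (S : Setting F r α β γ δ χ A B C) (p : ℤ × ℤ) :
    ConjPair ((α * δ - β * γ) / χ) (2 * r * ((α * δ - β * γ) / χ) * lin α β p ^ r)
      (2 * r * ((α * δ - β * γ) / χ) * lin γ δ p ^ r) := by
  obtain ⟨s, hs⟩ := S.exists_sum_eq p
  refine ⟨s, r * value F p, ?_, ?_⟩ <;> rw [← hs] <;> push_cast <;> rw [value_eq S.diag] <;> ring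

/-- Half the sum is the polar form of the quadratic form; half the difference is d times the
determinant of the two points. -/
theorem conjPair_cross (S : Setting F r α β γ δ χ A B C) (p q : ℤ × ℤ) :
    ConjPair ((α * δ - β * γ) / χ) (2 * (lin α β q * lin γ δ p) / χ)
      (2 * (lin α β p * lin γ δ q) / χ) := by
  obtain ⟨h1, h2, h3⟩ := isAssociatedQuadratic_iff.1 S.quad
  have hχ := S.chi_ne_zero
  refine ⟨2 * A * (p.1 * q.1) + B * (p.1 * q.2 + q.1 * p.2) + 2 * C * (p.2 * q.2),
    q.1 * p.2 - p.1 * q.2, ?_, ?_⟩ <;> rw [div_eq_iff hχ] <;> push_cast <;> field_simp <;>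
    simp only [lin] <;> linear_combination (2 * (p.1 * q.1) : ℂ) * h1 +
      (p.1 * q.2 + q.1 * p.2 : ℂ) * h2 + (2 * (p.2 * q.2) : ℂ) * h3

/-- With d = j/χ, the number 2(2rd)^n Λ/χ is the difference or the sum of conjugates a ± bd, that is
2bd or 2a. Being nonzero, it has absolute value at least 2, because |d| ≥ 1. A last factor |d| turns
|χ| into |j|. -/
theorem norm_disc_le (S : Setting F r α β γ δ χ A B C) (p q : ℤ × ℤ) (c : ℕ → ℤ) (n : ℕ) {Λ : ℂ}
    (hΛ : Λ = lin α β q * lin γ δ p * formVal c n (lin α β p ^ r) (lin γ δ p ^ r) -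
        lin α β p * lin γ δ q * formVal c n (lin γ δ p ^ r) (lin α β p ^ r) ∨
      Λ = lin α β q * lin γ δ p * formVal c n (lin α β p ^ r) (lin γ δ p ^ r) +
        lin α β p * lin γ δ q * formVal c n (lin γ δ p ^ r) (lin α β p ^ r)) (h0 : Λ ≠ 0) :
    ‖α * δ - β * γ‖ ≤ (2 * r * ‖(α * δ - β * γ) / χ‖) ^ n * ‖(α * δ - β * γ) / χ‖ * ‖Λ‖ := by
  have hχ := S.chi_ne_zero
  have hd1 := S.one_le_norm_root
  have hj : α * δ - β * γ = (α * δ - β * γ) / χ * χ := (div_mul_cancel₀ _ hχ).symm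
  have hc := (S.conjPair_cross p q).mul S.root_sq ((S.conjPair_pow p).formVal S.root_sq c n)
  rw [formVal_mul, formVal_mul] at hc
  generalize (α * δ - β * γ) / χ = d at *
  have hr : (r : ℂ) ≠ 0 := by
    have := S.five_le
    exact_mod_cast (by omega : r ≠ 0)
  have hd : d ≠ 0 := by rintro rfl; norm_num at hd1
  have hM : 2 * (2 * r * d) ^ n / χ ≠ 0 :=
    div_ne_zero (mul_ne_zero two_ne_zero (pow_ne_zero _ (mul_ne_zero (mul_ne_zero two_ne_zero hr) hd)))
      hχ
  have key : 2 ≤ ‖2 * (2 * r * d) ^ n / χ * Λ‖ := by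
    obtain h | h := hΛ
    · have e := hc.two_le_norm_sub hd1 (by
        refine fun h1 => (mul_ne_zero hM h0) ?_
        rw [← h1, h]; ring)
      refine e.trans (le_of_eq ?_)
      congr 1
      rw [h]; ring
    · have e := hc.two_le_norm_add (by
        refine fun h1 => (mul_ne_zero hM h0) ?_
        rw [← h1, h]; ring)
      refine e.trans (le_of_eq ?_)
      congr 1
      rw [h]; ring
  have hχ0 : 0 < ‖χ‖ := norm_pos_iff.2 hχ
  rw [norm_mul, norm_div, norm_mul, norm_pow, norm_mul, norm_mul, Complex.norm_natCast,
    Complex.norm_ofNat, div_mul_eq_mul_div, le_div_iff₀ hχ0] at key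
  rw [hj, norm_mul]
  nlinarith [norm_nonneg d]

/-- If the quadratic form is primitive, its discriminant is bounded in terms of `j`. -/
theorem norm_root_pow_le (S : Setting F r α β γ δ χ A B C)
    (hprim : ∃ u v w : ℤ, u * A + v * B + w * C = 1) :
    ‖(α * δ - β * γ) / χ‖ ^ (r - 2) ≤ (r : ℝ) ^ 3 * ‖α * δ - β * γ‖ ^ r := by
  have hχ := S.chi_ne_zero
  have hr5 := S.five_le
  set d := (α * δ - β * γ) / χ with hd
  have hd1 : 1 ≤ ‖d‖ := S.one_le_norm_root
  -- The product of the conjugates in `conjPair_pow` is a² − Db², and ξη = χQ.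
  have hk : ∀ p : ℤ × ℤ, ∃ t : ℤ, (4 * r ^ 2 * d ^ 2 * χ ^ r : ℂ) *
      ((A * p.1 ^ 2 + B * (p.1 * p.2) + C * p.2 ^ 2 : ℤ) : ℂ) ^ r = t := by
    intro p
    obtain ⟨a, b, h1, h2⟩ := S.conjPair_pow p
    refine ⟨a ^ 2 - quadDisc A B C * b ^ 2, ?_⟩
    have h3 := congrArg (· ^ r) (S.lin_mul_lin p)
    simp only [mul_pow] at h3
    rw [mul_assoc, ← h3]
    push_cast
    rw [← S.root_sq, ← hd]
    rw [← hd] at h1 h2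
    linear_combination 2 * r * d * lin γ δ p ^ r * h1 + (a + d * b) * h2
  obtain ⟨t1, h1⟩ := hk (1, 0)
  obtain ⟨t2, h2⟩ := hk (0, 1)
  obtain ⟨t3, h3⟩ := hk (1, 1)
  norm_num at h1 h2 h3
  -- The values A, C, A + B + C at (1, 0), (0, 1), (1, 1) generate the unit ideal, hence so do their
  -- r-th powers. Therefore 4r²d²χ^r is an integer.
  have hspan : Ideal.span (({A, C, A + B + C} : Set ℤ)) = ⊤ := by
    obtain ⟨u, v, w, h⟩ := hprim
    rw [Ideal.eq_top_iff_one, ← h]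
    have hA : A ∈ Ideal.span (({A, C, A + B + C} : Set ℤ)) := Ideal.subset_span (by simp)
    have hC : C ∈ Ideal.span (({A, C, A + B + C} : Set ℤ)) := Ideal.subset_span (by simp)
    have hABC : A + B + C ∈ Ideal.span (({A, C, A + B + C} : Set ℤ)) :=
      Ideal.subset_span (by simp)
    have hB : B ∈ Ideal.span (({A, C, A + B + C} : Set ℤ)) := by
      have := Ideal.sub_mem _ (Ideal.sub_mem _ hABC hA) hC
      rwa [show A + B + C - A - C = B by ring] at this
    exact Ideal.add_mem _ (Ideal.add_mem _ (Ideal.mul_mem_left _ _ hA) (Ideal.mul_mem_left _ _ hB))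
      (Ideal.mul_mem_left _ _ hC)
  have hspan' := Ideal.span_pow_eq_top _ hspan r
  rw [Set.image_insert_eq, Set.image_pair, Ideal.eq_top_iff_one, Ideal.mem_span_insert] at hspan'
  obtain ⟨u, z, hz, huz⟩ := hspan'
  rw [Ideal.mem_span_pair] at hz
  obtain ⟨v, w, rfl⟩ := hz
  have hint : (4 * r ^ 2 * d ^ 2 * χ ^ r : ℂ) = ((u * t1 + v * t2 + w * t3 : ℤ) : ℂ) := by
    have huz' := congrArg (Int.cast : ℤ → ℂ) huz
    push_cast at huz' ⊢
    linear_combination (4 * r ^ 2 * d ^ 2 * χ ^ r : ℂ) * huz' + u * h1 + v * h2 + w * h3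
  have hr0 : (r : ℂ) ≠ 0 := by exact_mod_cast (by omega : r ≠ 0)
  have hd0 : d ≠ 0 := by intro h; rw [h] at hd1; norm_num at hd1
  have hne : (4 * r ^ 2 * d ^ 2 * χ ^ r : ℂ) ≠ 0 :=
    mul_ne_zero (mul_ne_zero (mul_ne_zero (by norm_num) (pow_ne_zero _ hr0)) (pow_ne_zero _ hd0))
      (pow_ne_zero _ hχ)
  have h1le : 1 ≤ ‖(4 * r ^ 2 * d ^ 2 * χ ^ r : ℂ)‖ := by
    rw [hint] at hne ⊢
    rw [Complex.norm_intCast, ← Int.cast_abs]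
    exact_mod_cast Int.one_le_abs (by exact_mod_cast hne)
  simp only [norm_mul, norm_pow, Complex.norm_natCast, Complex.norm_ofNat] at h1le
  have hj : α * δ - β * γ = d * χ := (div_mul_cancel₀ _ hχ).symm
  rw [hj, norm_mul, mul_pow]
  have hdr : ‖d‖ ^ r = ‖d‖ ^ (r - 2) * ‖d‖ ^ 2 := by rw [← pow_add]; congr 1; omega
  have hr4 : (4 : ℝ) ≤ r := by exact_mod_cast (by omega : 4 ≤ r)
  have hdp : 0 ≤ ‖d‖ ^ (r - 2) := by positivity
  calc ‖d‖ ^ (r - 2) = ‖d‖ ^ (r - 2) * 1 := (mul_one _).symm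
    _ ≤ ‖d‖ ^ (r - 2) * (4 * r ^ 2 * ‖d‖ ^ 2 * ‖χ‖ ^ r) := by gcongr
    _ ≤ ‖d‖ ^ (r - 2) * (r * r ^ 2 * ‖d‖ ^ 2 * ‖χ‖ ^ r) := by gcongr
    _ = _ := by rw [hdr]; ring

end Setting

/-! ### Existence of the integral quadratic form -/

/-- The quadratic form of a diagonalizable form is proportional to an integral one. -/
theorem exists_associatedQuadratic {F : MvPolynomial (Fin 2) ℤ} {r : ℕ} {α β γ δ : ℂ} (hr : 5 ≤ r)
    (hF : IsDiagonalizedBy F r α β γ δ) :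
    ∃ (χ : ℂ) (A B C : ℤ), IsAssociatedQuadratic α β γ δ χ A B C := by
  have hj := hF.2
  -- Each linear form vanishes at no more than one point (1, k), so one of k = 0, 1, 2 works.
  obtain ⟨k, hk1, hk2⟩ : ∃ k : ℤ, α + β * k ≠ 0 ∧ γ + δ * k ≠ 0 := by
    by_contra! hcon
    have h0 := hcon 0
    have h1 := hcon 1
    have h2 := hcon 2
    push_cast at h0 h1 h2
    simp only [mul_zero, add_zero, mul_one] at h0 h1 h2
    have huniq : ∀ a b c : ℂ, c ≠ 0 → a = 0 → a + b * c = 0 → b = 0 := by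
      intro a b c hc ha hb
      rw [ha, zero_add] at hb
      exact (mul_eq_zero.1 hb).resolve_right hc
    have hαβ : ¬(α = 0 ∧ β = 0) := by rintro ⟨rfl, rfl⟩; simp at hj
    have hγδ : ¬(γ = 0 ∧ δ = 0) := by rintro ⟨rfl, rfl⟩; simp at hj
    by_cases e0 : α = 0
    · have hβ : β ≠ 0 := fun h => hαβ ⟨e0, h⟩
      have e1 := h1 (by simpa [e0] using hβ)
      have e2 := h2 (by simpa [e0] using hβ)
      have : δ = 0 := by linear_combination e2 - e1
      exact hγδ ⟨by simpa [this] using e1, this⟩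
    · have e0' := h0 e0
      have hδ : δ ≠ 0 := fun h => hγδ ⟨e0', h⟩
      by_cases e1 : α + β = 0
      · by_cases e2 : α + β * 2 = 0
        · exact e0 (by linear_combination 2 * e1 - e2)
        · have := h2 e2
          rw [e0', zero_add] at this
          exact hδ ((mul_eq_zero.1 this).resolve_right two_ne_zero)
      · have := h1 e1
        rw [e0', zero_add] at this
        exact hδ this
  obtain ⟨l, rfl⟩ : ∃ l, r = l + 3 := ⟨r - 3, by omega⟩
  have hv0 := value_eq hF (1, k)
  have hv1 := value_pderiv_one hF (1, k)
  have hv2 := value_pderiv_one_one hF (1, k)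
  have hv3 := value_pderiv_one_one_one hF (1, k)
  simp only [lin, Int.cast_one, mul_one] at hv0 hv1 hv2 hv3
  rw [show l + 3 - 1 = l + 2 by omega, show l + 3 - 2 = l + 1 by omega] at *
  rw [Nat.add_sub_cancel] at hv3
  set ξ := α + β * k with hξ
  set η := γ + δ * k with hη
  set c0 := value F (1, k)
  set c1 := value (pderiv 1 F) (1, k)
  set c2 := value (pderiv 1 (pderiv 1 F)) (1, k)
  set c3 := value (pderiv 1 (pderiv 1 (pderiv 1 F))) (1, k)
  have hl1 : ((l + 3 : ℕ) : ℂ) ≠ 0 := by exact_mod_cast (by omega : l + 3 ≠ 0)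
  have hl2 : ((l + 2 : ℕ) : ℂ) ≠ 0 := by exact_mod_cast (by omega : l + 2 ≠ 0)
  have hl3 : ((l + 1 : ℕ) : ℂ) ≠ 0 := by exact_mod_cast (by omega : l + 1 ≠ 0)
  have hμ : ((l + 3 : ℕ) : ℂ) ^ 2 * ((l + 2 : ℕ) : ℂ) ^ 2 * ((l + 1 : ℕ) : ℂ) * (ξ * η) ^ l *
      (α * δ - β * γ) ^ 2 ≠ 0 := by positivity
  set μ := ((l + 3 : ℕ) : ℂ) ^ 2 * ((l + 2 : ℕ) : ℂ) ^ 2 * ((l + 1 : ℕ) : ℂ) * (ξ * η) ^ l *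
      (α * δ - β * γ) ^ 2 with hμdef
  have hjk : ξ * δ - β * η = α * δ - β * γ := by rw [hξ, hη]; ring
  -- Up to integer factors the y-derivatives at (1, k) are u_i = β^i ξ^(r−i) − δ^i η^(r−i), a linear
  -- recurrence with roots β/ξ and δ/η. Hence u₁² − u₀u₂, u₁u₂ − u₀u₃, u₂² − u₁u₃ are proportional
  -- to ξη, ξδ + βη, βδ.
  obtain ⟨N0, hN0⟩ : ∃ N : ℤ, ξ * η * μ = N := by
    refine ⟨(l + 2 : ℕ) ^ 2 * (l + 1 : ℕ) * c1 ^ 2 -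
      (l + 3 : ℕ) * (l + 2 : ℕ) * (l + 1 : ℕ) * c0 * c2, ?_⟩
    simp only [Int.cast_sub, Int.cast_mul, Int.cast_pow, Int.cast_natCast]
    rw [hv0, hv1, hv2, hμdef, ← hjk]
    push_cast
    ring_nf
  obtain ⟨N1, hN1⟩ : ∃ N : ℤ, (ξ * δ + β * η) * μ = N := by
    refine ⟨(l + 2 : ℕ) * (l + 1 : ℕ) * c1 * c2 - (l + 3 : ℕ) * (l + 2 : ℕ) * c0 * c3, ?_⟩
    simp only [Int.cast_sub, Int.cast_mul, Int.cast_natCast]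
    rw [hv0, hv1, hv2, hv3, hμdef, ← hjk]
    push_cast
    ring_nf
  obtain ⟨N2, hN2⟩ : ∃ N : ℤ, β * δ * μ = N := by
    refine ⟨(l + 1 : ℕ) * c2 ^ 2 - (l + 2 : ℕ) * c1 * c3, ?_⟩
    simp only [Int.cast_sub, Int.cast_mul, Int.cast_pow, Int.cast_natCast]
    rw [hv1, hv2, hv3, hμdef, ← hjk]
    push_cast
    ring_nf
  -- The N's are the coefficients in the basis (1, k), (0, 1); replacing y by y − kx returns to the
  -- standard one.
  refine ⟨μ⁻¹, N0 - k * N1 + k ^ 2 * N2, N1 - 2 * k * N2, N2, isAssociatedQuadratic_iff.2 ?_⟩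
  push_cast
  rw [← hN0, ← hN1, ← hN2]
  refine ⟨?_, ?_, ?_⟩
  · field_simp; rw [hξ, hη]; ring
  · field_simp; rw [hξ, hη]; ring
  · field_simp

/-! ### Analytic estimates near a root of unity -/

/-- `ξ / η` is close to the root of unity `ω`, with logarithmic distance `L` and size `ρ`. -/
structure NearRoot (r : ℕ) (h : ℝ) (ω ξ η : ℂ) (ρ : ℝ) (L : ℂ) : Prop where
  eq : ξ = ω * η * Complex.exp L
  pow_eq_one : ω ^ r = 1
  rho_pos : 0 < ρ
  rho_sq : ρ ^ 2 = ‖ξ‖ * ‖η‖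
  norm_le : ‖L‖ ≤ 8 / 5 * h / (r * ρ ^ r)

/-- With u = e^x this is |x| ≤ 2 sinh(|x|/2). The constant 1 would do; 8/5 matches the case of norm
one. -/
theorem norm_log_le_of_pos {u : ℝ} (hu : 0 < u) :
    Real.sqrt u * ‖Complex.log u‖ ≤ 8 / 5 * ‖(u : ℂ) - 1‖ := by
  rw [← Complex.ofReal_log hu.le, Complex.norm_real, ← Complex.ofReal_one, ← Complex.ofReal_sub,
    Complex.norm_real, Real.norm_eq_abs, Real.norm_eq_abs]
  have hs : 0 < Real.sqrt u := Real.sqrt_pos.2 hu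
  have hx : Real.sqrt u = Real.exp (Real.log u / 2) := by
    rw [Real.sqrt_eq_rpow, Real.rpow_def_of_pos hu]; congr 1; ring
  have hu2 : u = Real.exp (Real.log u / 2) * Real.exp (Real.log u / 2) := by
    rw [← Real.exp_add, add_halves, Real.exp_log hu]
  have key : ∀ x : ℝ, Real.exp (x / 2) * |x| ≤ |Real.exp (x / 2) * Real.exp (x / 2) - 1| := by
    intro x
    have e : Real.exp (x / 2) * Real.exp (x / 2) - 1 =
        Real.exp (x / 2) * (2 * Real.sinh (x / 2)) := by
      rw [Real.sinh_eq]
      have : Real.exp (x / 2) * Real.exp (-(x / 2)) = 1 := by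
        rw [← Real.exp_add, add_neg_cancel, Real.exp_zero]
      linear_combination this
    rw [e, abs_mul, abs_of_pos (Real.exp_pos _)]
    refine mul_le_mul_of_nonneg_left ?_ (Real.exp_pos _).le
    rw [abs_mul, Real.abs_sinh, abs_two]
    have := Real.self_le_sinh_iff.2 (abs_nonneg (x / 2))
    rw [abs_div, abs_two] at this ⊢
    linarith
  have h1 := key (Real.log u)
  rw [← hu2, ← hx] at h1
  linarith [abs_nonneg (u - 1)]

/-- Jordan's inequality bounds the arc by π/2 times the chord, and π/2 < 8/5. -/
theorem norm_log_le_of_norm_eq_one {u : ℂ} (hu : ‖u‖ = 1) :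
    ‖Complex.log u‖ ≤ 8 / 5 * ‖u - 1‖ := by
  have hu0 : u ≠ 0 := by intro h; rw [h] at hu; simp at hu
  set θ := u.arg
  have hlog : Complex.log u = Complex.I * θ := by
    rw [Complex.log, hu, Real.log_one]; simp [mul_comm, θ]
  have hexp : u = Complex.exp (Complex.I * θ) := by rw [← hlog, Complex.exp_log hu0]
  rw [hlog, hexp, Complex.norm_exp_I_mul_ofReal_sub_one, norm_mul, Complex.norm_I, one_mul,
    Complex.norm_real, Real.norm_eq_abs, Real.norm_eq_abs, abs_mul, abs_two]
  have hθ : |θ| ≤ Real.pi := Complex.abs_arg_le_pi u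
  have h1 := Real.mul_le_sin (x := |θ| / 2) (by positivity) (by linarith)
  have h2 : Real.sin (|θ| / 2) ≤ |Real.sin (θ / 2)| := by
    rcases abs_cases θ with ⟨h, _⟩ | ⟨h, _⟩ <;> rw [h]
    · exact le_abs_self _
    · rw [neg_div, Real.sin_neg]; exact neg_le_abs _
  have h3 := Real.pi_lt_d2
  have h4 := Real.pi_pos
  have h5 : |θ| ≤ Real.pi * Real.sin (|θ| / 2) := by
    have := mul_le_mul_of_nonneg_left h1 h4.le
    calc |θ| = Real.pi * (2 / Real.pi * (|θ| / 2)) := by field_simp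
      _ ≤ _ := this
  nlinarith [abs_nonneg θ, abs_nonneg (Real.sin (θ / 2))]

/-- The logarithm of a quotient of powers, if it is positive or has absolute value `1`. -/
theorem exists_nearRoot {r : ℕ} (hr : r ≠ 0) {ξ η : ℂ} {h : ℝ} (hξ : ξ ≠ 0) (hη : η ≠ 0)
    (hu : ‖ξ ^ r‖ = ‖η ^ r‖ ∨ ∃ u : ℝ, 0 < u ∧ ξ ^ r = u * η ^ r) (hh : ‖ξ ^ r - η ^ r‖ ≤ h) :
    NearRoot r h (ξ / (η * Complex.exp (Complex.log (ξ ^ r / η ^ r) / r))) ξ η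
      (Real.sqrt (‖ξ‖ * ‖η‖)) (Complex.log (ξ ^ r / η ^ r) / r) := by
  have hr' : (r : ℂ) ≠ 0 := by exact_mod_cast hr
  have hξ0 : 0 < ‖ξ‖ := norm_pos_iff.2 hξ
  have hη0 : 0 < ‖η‖ := norm_pos_iff.2 hη
  have hρ : 0 < Real.sqrt (‖ξ‖ * ‖η‖) := Real.sqrt_pos.2 (by positivity)
  have hηr : η ^ r ≠ 0 := pow_ne_zero _ hη
  refine ⟨?_, ?_, hρ, Real.sq_sqrt (by positivity), ?_⟩
  · have := Complex.exp_ne_zero (Complex.log (ξ ^ r / η ^ r) / r)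
    field_simp
  · rw [div_pow, mul_pow, ← Complex.exp_nat_mul, mul_div_cancel₀ _ hr',
      Complex.exp_log (div_ne_zero (pow_ne_zero _ hξ) hηr), mul_div_cancel₀ _ hηr,
      div_self (pow_ne_zero _ hξ)]
  · set ρ := Real.sqrt (‖ξ‖ * ‖η‖)
    have hr0 : (0 : ℝ) < r := by exact_mod_cast Nat.pos_of_ne_zero hr
    have hρr : (ρ ^ r) ^ 2 = ‖ξ ^ r‖ * ‖η ^ r‖ := by
      rw [← pow_mul, mul_comm, pow_mul, Real.sq_sqrt (by positivity), mul_pow, norm_pow, norm_pow]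
    have hρr0 : 0 < ρ ^ r := by positivity
    have key : ρ ^ r * ‖Complex.log (ξ ^ r / η ^ r)‖ ≤ 8 / 5 * h := by
      have hsub : ξ ^ r - η ^ r = η ^ r * (ξ ^ r / η ^ r - 1) := by field_simp
      have hn : 0 < ‖η ^ r‖ := norm_pos_iff.2 hηr
      rw [hsub, norm_mul] at hh
      obtain hu | ⟨u, hu, he⟩ := hu
      · have h1 : ‖ξ ^ r / η ^ r‖ = 1 := by rw [norm_div, hu, div_self hn.ne']
        have h2 := norm_log_le_of_norm_eq_one h1
        rw [hu, ← sq] at hρr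
        have h3 : ρ ^ r = ‖η ^ r‖ := (sq_eq_sq₀ hρr0.le hn.le).1 hρr
        rw [h3]
        nlinarith
      · have he' : ξ ^ r / η ^ r = u := by rw [he, mul_div_cancel_right₀ _ hηr]
        rw [he'] at hh ⊢
        have h2 := norm_log_le_of_pos hu
        have h3 : ρ ^ r = ‖η ^ r‖ * Real.sqrt u := by
          refine (sq_eq_sq₀ hρr0.le (by positivity)).1 ?_
          rw [hρr, mul_pow, Real.sq_sqrt hu.le, he, norm_mul, Complex.norm_real,
            Real.norm_of_nonneg hu.le]
          ring
        rw [h3]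
        nlinarith
    rw [norm_div, Complex.norm_natCast, div_le_div_iff₀ hr0 (by positivity)]
    nlinarith

namespace NearRoot

variable {r : ℕ} {h : ℝ} {ω ξ η : ℂ} {ρ : ℝ} {L : ℂ} {ξ' η' : ℂ} {ρ' : ℝ} {L' : ℂ}

theorem norm_omega (hr : r ≠ 0) (N : NearRoot r h ω ξ η ρ L) : ‖ω‖ = 1 :=
  Complex.norm_eq_one_of_pow_eq_one N.pow_eq_one hr

theorem norm_eta (hr : r ≠ 0) (N : NearRoot r h ω ξ η ρ L) :
    ‖η‖ = ρ * Real.exp (-L.re / 2) := by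
  have hρ := N.rho_pos
  refine (sq_eq_sq₀ (norm_nonneg _) (by positivity)).1 ?_
  rw [mul_pow, N.rho_sq, N.eq, norm_mul, norm_mul, N.norm_omega hr, Complex.norm_exp,
    ← Real.exp_nat_mul]
  have : Real.exp L.re * Real.exp ((2 : ℕ) * (-L.re / 2)) = 1 := by
    rw [← Real.exp_add, ← Real.exp_zero]; congr 1; push_cast; ring
  linear_combination -‖η‖ ^ 2 * this

/-- Here e^L − e^L' = e^((L+L')/2) · 2 sinh((L−L')/2), and the first factor turns |ηη'| into ρρ'. -/
theorem norm_cross_eq (hr : r ≠ 0) (N : NearRoot r h ω ξ η ρ L) (N' : NearRoot r h ω ξ' η' ρ' L') :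
    ‖ξ * η' - ξ' * η‖ =
      ρ * ρ' * ‖Complex.exp ((L - L') / 2) - Complex.exp (-((L - L') / 2))‖ := by
  have e : ξ * η' - ξ' * η = ω * (η * η') * (Complex.exp ((L + L') / 2) *
      (Complex.exp ((L - L') / 2) - Complex.exp (-((L - L') / 2)))) := by
    rw [mul_sub, ← Complex.exp_add, ← Complex.exp_add, N.eq, N'.eq,
      show (L + L') / 2 + (L - L') / 2 = L by ring,
      show (L + L') / 2 + -((L - L') / 2) = L' by ring]
    ring
  rw [e, norm_mul, norm_mul, norm_mul, norm_mul, N.norm_omega hr, N.norm_eta hr, N'.norm_eta hr,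
    Complex.norm_exp]
  have : Real.exp (-L.re / 2) * Real.exp (-L'.re / 2) * Real.exp ((L + L') / 2).re = 1 := by
    rw [← Real.exp_add, ← Real.exp_add, ← Real.exp_zero]
    congr 1
    have : ((L + L') / 2).re = (L.re + L'.re) / 2 := by
      rw [show (2 : ℂ) = ((2 : ℝ) : ℂ) by norm_num, Complex.div_ofReal_re, Complex.add_re]
    rw [this]; ring
  linear_combination ρ * ρ' * ‖Complex.exp ((L - L') / 2) - Complex.exp (-((L - L') / 2))‖ * this

theorem norm_exp_sub_exp_neg_le {z : ℂ} (hz : ‖z‖ ≤ 2 / 5) :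
    ‖Complex.exp (z / 2) - Complex.exp (-(z / 2))‖ ≤ 6 / 5 * ‖z‖ := by
  have hn : ‖z / 2‖ = ‖z‖ / 2 := by rw [norm_div, Complex.norm_ofNat]
  have h1 := Complex.norm_exp_sub_one_sub_id_le (x := z / 2) (by rw [hn]; linarith)
  have h2 := Complex.norm_exp_sub_one_sub_id_le (x := -(z / 2)) (by rw [norm_neg, hn]; linarith)
  rw [norm_neg] at h2
  rw [hn] at h1 h2
  have e : Complex.exp (z / 2) - Complex.exp (-(z / 2)) = z + (Complex.exp (z / 2) - 1 - z / 2) -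
      (Complex.exp (-(z / 2)) - 1 - -(z / 2)) := by ring
  rw [e]
  have h3 := norm_sub_le (z + (Complex.exp (z / 2) - 1 - z / 2))
    (Complex.exp (-(z / 2)) - 1 - -(z / 2))
  have h4 := norm_add_le z (Complex.exp (z / 2) - 1 - z / 2)
  nlinarith [norm_nonneg z]

/-- The gap principle. -/
theorem gap (hr : 5 ≤ r) (hh : 0 < h) (N : NearRoot r h ω ξ η ρ L)
    (N' : NearRoot r h ω ξ' η' ρ' L') (hle : ρ ≤ ρ') (h2 : 2 * h ≤ ρ ^ r) :
    ‖ξ * η' - ξ' * η‖ * ρ ^ (r - 1) ≤ h * ρ' := by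
  have hr5 : (5 : ℝ) ≤ r := by exact_mod_cast hr
  have hρ := N.rho_pos
  have hρ' := N'.rho_pos
  have hL : ‖L'‖ ≤ 8 / 5 * h / (r * ρ ^ r) := by
    refine N'.norm_le.trans ?_
    gcongr
  have hsum : ‖L - L'‖ ≤ 16 / 5 * h / (r * ρ ^ r) := by
    refine (norm_sub_le _ _).trans ((add_le_add N.norm_le hL).trans (le_of_eq ?_))
    ring
  have hsmall : 16 / 5 * h / (r * ρ ^ r) ≤ 2 / 5 := by
    rw [div_le_iff₀ (by positivity)]
    nlinarith [mul_le_mul hr5 h2 (by positivity) (by positivity)]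
  rw [norm_cross_eq (by omega) N N']
  have h3 := (norm_exp_sub_exp_neg_le (hsum.trans hsmall)).trans
    (mul_le_mul_of_nonneg_left hsum (by norm_num))
  have hpow : ρ ^ r = ρ * ρ ^ (r - 1) := by rw [← pow_succ']; congr 1; omega
  calc _ ≤ ρ * ρ' * (6 / 5 * (16 / 5 * h / (r * ρ ^ r))) * ρ ^ (r - 1) := by gcongr
    -- 96/25 = (6/5)(16/5) is less than 5 ≤ r.
    _ = 96 / 25 / r * (h * ρ') := by rw [hpow]; field_simp; ring
    _ ≤ 1 * (h * ρ') := by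
      gcongr
      rw [div_le_one (by positivity)]
      linarith
    _ = _ := one_mul _

theorem norm_formVal_le (c : ℕ → ℤ) (n : ℕ) {z : ℂ} {B : ℝ} (hB : 1 ≤ B) (hz : ‖z‖ ≤ B) :
    ‖formVal c n 1 z‖ ≤ ((∑ k ∈ Finset.range (n + 1), |c k| : ℤ) : ℝ) * B ^ n := by
  rw [formVal]
  push_cast
  rw [Finset.sum_mul]
  refine (norm_sum_le _ _).trans (Finset.sum_le_sum fun k hk => ?_)
  rw [norm_mul, Complex.norm_intCast, one_pow, one_mul, norm_pow]
  gcongr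
  exact (pow_le_pow_left₀ (norm_nonneg _) hz _).trans (pow_le_pow_right₀ hB (Nat.sub_le n k))

set_option maxHeartbeats 400000 in
/-- The combination of approximants at one point is small at another one. -/
theorem norm_combination_le (hr : 5 ≤ r) (hh : 0 < h) (N : NearRoot r h ω ξ η ρ L)
    (N' : NearRoot r h ω ξ' η' ρ' L') (hle : ρ ≤ ρ') (h2 : 100 * h ≤ ρ ^ r) {n : ℕ} (hn : 1 ≤ n)
    {c : ℕ → ℤ} {ε : ℂ} (hε : ‖ε‖ = 1) {Rem : ℂ}
    (hRem : Rem = Complex.exp (-((n * r + 1) / 2) * L) *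
      (formVal c n (Complex.exp (r * L)) 1 + ε * Complex.exp L * formVal c n 1 (Complex.exp (r * L))))
    (hbound : ‖Rem‖ ≤ padeBound r n ‖L‖)
    (hsum : ∑ k ∈ Finset.range (n + 1), |c k| ≤ (n * r + 1) * (2 * (4 * (r : ℤ) ^ 2) ^ n)) :
    ‖ξ' * η * formVal c n (ξ ^ r) (η ^ r) + ε * (ξ * η' * formVal c n (η ^ r) (ξ ^ r))‖ ≤
      ρ' * ρ ^ (r * n + 1) * (8 * (16 * r ^ 2) ^ n * ((h / ρ ^ r) ^ (2 * n) + h / ρ' ^ r)) := by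
  have hr5 : (5 : ℝ) ≤ r := by exact_mod_cast hr
  have hr0 : r ≠ 0 := by omega
  have hρ := N.rho_pos
  have hρ' := N'.rho_pos
  have hn1 : (1 : ℝ) ≤ n := by exact_mod_cast hn
  set τ := h / ρ ^ r with hτ
  have hτ1 : τ ≤ 1 / 100 := by rw [hτ, div_le_iff₀ (by positivity)]; linarith
  have hL : ‖L‖ ≤ 8 / 5 * τ / r := by
    refine N.norm_le.trans (le_of_eq ?_)
    rw [hτ]; field_simp
  have hrL : r * ‖L‖ ≤ 8 / 5 * τ := by rw [le_div_iff₀ (by positivity)] at hL; linarith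
  have hL' : ‖L'‖ ≤ 8 / 5 * (h / ρ' ^ r) / r := by
    refine N'.norm_le.trans (le_of_eq ?_)
    field_simp
  have hτ' : h / ρ' ^ r ≤ τ := by rw [hτ]; gcongr
  have hrL' : r * ‖L'‖ ≤ 8 / 5 * τ := by
    rw [le_div_iff₀ (by positivity)] at hL'; linarith
  have hL1 : ‖L‖ ≤ 1 / 100 := by nlinarith [norm_nonneg L]
  have hL1' : ‖L'‖ ≤ 1 / 100 := by nlinarith [norm_nonneg L']
  have hre : |L.re| ≤ ‖L‖ := Complex.abs_re_le_norm L
  have hre' : |L'.re| ≤ ‖L'‖ := Complex.abs_re_le_norm L'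
  have hU : ξ ^ r = η ^ r * Complex.exp (r * L) := by
    rw [N.eq, mul_pow, mul_pow, N.pow_eq_one, ← Complex.exp_nat_mul]; ring
  have hfor1 : formVal c n (ξ ^ r) (η ^ r) = (η ^ r) ^ n * formVal c n (Complex.exp (r * L)) 1 := by
    rw [← formVal_mul, mul_one, hU]
  have hfor2 : formVal c n (η ^ r) (ξ ^ r) = (η ^ r) ^ n * formVal c n 1 (Complex.exp (r * L)) := by
    rw [← formVal_mul, mul_one, hU]
  set f1 := formVal c n (Complex.exp (r * L)) 1
  set f2 := formVal c n 1 (Complex.exp (r * L)) with hf2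
  have hRem' : f1 + ε * Complex.exp L * f2 = Complex.exp ((n * r + 1) / 2 * L) * Rem := by
    rw [hRem, ← mul_assoc, ← Complex.exp_add, neg_mul, add_neg_cancel, Complex.exp_zero, one_mul]
  -- The first summand is the Padé remainder at the smaller point, the second the error e^L' − 1 at
  -- the larger point.
  have hmain : ξ' * η * formVal c n (ξ ^ r) (η ^ r) + ε * (ξ * η' * formVal c n (η ^ r) (ξ ^ r)) =
      ω * (η * η' * (η ^ r) ^ n) * (Complex.exp L' * (Complex.exp ((n * r + 1) / 2 * L) * Rem) -
        ε * (Complex.exp L' - 1) * Complex.exp L * f2) := by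
    rw [hfor1, hfor2, ← hRem', N.eq, N'.eq]; ring
  have hfac : ‖ω * (η * η' * (η ^ r) ^ n)‖ = ρ' * ρ ^ (r * n + 1) *
      Real.exp (-(n * r + 1) / 2 * L.re - L'.re / 2) := by
    rw [norm_mul, N.norm_omega hr0, one_mul, norm_mul, norm_mul, ← pow_mul, norm_pow,
      N.norm_eta hr0, N'.norm_eta hr0, mul_pow, ← Real.exp_nat_mul,
      show -((n : ℝ) * r + 1) / 2 * L.re - L'.re / 2 =
        -L.re / 2 + -L'.re / 2 + (r * n : ℕ) * (-L.re / 2) by push_cast; ring,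
      Real.exp_add, Real.exp_add]
    ring
  have hre1 : ((n * r + 1) / 2 * L : ℂ).re = (n * r + 1) / 2 * L.re := by
    rw [show ((n * r + 1) / 2 : ℂ) = (((n * r + 1) / 2 : ℝ) : ℂ) by push_cast; rfl,
      Complex.re_ofReal_mul]
  have hre2 : (r * L : ℂ).re = r * L.re := by
    rw [← Complex.ofReal_natCast, Complex.re_ofReal_mul]
  rw [hmain, norm_mul, hfac]
  -- Since r‖L‖ ≤ 2/125, all exponentials of L and L' below combine to at most e^(n/4).
  have hexpn : Real.exp (n / 4) ≤ 2 ^ n := by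
    rw [show (n : ℝ) / 4 = n * (1 / 4) by ring, Real.exp_nat_mul]
    gcongr
    have h4 : Real.exp (1 / 4) ^ 4 ≤ 2 ^ 4 := by
      rw [← Real.exp_nat_mul]
      have := Real.exp_one_lt_three
      norm_num
      linarith
    exact le_of_pow_le_pow_left₀ (by norm_num) (by norm_num) h4
  have hnrL : n * r * ‖L‖ ≤ n * (2 / 125) := by nlinarith
  have hnr0 : 0 ≤ n * r * ‖L‖ := by positivity
  have hnre : |n * r * L.re| ≤ n * r * ‖L‖ := by
    rw [abs_mul, abs_of_nonneg (by positivity : (0 : ℝ) ≤ n * r)]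
    gcongr
  rw [abs_le] at hre hre' hnre
  -- the remainder term
  have hT1 : Real.exp (-(n * r + 1) / 2 * L.re - L'.re / 2) *
      ‖Complex.exp L' * (Complex.exp ((n * r + 1) / 2 * L) * Rem)‖ ≤
        8 * (16 * r ^ 2) ^ n * τ ^ (2 * n) := by
    rw [norm_mul, norm_mul, Complex.norm_exp, Complex.norm_exp, hre1, ← mul_assoc, ← mul_assoc,
      ← Real.exp_add, ← Real.exp_add]
    have e1 : -((n : ℝ) * r + 1) / 2 * L.re - L'.re / 2 + L'.re + (n * r + 1) / 2 * L.re =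
        L'.re / 2 := by ring
    rw [e1]
    have e2 : 1 + ((n : ℝ) * r + 1) * ‖L‖ ≤ Real.exp ((n * r + 1) * ‖L‖) := by
      have := Real.add_one_le_exp (((n : ℝ) * r + 1) * ‖L‖)
      linarith
    have e3 : (r : ℝ) ^ (4 * n) * ‖L‖ ^ (2 * n) ≤ (r ^ 2) ^ n * (64 / 25) ^ n * τ ^ (2 * n) := by
      calc (r : ℝ) ^ (4 * n) * ‖L‖ ^ (2 * n) = (r ^ 2) ^ n * (r * ‖L‖) ^ (2 * n) := by
            rw [mul_pow, ← pow_mul, ← mul_assoc, ← pow_add]; congr 2; ring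
        _ ≤ (r ^ 2) ^ n * (8 / 5 * τ) ^ (2 * n) := by gcongr
        _ = _ := by rw [mul_pow, pow_mul (8 / 5 : ℝ)]; norm_num; ring
    calc Real.exp (L'.re / 2) * ‖Rem‖
        ≤ Real.exp (L'.re / 2) * padeBound r n ‖L‖ := by gcongr
      _ ≤ Real.exp (L'.re / 2) * (2 * (r ^ (4 * n) * ‖L‖ ^ (2 * n)) *
          Real.exp ((n * r + 1) * ‖L‖) * Real.exp ((n * r + 1) / 2 * ‖L‖)) := by
        rw [padeBound, ← mul_assoc (2 : ℝ)]; gcongr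
      _ = 2 * (r ^ (4 * n) * ‖L‖ ^ (2 * n)) * Real.exp (L'.re / 2 + (n * r + 1) * ‖L‖ +
          (n * r + 1) / 2 * ‖L‖) := by rw [Real.exp_add, Real.exp_add]; ring
      _ ≤ 2 * ((r ^ 2) ^ n * (64 / 25) ^ n * τ ^ (2 * n)) * Real.exp (n / 4) := by
        gcongr
        linarith
      _ ≤ 2 * ((r ^ 2) ^ n * (64 / 25) ^ n * τ ^ (2 * n)) * 2 ^ n := by gcongr
      _ = 2 * ((64 / 25 * 2) * r ^ 2) ^ n * τ ^ (2 * n) := by rw [mul_pow, mul_pow]; ring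
      _ ≤ 8 * (16 * r ^ 2) ^ n * τ ^ (2 * n) := by gcongr <;> norm_num
  -- the term from the second point
  have hT2 : Real.exp (-(n * r + 1) / 2 * L.re - L'.re / 2) *
      ‖ε * (Complex.exp L' - 1) * Complex.exp L * f2‖ ≤
        8 * (16 * r ^ 2) ^ n * (h / ρ' ^ r) := by
    have e1 : ‖Complex.exp L' - 1‖ ≤ 2 * (8 / 5 * (h / ρ' ^ r) / r) :=
      (Complex.norm_exp_sub_one_le (by linarith)).trans (by gcongr)
    have e2 : ‖f2‖ ≤ ((∑ k ∈ Finset.range (n + 1), |c k| : ℤ) : ℝ) * Real.exp (r * ‖L‖) ^ n := by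
      refine norm_formVal_le c n (Real.one_le_exp (by positivity)) ?_
      rw [Complex.norm_exp, hre2]
      gcongr
      exact hre.2
    have e3 : ((∑ k ∈ Finset.range (n + 1), |c k| : ℤ) : ℝ) ≤ r * 2 ^ n * (2 * (4 * r ^ 2) ^ n) := by
      have h1 : ((∑ k ∈ Finset.range (n + 1), |c k| : ℤ) : ℝ) ≤
          (n * r + 1) * (2 * (4 * (r : ℝ) ^ 2) ^ n) := by exact_mod_cast hsum
      refine h1.trans ?_
      gcongr
      have h3 : (n : ℝ) + 1 ≤ 2 ^ n := by exact_mod_cast Nat.lt_two_pow_self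
      nlinarith
    rw [norm_mul, norm_mul, norm_mul, hε, one_mul, Complex.norm_exp]
    calc _ ≤ Real.exp (-(n * r + 1) / 2 * L.re - L'.re / 2) *
          ((2 * (8 / 5 * (h / ρ' ^ r) / r)) * Real.exp L.re *
            ((r * 2 ^ n * (2 * (4 * r ^ 2) ^ n)) * Real.exp (r * ‖L‖) ^ n)) := by
          gcongr
          exact e2.trans (by gcongr)
      _ = 32 / 5 * (h / ρ' ^ r) * (2 ^ n * (4 * r ^ 2) ^ n) *
          Real.exp (-(n * r + 1) / 2 * L.re - L'.re / 2 + L.re + n * (r * ‖L‖)) := by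
        rw [Real.exp_add, Real.exp_add, Real.exp_nat_mul (r * ‖L‖) n]
        generalize Real.exp (r * ‖L‖) = E
        field_simp
        ring
      _ ≤ 32 / 5 * (h / ρ' ^ r) * (2 ^ n * (4 * r ^ 2) ^ n) * Real.exp (n / 4) := by
        gcongr
        linarith
      _ ≤ 32 / 5 * (h / ρ' ^ r) * (2 ^ n * (4 * r ^ 2) ^ n) * 2 ^ n := by gcongr
      _ = 32 / 5 * (16 * r ^ 2) ^ n * (h / ρ' ^ r) := by
        -- 4r² comes from the coefficients, one factor 2 from nr + 1 and the other from the
        -- exponentials.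
        rw [show (16 * (r : ℝ) ^ 2) = 2 * (4 * r ^ 2) * 2 by ring,
          mul_pow (2 * (4 * (r : ℝ) ^ 2)) 2, mul_pow 2 (4 * (r : ℝ) ^ 2)]
        ring
      _ ≤ _ := by gcongr; norm_num
  calc _ ≤ ρ' * ρ ^ (r * n + 1) * Real.exp (-(n * r + 1) / 2 * L.re - L'.re / 2) *
        (‖Complex.exp L' * (Complex.exp ((n * r + 1) / 2 * L) * Rem)‖ +
          ‖ε * (Complex.exp L' - 1) * Complex.exp L * f2‖) := by
        gcongr; exact norm_sub_le _ _
    _ = ρ' * ρ ^ (r * n + 1) * (Real.exp (-(n * r + 1) / 2 * L.re - L'.re / 2) *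
        ‖Complex.exp L' * (Complex.exp ((n * r + 1) / 2 * L) * Rem)‖ +
        Real.exp (-(n * r + 1) / 2 * L.re - L'.re / 2) *
          ‖ε * (Complex.exp L' - 1) * Complex.exp L * f2‖) := by ring
    _ ≤ ρ' * ρ ^ (r * n + 1) * (8 * (16 * r ^ 2) ^ n * τ ^ (2 * n) +
        8 * (16 * r ^ 2) ^ n * (h / ρ' ^ r)) := by gcongr
    _ = _ := by ring

end NearRoot

/-- The fundamental inequality for two points close to the same root of unity. -/
theorem Setting.norm_disc_le_of_nearRoot {F : MvPolynomial (Fin 2) ℤ} {r : ℕ} {α β γ δ χ : ℂ}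
    {A B C : ℤ} (S : Setting F r α β γ δ χ A B C) {p q : ℤ × ℤ} {h : ℝ} (hh : 0 < h) {ω : ℂ}
    {ρ ρ' : ℝ} {L L' : ℂ} (N : NearRoot r h ω (lin α β p) (lin γ δ p) ρ L)
    (N' : NearRoot r h ω (lin α β q) (lin γ δ q) ρ' L') (hle : ρ ≤ ρ')
    (h2 : 100 * h ≤ ρ ^ r) (hne : value F p ≠ 0) {n : ℕ} (hn : 1 ≤ n) :
    ‖α * δ - β * γ‖ ≤ (2 * r * ‖(α * δ - β * γ) / χ‖) ^ n * ‖(α * δ - β * γ) / χ‖ *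
      (ρ' * ρ ^ (r * n + 1) *
        (8 * (16 * r ^ 2) ^ n * ((h / ρ ^ r) ^ (2 * n) + h / ρ' ^ r))) := by
  have hr := S.five_le
  have hη : lin γ δ p ≠ 0 := by
    intro h0
    have := N.rho_sq
    rw [h0, norm_zero, mul_zero] at this
    exact (pow_pos N.rho_pos 2).ne' this
  have hξ' : lin α β q ≠ 0 := by
    intro h0
    have := N'.rho_sq
    rw [h0, norm_zero, zero_mul] at this
    exact (pow_pos N'.rho_pos 2).ne' this
  have hUV : lin α β p ^ r ≠ lin γ δ p ^ r := by
    intro h0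
    have := value_eq S.diag p
    rw [h0, sub_self] at this
    exact hne (by exact_mod_cast this)
  have hsum := sum_abs_padeCoeff_le (r := r) (n := n) (by omega)
  rcases formVal_ne_zero (r := r) (by omega) n (p := lin α β q * lin γ δ p)
    (q := lin α β p * lin γ δ q) hUV (pow_ne_zero r hη) (mul_ne_zero hξ' hη) with h0 | h0
  · refine (S.norm_disc_le p q _ n (Or.inl rfl) h0).trans ?_
    refine mul_le_mul_of_nonneg_left ?_ (by positivity)
    have := NearRoot.norm_combination_le hr hh N N' hle h2 hn (c := padeCoeff r n) (ε := -1)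
      (by simp) (by rw [padeRem_eq]; ring) (norm_padeRem_le (by omega) n L) hsum.1
    rwa [neg_one_mul, ← sub_eq_add_neg] at this
  · refine (S.norm_disc_le p q _ n (Or.inr rfl) h0).trans ?_
    refine mul_le_mul_of_nonneg_left ?_ (by positivity)
    have := NearRoot.norm_combination_le hr hh N N' hle h2 hn (c := padeCoeff' r n) (ε := 1)
      (by simp) (by rw [padeRem'_eq]; ring) (norm_padeRem'_le (by omega) n L) hsum.2
    rwa [one_mul] at this

/-! ### Iteration over the degree of the approximants -/

section Iteration

variable {r : ℕ} {h J j d x y : ℝ}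

/-- After multiplication by r the right side of `hP` is at least 1. By `hlt` the term with h / y ^ r
is below 1/2, so the other one is at least 1/2. -/
theorem pow_le_mul_of_lt_pow (hr : 5 ≤ r) (hh : 1 ≤ h) (hJ : 1 ≤ J) (hj : 1 / (r : ℝ) ≤ j)
    (hd : 1 ≤ d) (hd' : d ≤ r * J ^ 2) (hx : 0 < x) (hy : 0 < y) {n : ℕ} (hn : 1 ≤ n)
    (hP : j ≤ (2 * r * d) ^ n * d *
      (y * x ^ (r * n + 1) * (8 * (16 * r ^ 2) ^ n * ((h / x ^ r) ^ (2 * n) + h / y ^ r))))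
    (hlt : r ^ (7 * n + 5) * J ^ (2 * n + 2) * h * x ^ (r * n + 1) < y ^ (r - 1)) :
    x ^ (r * n - 1) ≤ r ^ (7 * n + 5) * J ^ (2 * n + 2) * h ^ (2 * n) * y := by
  have hr5 : (5 : ℝ) ≤ r := by exact_mod_cast hr
  set W : ℝ := (2 * r * d) ^ n * d * (8 * (16 * r ^ 2) ^ n) with hW
  have hW0 : 0 < W := by positivity
  have hWle : 2 * r * W ≤ r ^ (7 * n + 5) * J ^ (2 * n + 2) := by
    have h1 : 2 * r * d * (16 * r ^ 2) ≤ r ^ 7 * J ^ 2 := by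
      calc 2 * r * d * (16 * r ^ 2) ≤ 2 * r * (r * J ^ 2) * (16 * r ^ 2) := by gcongr
        _ = 32 * (r ^ 4 * J ^ 2) := by ring
        _ ≤ r ^ 3 * (r ^ 4 * J ^ 2) := by
          gcongr
          calc (32 : ℝ) ≤ 5 ^ 3 := by norm_num
            _ ≤ _ := by gcongr
        _ = _ := by ring
    have h2 : 2 * r * (8 * d) ≤ r ^ 5 * J ^ 2 := by
      calc 2 * r * (8 * d) ≤ 2 * r * (8 * (r * J ^ 2)) := by gcongr
        _ = 16 * (r ^ 2 * J ^ 2) := by ring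
        _ ≤ r ^ 3 * (r ^ 2 * J ^ 2) := by
          gcongr
          calc (16 : ℝ) ≤ 5 ^ 3 := by norm_num
            _ ≤ _ := by gcongr
        _ = _ := by ring
    calc 2 * r * W = (2 * r * d * (16 * r ^ 2)) ^ n * (2 * r * (8 * d)) := by
          rw [hW, mul_pow (2 * r * d)]; ring
      _ ≤ (r ^ 7 * J ^ 2) ^ n * (r ^ 5 * J ^ 2) := by gcongr
      _ = _ := by rw [mul_pow, ← pow_mul, ← pow_mul, pow_add, pow_add J]; ring
  have hP' : 1 ≤ r * W * (y * x ^ (r * n + 1) * h ^ (2 * n) / x ^ (2 * r * n)) +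
      r * W * (h * x ^ (r * n + 1) / y ^ (r - 1)) := by
    have h1 : 1 ≤ r * j := by
      rw [div_le_iff₀ (by positivity)] at hj
      linarith
    have h2 := mul_le_mul_of_nonneg_left hP (by positivity : (0 : ℝ) ≤ r)
    refine h1.trans (h2.trans (le_of_eq ?_))
    have e : y ^ r = y * y ^ (r - 1) := by rw [← pow_succ']; congr 1; omega
    rw [hW, e, div_pow, ← pow_mul, show r * (2 * n) = 2 * r * n by ring]
    field_simp
  have hsecond : r * W * (h * x ^ (r * n + 1) / y ^ (r - 1)) < 1 / 2 := by
    rw [← mul_div_assoc, div_lt_iff₀ (by positivity)]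
    have : 2 * r * W * (h * x ^ (r * n + 1)) ≤
        r ^ (7 * n + 5) * J ^ (2 * n + 2) * (h * x ^ (r * n + 1)) := by gcongr
    nlinarith
  have hfirst : 1 / 2 ≤ r * W * (y * x ^ (r * n + 1) * h ^ (2 * n) / x ^ (2 * r * n)) := by
    linarith
  rw [← mul_div_assoc, le_div_iff₀ (by positivity)] at hfirst
  have hrn : 1 ≤ r * n := Nat.mul_pos (by omega) hn
  have e : x ^ (2 * r * n) = x ^ (r * n - 1) * x ^ (r * n + 1) := by
    rw [← pow_add]; congr 1; rw [mul_assoc]; omega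
  rw [e] at hfirst
  have hfin : x ^ (r * n - 1) * x ^ (r * n + 1) ≤
      2 * r * W * h ^ (2 * n) * y * x ^ (r * n + 1) := by linarith
  have := le_of_mul_le_mul_right hfin (by positivity)
  refine this.trans ?_
  gcongr

/-- The approximant of degree n yields x^((r−2)n−1) ≤ y, which makes the term with h / y ^ r
negligible for degree n + 1. So y would exceed every power of x. The size of x absorbs all
constants. -/
theorem no_large_pair (hr : 5 ≤ r) (hh : 1 ≤ h) (hJ : 1 ≤ J) (hj : 1 / (r : ℝ) ≤ j)
    (hd : 1 ≤ d) (hd' : d ≤ r * J ^ 2) (hx : r ^ 10 * h * J ^ r ≤ x) (hxy : x ≤ y)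
    (hgap : j * x ^ (r - 1) ≤ h * y)
    (hP : ∀ n : ℕ, 1 ≤ n → j ≤ (2 * r * d) ^ n * d *
      (y * x ^ (r * n + 1) * (8 * (16 * r ^ 2) ^ n * ((h / x ^ r) ^ (2 * n) + h / y ^ r)))) :
    False := by
  have hr5 : (5 : ℝ) ≤ r := by exact_mod_cast hr
  have hr1 : (1 : ℝ) < r := by linarith
  have hx' : r ^ 10 * h * J ^ 5 ≤ x := by
    refine le_trans ?_ hx
    gcongr
  have hx0 : 0 < x := lt_of_lt_of_le (by positivity) hx'
  have hy0 : 0 < y := hx0.trans_le hxy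
  have hx1 : 1 < x := by
    refine lt_of_lt_of_le ?_ hx'
    have h1 : (1 : ℝ) < r ^ 10 := one_lt_pow₀ hr1 (by norm_num)
    have h2 : (1 : ℝ) ≤ J ^ 5 := one_le_pow₀ hJ
    calc (1 : ℝ) < r ^ 10 := h1
      _ = r ^ 10 * 1 * 1 := by ring
      _ ≤ _ := by gcongr
  have hloss : ∀ n : ℕ, 1 ≤ n → r ^ (7 * n + 5) * J ^ (2 * n + 2) * h ^ (2 * n) ≤ x ^ (2 * n) := by
    intro n hn
    calc (r : ℝ) ^ (7 * n + 5) * J ^ (2 * n + 2) * h ^ (2 * n)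
        ≤ r ^ (10 * (2 * n)) * J ^ (5 * (2 * n)) * h ^ (2 * n) := by
          gcongr
          · exact hr1.le
          · omega
          · omega
      _ = (r ^ 10 * h * J ^ 5) ^ (2 * n) := by rw [mul_pow, mul_pow, pow_mul, pow_mul]; ring
      _ ≤ _ := by gcongr
  have hloss' : ∀ n : ℕ, 2 ≤ n → r ^ (7 * n + 5) * J ^ (2 * n + 2) * h < x ^ n := by
    intro n hn
    calc (r : ℝ) ^ (7 * n + 5) * J ^ (2 * n + 2) * h
        < r ^ (10 * n) * J ^ (2 * n + 2) * h := by
          gcongr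
          omega
      _ ≤ r ^ (10 * n) * J ^ (5 * n) * h ^ n := by
          gcongr
          · omega
          · exact le_self_pow₀ hh (by omega)
      _ = (r ^ 10 * h * J ^ 5) ^ n := by rw [mul_pow, mul_pow, pow_mul, pow_mul]; ring
      _ ≤ _ := by gcongr
  have hstep : ∀ n : ℕ, 1 ≤ n →
      r ^ (7 * n + 5) * J ^ (2 * n + 2) * h * x ^ (r * n + 1) < y ^ (r - 1) →
      x ^ ((r - 2) * n - 1) ≤ y := by
    intro n hn hlt
    have h1 := pow_le_mul_of_lt_pow hr hh hJ hj hd hd' hx0 hy0 hn (hP n hn) hlt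
    have h2 : x ^ (r * n - 1) ≤ x ^ (2 * n) * y :=
      h1.trans (mul_le_mul_of_nonneg_right (hloss n hn) hy0.le)
    have e : x ^ (r * n - 1) = x ^ (2 * n) * x ^ ((r - 2) * n - 1) := by
      rw [← pow_add]; congr 1
      have : 3 * 1 ≤ (r - 2) * n := Nat.mul_le_mul (by omega) hn
      have : r * n = 2 * n + (r - 2) * n := by rw [← add_mul]; congr 1; omega
      omega
    rw [e] at h2
    exact le_of_mul_le_mul_left h2 (by positivity)
  have hbase : x ^ ((r - 2) * 2 - 1) ≤ y := by
    refine hstep 2 (by norm_num) ?_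
    have h1 : x ^ (r - 1) ≤ r * h * y := by
      rw [div_le_iff₀ (by positivity)] at hj
      have : x ^ (r - 1) * 1 ≤ x ^ (r - 1) * (j * r) := by gcongr
      nlinarith
    have h2 : x ^ ((r - 1) * (r - 1)) ≤ r ^ (r - 1) * h ^ (r - 1) * y ^ (r - 1) := by
      rw [pow_mul, ← mul_pow, ← mul_pow]
      gcongr
    have h3 : (r : ℝ) ^ (r - 1) * h ^ (r - 1) * (r ^ (7 * 2 + 5) * J ^ (2 * 2 + 2) * h) < x ^ r := by
      calc (r : ℝ) ^ (r - 1) * h ^ (r - 1) * (r ^ (7 * 2 + 5) * J ^ (2 * 2 + 2) * h)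
          = r ^ (r - 1 + 19) * (h ^ (r - 1) * h) * J ^ 6 := by rw [pow_add]; ring
        _ = r ^ (r - 1 + 19) * h ^ r * J ^ 6 := by
          rw [← pow_succ, Nat.sub_add_cancel (by omega)]
        _ < r ^ (10 * r) * h ^ r * J ^ 6 := by
          gcongr
          omega
        _ ≤ r ^ (10 * r) * h ^ r * J ^ (5 * r) := by
          gcongr
          · omega
        _ = (r ^ 10 * h * J ^ 5) ^ r := by rw [mul_pow, mul_pow, pow_mul, pow_mul]
        _ ≤ _ := by gcongr
    -- The gap principle alone starts the induction at n = 2, because 3r + 1 ≤ (r − 1)², with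
    -- equality for r = 5.
    have h4 : x ^ r * x ^ (r * 2 + 1) ≤ x ^ ((r - 1) * (r - 1)) := by
      rw [← pow_add]
      refine pow_le_pow_right₀ hx1.le ?_
      obtain ⟨k, rfl⟩ := Nat.exists_eq_add_of_le hr
      rw [show 5 + k - 1 = 4 + k by omega]
      nlinarith
    have h5 : r ^ (r - 1) * h ^ (r - 1) *
        (r ^ (7 * 2 + 5) * J ^ (2 * 2 + 2) * h * x ^ (r * 2 + 1)) <
        r ^ (r - 1) * h ^ (r - 1) * y ^ (r - 1) := by
      calc _ = (r : ℝ) ^ (r - 1) * h ^ (r - 1) * (r ^ (7 * 2 + 5) * J ^ (2 * 2 + 2) * h) *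
            x ^ (r * 2 + 1) := by ring
        _ < x ^ r * x ^ (r * 2 + 1) := by gcongr
        _ ≤ _ := h4.trans h2
    exact lt_of_mul_lt_mul_left h5 (by positivity)
  have hall : ∀ k : ℕ, x ^ ((r - 2) * (k + 2) - 1) ≤ y := by
    intro k
    induction k with
    | zero => exact hbase
    | succ k ih =>
      refine hstep (k + 1 + 2) (by omega) ?_
      calc r ^ (7 * (k + 1 + 2) + 5) * J ^ (2 * (k + 1 + 2) + 2) * h * x ^ (r * (k + 1 + 2) + 1)
          < x ^ (k + 1 + 2) * x ^ (r * (k + 1 + 2) + 1) := by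
            gcongr
            exact hloss' (k + 1 + 2) (by omega)
        _ ≤ x ^ (((r - 2) * (k + 2) - 1) * (r - 1)) := by
          rw [← pow_add]
          refine pow_le_pow_right₀ hx1.le ?_
          obtain ⟨l, rfl⟩ := Nat.exists_eq_add_of_le hr
          rw [show 5 + l - 2 = 3 + l by omega, show 5 + l - 1 = 4 + l by omega,
            show (3 + l) * (k + 2) - 1 = 3 * k + l * k + 2 * l + 5 by
              rw [show (3 + l) * (k + 2) = 3 * k + l * k + 2 * l + 5 + 1 by ring]; rfl]
          nlinarith [Nat.zero_le (l * k), Nat.zero_le (l * l * k), Nat.zero_le (l * l)]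
        _ ≤ y ^ (r - 1) := by rw [pow_mul]; gcongr
  obtain ⟨k, hk⟩ := pow_unbounded_of_one_lt y hx1
  refine absurd (hall k) (not_le.2 (hk.trans_le (pow_le_pow_right₀ hx1.le ?_)))
  have : 3 * (k + 2) ≤ (r - 2) * (k + 2) := Nat.mul_le_mul_right _ (by omega)
  omega

end Iteration

/-! ### The Hessian bound and the effect of repeated gaps -/

/-- The bound on the Hessian divided by `r ^ 4 h ^ 2`. -/
noncomputable def sizeBound (r m : ℕ) (h : ℝ) (j : ℂ) : ℝ :=
  (r : ℝ) ^ (1 + (11 * (r : ℝ) - 3) / ((r : ℝ) - 1) ^ (m - 1)) *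
    h ^ (2 * ((r : ℝ) - 3) / ((r : ℝ) - 1) ^ (m - 1)) * ‖j‖ ^ expJ r m j

theorem hessianBound_eq {r m : ℕ} (hr : 5 ≤ r) {h : ℤ} (hh : 1 ≤ h) (j : ℂ) :
    hessianBound r m h j = r ^ 4 * (h : ℝ) ^ 2 * sizeBound r m h j := by
  have hr0 : (0 : ℝ) < r := by exact_mod_cast (by omega : 0 < r)
  have hh0 : (0 : ℝ) < h := by exact_mod_cast (by omega : 0 < h)
  have e1 : (r : ℝ) ^ expR r m =
      r ^ 4 * (r : ℝ) ^ (1 + (11 * (r : ℝ) - 3) / ((r : ℝ) - 1) ^ (m - 1)) := by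
    rw [← Real.rpow_natCast, ← Real.rpow_add hr0, expR]; congr 1; push_cast; ring
  have e2 : (h : ℝ) ^ expH r m =
      (h : ℝ) ^ 2 * (h : ℝ) ^ (2 * ((r : ℝ) - 3) / ((r : ℝ) - 1) ^ (m - 1)) := by
    rw [← Real.rpow_natCast, ← Real.rpow_add hh0, expH]; congr 1
  rw [hessianBound, e1, e2, sizeBound]
  ring

section

variable {r m : ℕ} {h : ℝ} {j : ℂ} {ρ : ℝ}

theorem sizeBound_pos (hr : 5 ≤ r) (hh : 1 ≤ h) (hj : j ≠ 0) : 0 < sizeBound r m h j := by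
  have hr0 : (0 : ℝ) < r := by exact_mod_cast (by omega : 0 < r)
  have hj0 : 0 < ‖j‖ := norm_pos_iff.2 hj
  unfold sizeBound
  positivity

theorem one_le_pow_sub_one (hr : 5 ≤ r) (m : ℕ) : (1 : ℝ) ≤ ((r : ℝ) - 1) ^ (m - 1) := by
  have hr5 : (5 : ℝ) ≤ r := by exact_mod_cast hr
  exact one_le_pow₀ (by linarith)

theorem sq_norm_le_rpow_expJ (hr : 5 ≤ r) (hj : j ≠ 0) : ‖j‖ ^ 2 ≤ ‖j‖ ^ expJ r m j := by
  have hr5 : (5 : ℝ) ≤ r := by exact_mod_cast hr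
  have hj0 : 0 < ‖j‖ := norm_pos_iff.2 hj
  rw [← Real.rpow_natCast]
  by_cases h1 : 1 ≤ ‖j‖
  · rw [expJ, if_pos h1]; norm_num
  · rw [expJ, if_neg h1]
    refine Real.rpow_le_rpow_of_exponent_ge hj0 (not_le.1 h1).le ?_
    have := one_le_pow_sub_one hr m
    rw [div_le_iff₀ (by nlinarith)]
    push_cast
    nlinarith

theorem mul_sq_le_sizeBound (hr : 5 ≤ r) (hh : 1 ≤ h) (hj : j ≠ 0) :
    r * ‖j‖ ^ 2 ≤ sizeBound r m h j := by
  have hr5 : (5 : ℝ) ≤ r := by exact_mod_cast hr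
  have hE := one_le_pow_sub_one hr m
  have h1 : (r : ℝ) ≤ (r : ℝ) ^ (1 + (11 * (r : ℝ) - 3) / ((r : ℝ) - 1) ^ (m - 1)) := by
    refine Real.self_le_rpow_of_one_le (by linarith) ?_
    have : 0 ≤ (11 * (r : ℝ) - 3) / ((r : ℝ) - 1) ^ (m - 1) := div_nonneg (by linarith) (by linarith)
    linarith
  have h2 : (1 : ℝ) ≤ h ^ (2 * ((r : ℝ) - 3) / ((r : ℝ) - 1) ^ (m - 1)) :=
    Real.one_le_rpow hh (div_nonneg (by linarith) (by linarith))
  have h3 := sq_norm_le_rpow_expJ (m := m) hr hj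
  calc (r : ℝ) * ‖j‖ ^ 2 = r * 1 * ‖j‖ ^ 2 := by ring
    _ ≤ _ := by unfold sizeBound; gcongr

/-- Provides the room needed by the gap principle and, for D > 0, by the argument that ξ^r and η^r
have the same sign. -/
theorem two_mul_le_pow_of_sizeBound_le (hr : 5 ≤ r) (hh : 1 ≤ h) (hj : j ≠ 0) (hρ : 0 ≤ ρ)
    (hw : sizeBound r m h j ≤ (ρ ^ (r - 2) * ‖j‖ / h) ^ 2) : 2 * h ≤ ρ ^ r := by
  have hr5 : (5 : ℝ) ≤ r := by exact_mod_cast hr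
  have hj0 : 0 < ‖j‖ := norm_pos_iff.2 hj
  have h1 := (mul_sq_le_sizeBound hr hh hj).trans hw
  have h2 : (2 * ‖j‖) ^ 2 ≤ (ρ ^ (r - 2) * ‖j‖ / h) ^ 2 := by nlinarith [sq_nonneg ‖j‖]
  have h3 : 2 * ‖j‖ ≤ ρ ^ (r - 2) * ‖j‖ / h :=
    le_of_sq_le_sq h2 (by positivity)
  rw [le_div_iff₀ (by linarith)] at h3
  have h4 : 2 * h ≤ ρ ^ (r - 2) := by nlinarith
  have h5 : 1 ≤ ρ := by
    by_contra hlt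
    have : ρ ^ (r - 2) ≤ 1 := pow_le_one₀ hρ (not_le.1 hlt).le
    linarith
  exact h4.trans (pow_le_pow_right₀ h5 (Nat.sub_le r 2))

/-- The power is the effect of m − 1 gaps; it clears the denominators in the exponents of r and h.
-/
theorem sizeBound_pow (hr : 5 ≤ r) (hh : 1 ≤ h) (j : ℂ) :
    sizeBound r m h j ^ ((r - 1) ^ (m - 1)) =
      (r : ℝ) ^ ((r - 1) ^ (m - 1) + (11 * r - 3)) * h ^ (2 * (r - 3)) *
        ‖j‖ ^ (expJ r m j * ((r : ℝ) - 1) ^ (m - 1)) := by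
  have hr5 : (5 : ℝ) ≤ r := by exact_mod_cast hr
  have hE0 : ((r : ℝ) - 1) ^ (m - 1) ≠ 0 := (zero_lt_one.trans_le (one_le_pow_sub_one hr m)).ne'
  have hcast : (((r - 1) ^ (m - 1) : ℕ) : ℝ) = ((r : ℝ) - 1) ^ (m - 1) := by
    push_cast [Nat.cast_sub (by omega : 1 ≤ r)]; rfl
  have e1 : (1 + (11 * (r : ℝ) - 3) / ((r : ℝ) - 1) ^ (m - 1)) * ((r : ℝ) - 1) ^ (m - 1) =
      (((r - 1) ^ (m - 1) + (11 * r - 3) : ℕ) : ℝ) := by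
    rw [Nat.cast_add, hcast, add_mul, one_mul, div_mul_cancel₀ _ hE0,
      Nat.cast_sub (by omega : 3 ≤ 11 * r)]
    push_cast; ring
  have e2 : 2 * ((r : ℝ) - 3) / ((r : ℝ) - 1) ^ (m - 1) * ((r : ℝ) - 1) ^ (m - 1) =
      ((2 * (r - 3) : ℕ) : ℝ) := by
    rw [div_mul_cancel₀ _ hE0, Nat.cast_mul, Nat.cast_sub (by omega : 3 ≤ r)]
    push_cast; ring
  have e3 : ∀ x y : ℝ, 0 ≤ x → (x ^ y) ^ ((r - 1) ^ (m - 1)) =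
      x ^ (y * ((r : ℝ) - 1) ^ (m - 1)) := by
    intro x y hx
    rw [← hcast, Real.rpow_mul hx, Real.rpow_natCast]
  rw [sizeBound, mul_pow, mul_pow, e3 _ _ (by linarith), e3 _ _ (by linarith),
    e3 _ _ (norm_nonneg _), e1, e2, Real.rpow_natCast, Real.rpow_natCast]

theorem le_of_sizeBound_pow_le (hr : 5 ≤ r) (hm : 3 ≤ m) (hh : 1 ≤ h) (hj : j ≠ 0) (hρ : 0 ≤ ρ)
    (hw : sizeBound r m h j ^ ((r - 1) ^ (m - 1)) ≤ (ρ ^ (r - 2) * ‖j‖ / h) ^ 2) :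
    r ^ 10 * h * max ‖j‖ 1 ^ r ≤ ρ := by
  have hr5 : (5 : ℝ) ≤ r := by exact_mod_cast hr
  have hj0 : 0 < ‖j‖ := norm_pos_iff.2 hj
  have hE : (r - 1) ^ 2 ≤ (r - 1) ^ (m - 1) := Nat.pow_le_pow_right (by omega) (by omega)
  -- By (r−1)² ≤ (r−1)^(m−1) this reduces to r² − 11r + 38 ≥ 0, a quadratic without real roots.
  have hexp : 20 * (r - 2) ≤ (r - 1) ^ (m - 1) + (11 * r - 3) := by
    refine le_trans ?_ (Nat.add_le_add_right hE _)
    obtain ⟨k, rfl⟩ := Nat.exists_eq_add_of_le hr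
    rw [show 5 + k - 2 = k + 3 by omega, show 5 + k - 1 = k + 4 by omega,
      show 11 * (5 + k) - 3 = 11 * k + 52 by omega]
    nlinarith [sq_nonneg ((k : ℤ) - 1)]
  have hEr : (((r - 1) ^ (m - 1) : ℕ) : ℝ) = ((r : ℝ) - 1) ^ (m - 1) := by
    push_cast [Nat.cast_sub (by omega : 1 ≤ r)]; rfl
  -- For |j| ≥ 1, 2r(r − 2) + 2 = 2(r − 1)²; for |j| < 1 the exponent on the right is 2/(r − 3) ≤ 2.
  have hmax : max ‖j‖ 1 ^ (2 * r * (r - 2)) * ‖j‖ ^ 2 ≤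
      ‖j‖ ^ (expJ r m j * ((r : ℝ) - 1) ^ (m - 1)) := by
    by_cases h1 : 1 ≤ ‖j‖
    · rw [max_eq_left h1, expJ, if_pos h1, ← pow_add, ← hEr, ← Nat.cast_ofNat (R := ℝ),
        ← Nat.cast_mul, Real.rpow_natCast]
      refine pow_le_pow_right₀ h1 (le_trans (le_of_eq ?_) (Nat.mul_le_mul_left 2 hE))
      obtain ⟨k, rfl⟩ := Nat.exists_eq_add_of_le hr
      rw [show 5 + k - 2 = k + 3 by omega, show 5 + k - 1 = k + 4 by omega]
      ring
    · rw [max_eq_right (not_le.1 h1).le, one_pow, one_mul, expJ, if_neg h1, ← Real.rpow_natCast]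
      refine Real.rpow_le_rpow_of_exponent_ge hj0 (not_le.1 h1).le ?_
      have hE1 := one_le_pow_sub_one hr m
      have e : 2 / (((r : ℝ) - 3) * ((r : ℝ) - 1) ^ (m - 1)) * ((r : ℝ) - 1) ^ (m - 1) =
          2 / ((r : ℝ) - 3) := by
        have : (r : ℝ) - 3 ≠ 0 := by linarith
        field_simp
      rw [e, div_le_iff₀ (by linarith)]
      push_cast
      linarith
  rw [sizeBound_pow hr hh] at hw
  have hJ0 : 0 < max ‖j‖ 1 := lt_max_of_lt_right one_pos
  have key : (r ^ 10 * h * max ‖j‖ 1 ^ r) ^ (2 * (r - 2)) * (‖j‖ ^ 2 / h ^ 2) ≤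
      ρ ^ (2 * (r - 2)) * (‖j‖ ^ 2 / h ^ 2) := by
    calc (r ^ 10 * h * max ‖j‖ 1 ^ r) ^ (2 * (r - 2)) * (‖j‖ ^ 2 / h ^ 2)
        = (r : ℝ) ^ (20 * (r - 2)) * (h ^ (2 * (r - 2)) / h ^ 2) *
          (max ‖j‖ 1 ^ (2 * r * (r - 2)) * ‖j‖ ^ 2) := by
          rw [mul_pow, mul_pow, ← pow_mul, ← pow_mul, show 10 * (2 * (r - 2)) = 20 * (r - 2) by ring,
            show r * (2 * (r - 2)) = 2 * r * (r - 2) by ring]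
          ring
      _ = (r : ℝ) ^ (20 * (r - 2)) * h ^ (2 * (r - 3)) *
          (max ‖j‖ 1 ^ (2 * r * (r - 2)) * ‖j‖ ^ 2) := by
          rw [show 2 * (r - 2) = 2 * (r - 3) + 2 by omega, pow_add h]
          field_simp
      _ ≤ (r : ℝ) ^ ((r - 1) ^ (m - 1) + (11 * r - 3)) * h ^ (2 * (r - 3)) *
          ‖j‖ ^ (expJ r m j * ((r : ℝ) - 1) ^ (m - 1)) := by
          have : (1 : ℝ) ≤ r := by linarith
          gcongr
      _ ≤ (ρ ^ (r - 2) * ‖j‖ / h) ^ 2 := hw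
      _ = _ := by rw [div_pow, mul_pow, ← pow_mul, mul_comm (r - 2) 2]; ring
  have h1 := le_of_mul_le_mul_right key (by positivity)
  exact le_of_pow_le_pow_left₀ (by omega) hρ h1

end

/-! ### Chains of gaps and counting up to sign -/

/-- The largest member of a family with a gap principle. -/
theorem exists_max_of_gap {ι : Type*} [DecidableEq ι] (f w : ι → ℝ) {b : ℝ} (hb : 0 ≤ b) (e : ℕ)
    (k : ℕ) : ∀ R : Finset ι, R.card = k + 1 → (∀ p ∈ R, b ≤ w p) →
      (∀ p ∈ R, ∀ q ∈ R, p ≠ q → f p ≤ f q → w p ^ e ≤ w q) →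
      ∃ p ∈ R, (∀ q ∈ R, f q ≤ f p) ∧ b ^ (e ^ k) ≤ w p := by
  induction k with
  | zero =>
    intro R hR hbw _
    obtain ⟨p, rfl⟩ := Finset.card_eq_one.1 hR
    exact ⟨p, by simp, by simp, by simpa using hbw⟩
  | succ k ih =>
    intro R hR hbw hgap
    obtain ⟨p, hp, hmax⟩ := R.exists_max_image f (Finset.card_pos.1 (by omega))
    obtain ⟨q, hq, -, hqw⟩ := ih (R.erase p) (by rw [Finset.card_erase_of_mem hp]; omega)
      (fun q hq => hbw q (Finset.mem_of_mem_erase hq))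
      (fun q hq q' hq' => hgap q (Finset.mem_of_mem_erase hq) q' (Finset.mem_of_mem_erase hq'))
    have hqR := Finset.mem_of_mem_erase hq
    refine ⟨p, hp, hmax, ?_⟩
    calc b ^ (e ^ (k + 1)) = (b ^ (e ^ k)) ^ e := by rw [← pow_mul, pow_succ]
      _ ≤ w q ^ e := by gcongr
      _ ≤ w p := hgap q hqR p hp (Finset.ne_of_mem_erase hq) (hmax q hqR)

/-- Counting up to sign by a map to a finite set. -/
theorem countUpToSign_le {S : Set (ℤ × ℤ)} {Ω : Finset ℂ} {ω : ℤ × ℤ → ℂ} {K m : ℕ}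
    (hK : Ω.card ≤ K) (hω : ∀ p ∈ S, ω p ∈ Ω)
    (hm : ∀ c : ℂ, ∀ R : Finset (ℤ × ℤ), (∀ p ∈ R, p ∈ S ∧ ω p = c) →
      (∀ p ∈ R, ∀ q ∈ R, p ≠ q → p ≠ -q) → R.card ≤ m) :
    countUpToSign S ≤ ((K * m : ℕ) : ℕ∞) := by
  classical
  by_contra hcon
  rw [not_le, countUpToSign] at hcon
  -- The solution set is not known to be finite, so Km + 1 pairs are extracted before the pigeonhole
  -- principle is applied.
  obtain ⟨T, hT, hTcard⟩ := Set.exists_subset_encard_eq (Order.add_one_le_of_lt hcon)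
  have hfin : T.Finite := Set.finite_of_encard_eq_coe (k := K * m + 1) (by rw [hTcard]; rfl)
  lift T to Finset (Sym2 (ℤ × ℤ)) using hfin
  rw [Set.encard_coe_eq_coe_finsetCard] at hTcard
  have hTc : T.card = K * m + 1 := by exact_mod_cast hTcard
  choose! g hgS hg using fun t (ht : t ∈ T) => hT ht
  obtain ⟨c, hc, hlt⟩ := Finset.exists_lt_card_fiber_of_mul_lt_card_of_maps_to (s := T) (t := Ω)
    (f := fun t => ω (g t)) (n := m) (fun t ht => hω _ (hgS t ht))
    (by rw [hTc]; exact Nat.lt_succ_of_le (Nat.mul_le_mul_right m hK))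
  set T' := T.filter fun t => ω (g t) = c with hT'
  have hinj : Set.InjOn g T' := by
    intro t ht t' ht' h
    rw [← hg t (Finset.mem_filter.1 ht).1, ← hg t' (Finset.mem_filter.1 ht').1, h]
  refine absurd (hm c (T'.image g) ?_ ?_) ?_
  · intro p hp
    obtain ⟨t, ht, rfl⟩ := Finset.mem_image.1 hp
    exact ⟨hgS t (Finset.mem_filter.1 ht).1, (Finset.mem_filter.1 ht).2⟩
  · intro p hp q hq hpq hneg
    obtain ⟨t, ht, rfl⟩ := Finset.mem_image.1 hp
    obtain ⟨t', ht', rfl⟩ := Finset.mem_image.1 hq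
    apply hpq
    have h1 := hg t (Finset.mem_filter.1 ht).1
    have h2 := hg t' (Finset.mem_filter.1 ht').1
    simp only [hneg, neg_neg] at h1
    simp only at h2
    rw [h1.symm.trans (Sym2.eq_swap.trans h2)]
  · rw [Finset.card_image_of_injOn hinj]
    exact not_le.2 hlt

theorem eq_or_eq_neg_of_gcd_eq_one {p q : ℤ × ℤ} (hp : Int.gcd p.1 p.2 = 1)
    (hq : Int.gcd q.1 q.2 = 1) (h : p.1 * q.2 = q.1 * p.2) : p = q ∨ p = -q := by
  obtain ⟨u, v, huv⟩ := Int.isCoprime_iff_gcd_eq_one.2 hp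
  obtain ⟨s, t, hst⟩ := Int.isCoprime_iff_gcd_eq_one.2 hq
  have h1 : q.1 = (u * q.1 + v * q.2) * p.1 := by linear_combination -q.1 * huv - v * h
  have h2 : q.2 = (u * q.1 + v * q.2) * p.2 := by linear_combination -q.2 * huv + u * h
  have h3 : (u * q.1 + v * q.2) * (s * p.1 + t * p.2) = 1 := by
    linear_combination hst - s * h1 - t * h2
  rcases Int.isUnit_iff.1 (IsUnit.of_mul_eq_one _ h3) with h4 | h4 <;> rw [h4] at h1 h2
  · left; ext <;> simp [h1, h2]
  · right; ext <;> simp [h1, h2]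

/-! ### Size and separation of large solutions -/

section Size

variable {F : MvPolynomial (Fin 2) ℤ} {r m : ℕ} {α β γ δ : ℂ} {h : ℤ} {p q : ℤ × ℤ}

/-- The geometric mean of the absolute values of the two linear forms. -/
noncomputable def meanSize (α β γ δ : ℂ) (p : ℤ × ℤ) : ℝ :=
  Real.sqrt (‖lin α β p‖ * ‖lin γ δ p‖)

theorem meanSize_sq (p : ℤ × ℤ) : meanSize α β γ δ p ^ 2 = ‖lin α β p‖ * ‖lin γ δ p‖ :=
  Real.sq_sqrt (by positivity)

theorem one_le_of_mem {b : ℝ} (hp : p ∈ largeSolutions F h b) : 1 ≤ h :=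
  (Int.add_one_le_iff.2 hp.2.1).trans hp.2.2.1

/-- From `value_hessian`, with r − 1 bounded by r. -/
theorem sizeBound_le_of_mem (hr : 5 ≤ r) (hF : IsDiagonalizedBy F r α β γ δ)
    (hp : p ∈ largeSolutions F h (hessianBound r m h (α * δ - β * γ))) :
    sizeBound r m h (α * δ - β * γ) ≤
      (meanSize α β γ δ p ^ (r - 2) * ‖α * δ - β * γ‖ / h) ^ 2 := by
  have hh := one_le_of_mem hp
  have hh1 : (1 : ℝ) ≤ h := by exact_mod_cast hh
  have hr5 : (5 : ℝ) ≤ r := by exact_mod_cast hr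
  have hH := hp.2.2.2
  rw [hessianBound_eq hr hh] at hH
  have e := congrArg norm (value_hessian hF p)
  rw [Complex.norm_intCast, ← Int.cast_abs] at e
  rw [e, norm_neg, norm_mul, norm_mul, norm_pow, norm_pow, norm_pow, norm_mul, norm_mul,
    Complex.norm_natCast, Complex.norm_natCast, ← meanSize_sq] at hH
  have hr1 : ((r - 1 : ℕ) : ℝ) ≤ r := by exact_mod_cast Nat.sub_le r 1
  rw [div_pow, le_div_iff₀ (by positivity)]
  have h1 : (r : ℝ) ^ 4 * (h ^ 2 * sizeBound r m h (α * δ - β * γ)) ≤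
      r ^ 4 * (meanSize α β γ δ p ^ (r - 2) * ‖α * δ - β * γ‖) ^ 2 := by
    calc _ = r ^ 4 * (h : ℝ) ^ 2 * sizeBound r m h (α * δ - β * γ) := by ring
      _ ≤ _ := hH
      _ ≤ (r * r) ^ 2 * ‖α * δ - β * γ‖ ^ 2 * (meanSize α β γ δ p ^ 2) ^ (r - 2) := by gcongr
      _ = _ := by ring
  have h2 := le_of_mul_le_mul_left h1 (by positivity)
  linarith

theorem two_mul_le_pow_of_mem (hr : 5 ≤ r) (hF : IsDiagonalizedBy F r α β γ δ)
    (hp : p ∈ largeSolutions F h (hessianBound r m h (α * δ - β * γ))) :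
    2 * (h : ℝ) ≤ meanSize α β γ δ p ^ r :=
  two_mul_le_pow_of_sizeBound_le hr (by exact_mod_cast one_le_of_mem hp) hF.2
    (Real.sqrt_nonneg _) (sizeBound_le_of_mem hr hF hp)

theorem meanSize_pos_of_mem (hr : 5 ≤ r) (hF : IsDiagonalizedBy F r α β γ δ)
    (hp : p ∈ largeSolutions F h (hessianBound r m h (α * δ - β * γ))) :
    0 < meanSize α β γ δ p := by
  have hh1 : (1 : ℝ) ≤ h := by exact_mod_cast one_le_of_mem hp
  have := two_mul_le_pow_of_mem hr hF hp
  refine lt_of_le_of_ne (Real.sqrt_nonneg _) fun h0 => ?_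
  rw [← h0, zero_pow (by omega)] at this
  linarith

theorem lin_ne_zero_of_mem (hr : 5 ≤ r) (hF : IsDiagonalizedBy F r α β γ δ)
    (hp : p ∈ largeSolutions F h (hessianBound r m h (α * δ - β * γ))) :
    lin α β p ≠ 0 ∧ lin γ δ p ≠ 0 := by
  have h1 := pow_pos (meanSize_pos_of_mem hr hF hp) 2
  rw [meanSize_sq] at h1
  constructor <;> intro h0 <;> simp [h0] at h1

theorem lin_cross (p q : ℤ × ℤ) : lin α β p * lin γ δ q - lin α β q * lin γ δ p =
    (α * δ - β * γ) * ((p.1 * q.2 - q.1 * p.2 : ℤ) : ℂ) := by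
  simp only [lin]; push_cast; ring

/-- Primitive points that differ by more than a sign have a nonzero integer determinant. -/
theorem norm_le_norm_cross (hp : Int.gcd p.1 p.2 = 1) (hq : Int.gcd q.1 q.2 = 1) (h1 : p ≠ q)
    (h2 : p ≠ -q) :
    ‖α * δ - β * γ‖ ≤ ‖lin α β p * lin γ δ q - lin α β q * lin γ δ p‖ := by
  rw [lin_cross, norm_mul, Complex.norm_intCast, ← Int.cast_abs]
  have h0 : p.1 * q.2 - q.1 * p.2 ≠ 0 := fun h0 =>
    (eq_or_eq_neg_of_gcd_eq_one hp hq (sub_eq_zero.1 h0)).elim h1 h2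
  have : (1 : ℝ) ≤ (|p.1 * q.2 - q.1 * p.2| : ℤ) := by exact_mod_cast Int.one_le_abs h0
  exact le_mul_of_one_le_right (norm_nonneg _) this

end Size

namespace Setting

variable {F : MvPolynomial (Fin 2) ℤ} {r m : ℕ} {α β γ δ χ : ℂ} {A B C : ℤ} {h : ℤ}

/-- As |d| ≥ 1, `norm_root_pow_le` gives 1 ≤ r³|j|^r, which fails if r|j| < 1. -/
theorem one_div_le_norm (S : Setting F r α β γ δ χ A B C)
    (hprim : ∃ u v w : ℤ, u * A + v * B + w * C = 1) : 1 / (r : ℝ) ≤ ‖α * δ - β * γ‖ := by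
  have h5 := S.five_le
  have hr5 : (5 : ℝ) ≤ r := by exact_mod_cast h5
  have h1 := (one_le_pow₀ S.one_le_norm_root).trans (S.norm_root_pow_le hprim)
  by_contra! hlt
  have h2 : (r : ℝ) * ‖α * δ - β * γ‖ < 1 := by
    rw [lt_div_iff₀ (by linarith)] at hlt; linarith
  have h3 : ‖α * δ - β * γ‖ ≤ 1 := by nlinarith [norm_nonneg (α * δ - β * γ)]
  have h4 : ‖α * δ - β * γ‖ ^ r ≤ ‖α * δ - β * γ‖ ^ 3 :=
    pow_le_pow_of_le_one (norm_nonneg _) h3 (by omega)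
  have h6 : ((r : ℝ) * ‖α * δ - β * γ‖) ^ 3 < 1 := pow_lt_one₀ (by positivity) h2 (by norm_num)
  rw [mul_pow] at h6
  have : (r : ℝ) ^ 3 * ‖α * δ - β * γ‖ ^ r ≤ (r : ℝ) ^ 3 * ‖α * δ - β * γ‖ ^ 3 := by gcongr
  linarith

/-- Root of order r − 2 in `norm_root_pow_le`, by 3 ≤ r − 2 and r ≤ 2(r − 2). -/
theorem norm_root_le (S : Setting F r α β γ δ χ A B C)
    (hprim : ∃ u v w : ℤ, u * A + v * B + w * C = 1) :
    ‖(α * δ - β * γ) / χ‖ ≤ r * max ‖α * δ - β * γ‖ 1 ^ 2 := by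
  have h5 := S.five_le
  have hr1 : (1 : ℝ) ≤ r := by exact_mod_cast (by omega : 1 ≤ r)
  have hJ : 1 ≤ max ‖α * δ - β * γ‖ 1 := le_max_right _ _
  refine le_of_pow_le_pow_left₀ (by omega : r - 2 ≠ 0) (by positivity)
    ((S.norm_root_pow_le hprim).trans ?_)
  rw [mul_pow, ← pow_mul]
  refine mul_le_mul (pow_le_pow_right₀ hr1 (by omega)) ?_ (by positivity) (by positivity)
  exact (pow_le_pow_left₀ (norm_nonneg _) (le_max_left _ _) _).trans
    (pow_le_pow_right₀ hJ (by omega))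

/-- At most `m` large solutions belong to the same root of unity. -/
theorem card_le_of_nearRoot (S : Setting F r α β γ δ χ A B C)
    (hprim : ∃ u v w : ℤ, u * A + v * B + w * C = 1) (hm : 3 ≤ m) (ω : ℂ) (L : ℤ × ℤ → ℂ)
    (R : Finset (ℤ × ℤ))
    (hR : ∀ p ∈ R, p ∈ largeSolutions F h (hessianBound r m h (α * δ - β * γ)) ∧
      NearRoot r h ω (lin α β p) (lin γ δ p) (meanSize α β γ δ p) (L p))
    (hne : ∀ p ∈ R, ∀ q ∈ R, p ≠ q → p ≠ -q) : R.card ≤ m := by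
  classical
  by_contra! hlt
  have hr := S.five_le
  have hF := S.diag
  obtain ⟨R', hR'R, hcard⟩ := Finset.exists_subset_card_eq (Nat.succ_le_of_lt hlt)
  obtain ⟨p₀, hp₀⟩ := Finset.card_pos.1 (by omega : 0 < R'.card)
  have hh : (1 : ℝ) ≤ h := by exact_mod_cast one_le_of_mem (hR p₀ (hR'R hp₀)).1
  have hj0 : 0 < ‖α * δ - β * γ‖ := norm_pos_iff.2 hF.2
  set ρ := meanSize α β γ δ with hρdef
  have gap : ∀ p ∈ R, ∀ q ∈ R, p ≠ q → ρ p ≤ ρ q →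
      ‖α * δ - β * γ‖ * ρ p ^ (r - 1) ≤ h * ρ q := by
    intro p hp q hq hpq hle
    have hpos : 0 < ρ p := (hR p hp).2.rho_pos
    refine le_trans ?_ (NearRoot.gap hr (by linarith) (hR p hp).2 (hR q hq).2 hle
      (two_mul_le_pow_of_mem hr hF (hR p hp).1))
    gcongr
    exact norm_le_norm_cross (hR p hp).1.1 (hR q hq).1.1 hpq (hne p hp q hq hpq)
  -- Of m + 1 points the largest is set aside; the largest of the other m lies beyond m − 1 gaps and
  -- forms with it the forbidden pair.
  obtain ⟨p₂, hp₂, hmax⟩ := R'.exists_max_image ρ ⟨p₀, hp₀⟩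
  have hsub : ∀ p ∈ R'.erase p₂, p ∈ R := fun p hp => hR'R (Finset.mem_of_mem_erase hp)
  obtain ⟨p₁, hp₁, -, hw⟩ := exists_max_of_gap ρ
    (fun p => (ρ p ^ (r - 2) * ‖α * δ - β * γ‖ / h) ^ 2)
    (sizeBound_pos (m := m) hr hh hF.2).le (r - 1) (m - 1) (R'.erase p₂)
    (by rw [Finset.card_erase_of_mem hp₂]; omega)
    (fun p hp => sizeBound_le_of_mem hr hF (hR p (hsub p hp)).1)
    (by
      intro p hp q hq hpq hle
      have hg := gap p (hsub p hp) q (hsub q hq) hpq hle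
      have hpos : 0 < ρ p := (hR p (hsub p hp)).2.rho_pos
      rw [← pow_mul, mul_comm 2, pow_mul]
      refine pow_le_pow_left₀ (by positivity) ?_ 2
      have hg' : ‖α * δ - β * γ‖ * ρ p ^ (r - 1) / h ≤ ρ q := by
        rw [div_le_iff₀ (by linarith)]; linarith
      -- The normalization of w makes the gap an exact power: r − 2 factors are replaced by ρ', and
      -- one factor |j|/h remains.
      calc (ρ p ^ (r - 2) * ‖α * δ - β * γ‖ / h) ^ (r - 1)
          = (‖α * δ - β * γ‖ * ρ p ^ (r - 1) / h) ^ (r - 2) * ‖α * δ - β * γ‖ / h := by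
            rw [div_pow, div_pow, mul_pow, mul_pow, ← pow_mul, ← pow_mul, mul_comm (r - 1) (r - 2),
              show r - 1 = r - 2 + 1 by omega]
            field_simp
            ring
        _ ≤ ρ q ^ (r - 2) * ‖α * δ - β * γ‖ / h := by gcongr)
  have hp₁R := hsub p₁ hp₁
  have hp₂R := hR'R hp₂
  have N₁ := (hR p₁ hp₁R).2
  have N₂ := (hR p₂ hp₂R).2
  have hx := le_of_sizeBound_pow_le hr hm hh hF.2 N₁.rho_pos.le hw
  have hle := hmax p₁ (Finset.mem_of_mem_erase hp₁)
  have hJ : 1 ≤ max ‖α * δ - β * γ‖ 1 := le_max_right _ _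
  have hr5 : (5 : ℝ) ≤ r := by exact_mod_cast hr
  have h100 : 100 * (h : ℝ) ≤ ρ p₁ ^ r := by
    have h1 : (100 : ℝ) ≤ r ^ 10 := by
      calc (100 : ℝ) ≤ 5 ^ 10 := by norm_num
        _ ≤ r ^ 10 := by gcongr
    have h2 : 100 * (h : ℝ) ≤ ρ p₁ := by
      refine le_trans ?_ hx
      calc 100 * (h : ℝ) = 100 * h * 1 := by ring
        _ ≤ r ^ 10 * h * max ‖α * δ - β * γ‖ 1 ^ r := by
          gcongr
          exact one_le_pow₀ hJ
    exact h2.trans (le_self_pow₀ (by linarith) (by omega))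
  have hv : value F p₁ ≠ 0 := abs_pos.1 (hR p₁ hp₁R).1.2.1
  exact no_large_pair hr hh hJ (S.one_div_le_norm hprim) S.one_le_norm_root (S.norm_root_le hprim)
    hx hle (gap p₁ hp₁R p₂ hp₂R (Finset.ne_of_mem_erase hp₁) hle)
    (fun n hn => S.norm_disc_le_of_nearRoot (by linarith) N₁ N₂ hle h100 hv hn)

end Setting

/-! ### Counting the roots of unity -/

/-- The root of unity to which `ξ / η` is close. -/
noncomputable def nearestRoot (r : ℕ) (ξ η : ℂ) : ℂ :=
  ξ / (η * Complex.exp (Complex.log (ξ ^ r / η ^ r) / r))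

theorem countUpToSign_empty : countUpToSign ∅ = 0 := by simp [countUpToSign]

/-- Division by a nonzero coefficient of the other linear form. -/
theorem exists_real_multiple {α β γ δ χ : ℂ} {a e e' c : ℝ} (hχ : χ ≠ 0) (hne : γ ≠ 0 ∨ δ ≠ 0)
    (h1 : α * γ = χ * a) (h2 : β * γ = χ * e) (h3 : α * δ = χ * e') (h4 : β * δ = χ * c) :
    ∃ (κ : ℂ) (x y : ℝ), κ ≠ 0 ∧ α = κ * x ∧ β = κ * y := by
  rcases hne with h0 | h0
  · exact ⟨χ / γ, a, e, div_ne_zero hχ h0, by rw [div_mul_eq_mul_div, ← h1, mul_div_cancel_right₀ _ h0],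
      by rw [div_mul_eq_mul_div, ← h2, mul_div_cancel_right₀ _ h0]⟩
  · exact ⟨χ / δ, e', c, div_ne_zero hχ h0, by rw [div_mul_eq_mul_div, ← h3, mul_div_cancel_right₀ _ h0],
      by rw [div_mul_eq_mul_div, ← h4, mul_div_cancel_right₀ _ h0]⟩

theorem eq_or_eq_neg_of_norm_mul_real {κ : ℂ} {t : ℝ} (h : ‖κ * t‖ = 1) :
    κ * t = κ / (‖κ‖ : ℝ) ∨ κ * t = -(κ / (‖κ‖ : ℝ)) := by
  rw [norm_mul, Complex.norm_real, Real.norm_eq_abs] at h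
  have hκ : ‖κ‖ ≠ 0 := by intro h0; rw [h0] at h; simp at h
  have ht : |t| = ‖κ‖⁻¹ := by field_simp; linarith
  rcases abs_eq (by positivity) |>.1 ht with h1 | h1
  · left; rw [h1, Complex.ofReal_inv, div_eq_mul_inv]
  · right; rw [h1, Complex.ofReal_neg, Complex.ofReal_inv, div_eq_mul_inv, mul_neg]

namespace Setting

variable {F : MvPolynomial (Fin 2) ℤ} {r m : ℕ} {α β γ δ χ : ℂ} {A B C : ℤ} {h : ℤ} {p : ℤ × ℤ}

theorem numLargeSolutions_le (S : Setting F r α β γ δ χ A B C)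
    (hprim : ∃ u v w : ℤ, u * A + v * B + w * C = 1) (hm : 3 ≤ m) {Ω : Finset ℂ} {K : ℕ}
    (hK : Ω.card ≤ K)
    (hu : ∀ p ∈ largeSolutions F h (hessianBound r m h (α * δ - β * γ)),
      ‖lin α β p ^ r‖ = ‖lin γ δ p ^ r‖ ∨ ∃ u : ℝ, 0 < u ∧ lin α β p ^ r = u * lin γ δ p ^ r)
    (hΩ : ∀ p ∈ largeSolutions F h (hessianBound r m h (α * δ - β * γ)),
      nearestRoot r (lin α β p) (lin γ δ p) ∈ Ω) :
    numLargeSolutions F r m h (α * δ - β * γ) ≤ ((K * m : ℕ) : ℕ∞) := by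
  have hr := S.five_le
  refine countUpToSign_le hK hΩ fun c R hR hne => ?_
  refine S.card_le_of_nearRoot (h := h) hprim hm c
    (fun p => Complex.log (lin α β p ^ r / lin γ δ p ^ r) / r) R (fun p hp => ?_) hne
  obtain ⟨hp, rfl⟩ := hR p hp
  obtain ⟨h1, h2⟩ := lin_ne_zero_of_mem hr S.diag hp
  refine ⟨hp, exists_nearRoot (by omega) h1 h2 (hu p hp) ?_⟩
  rw [← value_eq S.diag, Complex.norm_intCast, ← Int.cast_abs]
  exact_mod_cast hp.2.2.1

theorem nearestRoot_pow (S : Setting F r α β γ δ χ A B C)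
    (hp : p ∈ largeSolutions F h (hessianBound r m h (α * δ - β * γ)))
    (hu : ‖lin α β p ^ r‖ = ‖lin γ δ p ^ r‖ ∨
      ∃ u : ℝ, 0 < u ∧ lin α β p ^ r = u * lin γ δ p ^ r) :
    nearestRoot r (lin α β p) (lin γ δ p) ^ r = 1 := by
  have hr := S.five_le
  obtain ⟨h1, h2⟩ := lin_ne_zero_of_mem hr S.diag hp
  exact (exists_nearRoot (by omega) h1 h2 hu le_rfl).pow_eq_one

/-! ### Negative discriminant -/

/-- Here d = j/χ is purely imaginary, hence so is ξ^r + η^r, while ξ^r − η^r is an integer. So the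
complex conjugate of ξ^r is −η^r. -/
theorem norm_pow_eq_of_disc_neg (S : Setting F r α β γ δ χ A B C) (hD : quadDisc A B C < 0)
    (p : ℤ × ℤ) : ‖lin α β p ^ r‖ = ‖lin γ δ p ^ r‖ := by
  have hr := S.five_le
  have hsq := S.root_sq
  obtain ⟨s, hs⟩ := S.exists_sum_eq p
  have hv := value_eq S.diag p
  set d := (α * δ - β * γ) / χ
  have hd0 : d ≠ 0 := norm_pos_iff.1 (zero_lt_one.trans_le S.one_le_norm_root)
  have hDR : ((quadDisc A B C : ℤ) : ℝ) < 0 := by exact_mod_cast hD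
  have hconj : (starRingEnd ℂ) d = -d := by
    have hre := congrArg Complex.re hsq
    have him := congrArg Complex.im hsq
    rw [pow_two, Complex.mul_re, Complex.intCast_re] at hre
    rw [pow_two, Complex.mul_im, Complex.intCast_im] at him
    have : d.re = 0 := by
      rcases mul_eq_zero.1 (by linarith : d.re * d.im = 0) with h0 | h0
      · exact h0
      · rw [h0] at hre; nlinarith
    apply Complex.ext <;> simp [this]
  have hr0 : (r : ℂ) ≠ 0 := by exact_mod_cast (by omega : r ≠ 0)
  have hs' := congrArg (starRingEnd ℂ) hs
  have hv' := congrArg (starRingEnd ℂ) hv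
  simp only [map_mul, map_add, map_sub, map_natCast, map_intCast, hconj] at hs' hv'
  have h1 : (starRingEnd ℂ) (lin α β p ^ r) + (starRingEnd ℂ) (lin γ δ p ^ r) =
      -(lin α β p ^ r + lin γ δ p ^ r) := by
    refine mul_left_cancel₀ (mul_ne_zero hr0 hd0) ?_
    linear_combination -hs' + hs
  have h2 : (starRingEnd ℂ) (lin α β p ^ r) = -(lin γ δ p ^ r) := by
    linear_combination h1 / 2 - hv' / 2 + hv / 2
  rw [← norm_neg (lin γ δ p ^ r), ← h2, RCLike.norm_conj]

theorem numLargeSolutions_le_of_disc_neg (S : Setting F r α β γ δ χ A B C)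
    (hprim : ∃ u v w : ℤ, u * A + v * B + w * C = 1) (hm : 3 ≤ m) (hD : quadDisc A B C < 0) :
    numLargeSolutions F r m h (α * δ - β * γ) ≤ ((r * m : ℕ) : ℕ∞) := by
  classical
  have hr := S.five_le
  have hu := fun p => S.norm_pow_eq_of_disc_neg hD p
  refine S.numLargeSolutions_le hprim hm (Ω := (Polynomial.nthRoots r (1 : ℂ)).toFinset)
    ((Multiset.toFinset_card_le _).trans (Polynomial.card_nthRoots r 1))
    (fun p _ => Or.inl (hu p)) fun p hp => ?_
  rw [Multiset.mem_toFinset, Polynomial.mem_nthRoots (by omega)]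
  exact S.nearestRoot_pow hp (Or.inl (hu p))

/-! ### Positive discriminant -/

theorem exists_real_root (S : Setting F r α β γ δ χ A B C) (hD : 0 < quadDisc A B C) :
    ∃ d : ℝ, d ≠ 0 ∧ (α * δ - β * γ) / χ = d := by
  have hsq := S.root_sq
  have hd0 := norm_pos_iff.1 (zero_lt_one.trans_le S.one_le_norm_root)
  set d := (α * δ - β * γ) / χ
  have hDR : (0 : ℝ) < ((quadDisc A B C : ℤ) : ℝ) := by exact_mod_cast hD
  have hre := congrArg Complex.re hsq
  have him := congrArg Complex.im hsq
  rw [pow_two, Complex.mul_re, Complex.intCast_re] at hre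
  rw [pow_two, Complex.mul_im, Complex.intCast_im] at him
  have h0 : d.im = 0 := by
    rcases mul_eq_zero.1 (by linarith : d.re * d.im = 0) with h0 | h0
    · rw [h0] at hre; nlinarith
    · exact h0
  have hd : d = (d.re : ℂ) := by apply Complex.ext <;> simp [h0]
  exact ⟨d.re, fun h => hd0 (by rw [hd, h, Complex.ofReal_zero]), hd⟩

theorem exists_real_pow (S : Setting F r α β γ δ χ A B C) (hD : 0 < quadDisc A B C) (p : ℤ × ℤ) :
    ∃ u v : ℝ, lin α β p ^ r = u ∧ lin γ δ p ^ r = v := by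
  have hr := S.five_le
  obtain ⟨d, hd0, hd⟩ := S.exists_real_root hD
  obtain ⟨s, hs⟩ := S.exists_sum_eq p
  have hv := value_eq S.diag p
  rw [hd] at hs
  have hr0 : (r : ℂ) ≠ 0 := by exact_mod_cast (by omega : r ≠ 0)
  have hd0' : (d : ℂ) ≠ 0 := by exact_mod_cast hd0
  have h1 : lin α β p ^ r + lin γ δ p ^ r = s / (r * d) := by
    rw [← hs]; field_simp
  refine ⟨(s / (r * d) + value F p) / 2, (s / (r * d) - value F p) / 2, ?_, ?_⟩ <;> push_cast <;>
    rw [← h1, hv] <;> ring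

/-- Both powers are real. With opposite signs, |F| = |ξ^r| + |η^r| ≥ 2ρ^r ≥ 4h, which is too large.
-/
theorem exists_pos_ratio (S : Setting F r α β γ δ χ A B C) (hD : 0 < quadDisc A B C)
    (hp : p ∈ largeSolutions F h (hessianBound r m h (α * δ - β * γ))) :
    ∃ u : ℝ, 0 < u ∧ lin α β p ^ r = u * lin γ δ p ^ r := by
  have hr := S.five_le
  have hh : (1 : ℝ) ≤ h := by exact_mod_cast one_le_of_mem hp
  obtain ⟨u, v, hu, hv⟩ := S.exists_real_pow hD p
  have h2 := two_mul_le_pow_of_mem hr S.diag hp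
  have hsq : (meanSize α β γ δ p ^ r) ^ 2 = |u * v| := by
    rw [← pow_mul, mul_comm, pow_mul, meanSize_sq, mul_pow, ← norm_pow, ← norm_pow, hu, hv,
      Complex.norm_real, Complex.norm_real, abs_mul, Real.norm_eq_abs, Real.norm_eq_abs]
  have hval : |u - v| ≤ h := by
    have e := value_eq S.diag p
    rw [hu, hv, ← Complex.ofReal_sub] at e
    have e' : (value F p : ℝ) = u - v := by exact_mod_cast e
    rw [← e', ← Int.cast_abs]
    exact_mod_cast hp.2.2.1
  have huv : 0 < u * v := by
    by_contra! hneg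
    rw [abs_of_nonpos hneg] at hsq
    have h3 : (u - v) ^ 2 ≤ h ^ 2 := by
      rw [← sq_abs]; exact pow_le_pow_left₀ (abs_nonneg _) hval 2
    nlinarith [sq_nonneg (u + v), pow_le_pow_left₀ (by linarith) h2 2]
  have hv0 : v ≠ 0 := by rintro rfl; simp at huv
  refine ⟨u / v, ?_, ?_⟩
  · rw [← mul_div_mul_right u v hv0]
    exact div_pos huv (mul_self_pos.2 hv0)
  · have : (v : ℂ) ≠ 0 := by exact_mod_cast hv0
    rw [hu, hv]; push_cast; field_simp

/-- For positive discriminant the two linear forms are proportional to real forms. -/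
theorem exists_real_forms (S : Setting F r α β γ δ χ A B C) (hD : 0 < quadDisc A B C) :
    ∃ (κ κ' : ℂ) (a b c d : ℝ), κ ≠ 0 ∧ κ' ≠ 0 ∧ α = κ * a ∧ β = κ * b ∧ γ = κ' * c ∧
      δ = κ' * d := by
  obtain ⟨t, -, ht⟩ := S.exists_real_root hD
  obtain ⟨h1, h2, h3⟩ := isAssociatedQuadratic_iff.1 S.quad
  have hχ := S.chi_ne_zero
  have hj := S.diag.2
  rw [div_eq_iff hχ] at ht
  have h4 : α * δ = χ * (((B + t) / 2 : ℝ) : ℂ) := by push_cast; linear_combination (h2 + ht) / 2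
  have h5 : β * γ = χ * (((B - t) / 2 : ℝ) : ℂ) := by push_cast; linear_combination (h2 - ht) / 2
  have h1' : α * γ = χ * ((A : ℝ) : ℂ) := by rw [h1]; push_cast; rfl
  have h3' : β * δ = χ * ((C : ℝ) : ℂ) := by rw [h3]; push_cast; rfl
  obtain ⟨κ, a, b, hκ, ha, hb⟩ := exists_real_multiple (α := α) (β := β) (γ := γ) (δ := δ) hχ (by
    by_contra! h0
    exact hj (by rw [h0.1, h0.2]; ring)) h1' h5 h4 h3'
  obtain ⟨κ', c, d, hκ', hc, hd⟩ := exists_real_multiple (α := γ) (β := δ) (γ := α) (δ := β) hχ (by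
    by_contra! h0
    exact hj (by rw [h0.1, h0.2]; ring)) ((mul_comm _ _).trans h1') ((mul_comm _ _).trans h4)
    ((mul_comm _ _).trans h5) ((mul_comm _ _).trans h3')
  exact ⟨κ, κ', a, b, c, d, hκ, hκ', ha, hb, hc, hd⟩

/-- For positive discriminant the large solutions belong to one of two opposite roots of unity. -/
theorem exists_nearestRoot_eq (S : Setting F r α β γ δ χ A B C) (hD : 0 < quadDisc A B C) :
    ∃ c : ℂ, ∀ p ∈ largeSolutions F h (hessianBound r m h (α * δ - β * γ)),
      nearestRoot r (lin α β p) (lin γ δ p) = c ∨ nearestRoot r (lin α β p) (lin γ δ p) = -c := by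
  have hr := S.five_le
  obtain ⟨κ, κ', a, b, c, d, hκ, hκ', ha, hb, hc, hd⟩ := S.exists_real_forms hD
  -- The nearest root is a real multiple of κ/κ' and has norm 1.
  refine ⟨κ / κ' / (‖κ / κ'‖ : ℝ), fun p hp => ?_⟩
  obtain ⟨u, hu, huv⟩ := S.exists_pos_ratio hD hp
  obtain ⟨-, h2⟩ := lin_ne_zero_of_mem hr S.diag hp
  have hnorm := Complex.norm_eq_one_of_pow_eq_one (S.nearestRoot_pow hp (Or.inr ⟨u, hu, huv⟩))
    (by omega)
  have e1 : lin α β p = κ * ((a * p.1 + b * p.2 : ℝ) : ℂ) := by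
    rw [lin, ha, hb]; push_cast; ring
  have e2 : lin γ δ p = κ' * ((c * p.1 + d * p.2 : ℝ) : ℂ) := by
    rw [lin, hc, hd]; push_cast; ring
  have e3 : nearestRoot r (lin α β p) (lin γ δ p) = κ / κ' *
      (((a * p.1 + b * p.2) / ((c * p.1 + d * p.2) * Real.exp (Real.log u / r)) : ℝ) : ℂ) := by
    rw [nearestRoot, huv, mul_div_cancel_right₀ _ (pow_ne_zero r h2), ← Complex.ofReal_log hu.le,
      e1, e2, mul_assoc, mul_div_mul_comm]
    push_cast
    rfl
  rw [e3] at hnorm ⊢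
  exact eq_or_eq_neg_of_norm_mul_real hnorm

theorem numLargeSolutions_le_of_disc_pos (S : Setting F r α β γ δ χ A B C)
    (hprim : ∃ u v w : ℤ, u * A + v * B + w * C = 1) (hm : 3 ≤ m) (hD : 0 < quadDisc A B C) :
    numLargeSolutions F r m h (α * δ - β * γ) ≤ ((2 * m : ℕ) : ℕ∞) := by
  classical
  obtain ⟨c, hc⟩ := S.exists_nearestRoot_eq (m := m) (h := h) hD
  exact S.numLargeSolutions_le hprim hm (Ω := {c, -c}) Finset.card_le_two
    (fun p hp => Or.inr (S.exists_pos_ratio hD hp)) fun p hp => by simpa using hc p hp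

theorem numLargeSolutions_le_of_disc_pos_of_odd (S : Setting F r α β γ δ χ A B C)
    (hprim : ∃ u v w : ℤ, u * A + v * B + w * C = 1) (hm : 3 ≤ m) (hD : 0 < quadDisc A B C)
    (hodd : Odd r) : numLargeSolutions F r m h (α * δ - β * γ) ≤ (m : ℕ∞) := by
  classical
  obtain ⟨c, hc⟩ := S.exists_nearestRoot_eq (m := m) (h := h) hD
  -- For odd r only one of c and −c can be an r-th root of unity.
  have key := S.numLargeSolutions_le (h := h) hprim hm (Ω := {if c ^ r = 1 then c else -c}) (K := 1)
    (Finset.card_singleton _).le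
    (fun p hp => Or.inr (S.exists_pos_ratio hD hp)) fun p hp => by
      have hpow := S.nearestRoot_pow hp (Or.inr (S.exists_pos_ratio hD hp))
      rw [Finset.mem_singleton]
      rcases hc p hp with h1 | h1 <;> rw [h1] at hpow ⊢
      · rw [if_pos hpow]
      · rw [hodd.neg_pow] at hpow
        rw [if_neg]
        intro h2
        rw [h2] at hpow
        norm_num at hpow
  simpa using key

/-- At a large solution ξ^r = uη^r with u > 0. Keeping ξ and scaling η by u^(1/r) leads to a nonzero
real point where F vanishes. -/
theorem largeSolutions_eq_empty (S : Setting F r α β γ δ χ A B C) (hD : 0 < quadDisc A B C)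
    (hdef : IsDefinite F) :
    largeSolutions F h (hessianBound r m h (α * δ - β * γ)) = ∅ := by
  have hr := S.five_le
  refine Set.eq_empty_of_forall_notMem fun p hp => ?_
  obtain ⟨κ, κ', a, b, c, d, hκ, hκ', ha, hb, hc, hd⟩ := S.exists_real_forms hD
  obtain ⟨u, hu, huv⟩ := S.exists_pos_ratio hD hp
  obtain ⟨h1, -⟩ := lin_ne_zero_of_mem hr S.diag hp
  have e1 : lin α β p = κ * ((a * p.1 + b * p.2 : ℝ) : ℂ) := by
    rw [lin, ha, hb]; push_cast; ring
  have e2 : lin γ δ p = κ' * ((c * p.1 + d * p.2 : ℝ) : ℂ) := by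
    rw [lin, hc, hd]; push_cast; ring
  set x : ℝ := a * p.1 + b * p.2
  set y : ℝ := c * p.1 + d * p.2
  have hx : x ≠ 0 := by intro h0; rw [e1, h0] at h1; simp at h1
  have hΔ : a * d - b * c ≠ 0 := by
    intro h0
    apply S.diag.2
    rw [ha, hb, hc, hd]
    have : (a * d - b * c : ℂ) = 0 := by exact_mod_cast h0
    linear_combination κ * κ' * this
  set v : ℝ := u ^ (1 / r : ℝ)
  have hv : v ^ r = u := by
    rw [← Real.rpow_natCast, ← Real.rpow_mul hu.le, one_div_mul_cancel (by positivity), Real.rpow_one]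
  -- Cramer's rule for the point where the two real forms take the values x and vy.
  set P : ℝ × ℝ := ((d * x - b * (v * y)) / (a * d - b * c), (a * (v * y) - c * x) / (a * d - b * c))
    with hP
  have hP1 : a * P.1 + b * P.2 = x := by
    simp only [hP, mul_div_assoc', ← add_div]
    rw [div_eq_iff hΔ]; ring
  have hP2 : c * P.1 + d * P.2 = v * y := by
    simp only [hP, mul_div_assoc', ← add_div]
    rw [div_eq_iff hΔ]; ring
  have hP0 : P ≠ 0 := by
    intro h0
    rw [h0] at hP1
    exact hx (by simpa using hP1.symm)
  have hzero : realValue F P = 0 := by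
    have e := realValue_eq S.diag P
    have e3 : α * P.1 + β * P.2 = κ * x := by
      rw [ha, hb, ← hP1]; push_cast; ring
    have e4 : γ * P.1 + δ * P.2 = κ' * (v * y) := by
      rw [hc, hd, ← Complex.ofReal_mul, ← hP2]; push_cast; ring
    rw [e3, e4, ← e1, huv, e2, mul_left_comm, mul_pow (v : ℂ), ← Complex.ofReal_pow, hv, sub_self] at e
    exact_mod_cast e
  rcases hdef with h2 | h2
  · exact (h2 P hP0).ne' hzero
  · exact (h2 P hP0).ne hzero

/-- Division by the content g changes D by the factor g², so the sign of D, on which the cases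
depend, is kept. -/
theorem exists_primitive (S : Setting F r α β γ δ χ A B C) :
    ∃ (χ' : ℂ) (A' B' C' : ℤ), Setting F r α β γ δ χ' A' B' C' ∧
      (∃ u v w : ℤ, u * A' + v * B' + w * C' = 1) ∧
      ∃ g : ℤ, 0 < g ∧ quadDisc A B C = g * quadDisc A' B' C' := by
  obtain ⟨g, u, v, w, hg, ⟨A', hA⟩, ⟨B', hB⟩, ⟨C', hC⟩⟩ :
      ∃ g u v w : ℤ, u * A + v * B + w * C = g ∧ g ∣ A ∧ g ∣ B ∧ g ∣ C := by
    have e1 := Int.gcd_eq_gcd_ab A B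
    have e2 := Int.gcd_eq_gcd_ab (Int.gcd A B) C
    have h1 := Int.gcd_dvd_left (Int.gcd A B : ℤ) C
    refine ⟨Int.gcd (Int.gcd A B) C, Int.gcdA A B * Int.gcdA (Int.gcd A B) C,
      Int.gcdB A B * Int.gcdA (Int.gcd A B) C, Int.gcdB (Int.gcd A B) C, ?_,
      h1.trans (Int.gcd_dvd_left A B), h1.trans (Int.gcd_dvd_right A B), Int.gcd_dvd_right _ _⟩
    rw [e2]
    linear_combination -Int.gcdA (Int.gcd A B) C * e1
  have hg0 : g ≠ 0 := by
    rintro rfl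
    apply S.disc_ne_zero
    rw [hA, hB, hC]; simp [quadDisc]
  refine ⟨χ * g, A', B', C', ⟨S.diag, ?_, S.five_le⟩, ⟨u, v, w, ?_⟩, g ^ 2, by positivity, ?_⟩
  · obtain ⟨h1, h2, h3⟩ := isAssociatedQuadratic_iff.1 S.quad
    refine isAssociatedQuadratic_iff.2 ⟨?_, ?_, ?_⟩
    · rw [h1, hA]; push_cast; ring
    · rw [h2, hB]; push_cast; ring
    · rw [h3, hC]; push_cast; ring
  · refine mul_left_cancel₀ hg0 ?_
    linear_combination hg - u * hA - v * hB - w * hC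
  · rw [hA, hB, hC, quadDisc, quadDisc]; ring

end Setting

end DiagThue

theorem theorem1p8 (F : MvPolynomial (Fin 2) ℤ) (r m : ℕ) (hr : 5 ≤ r) (hm : 3 ≤ m) (h : ℤ)
    (α β γ δ : ℂ) (hF : DiagThue.IsDiagonalizedBy F r α β γ δ) :
    (∃ (χ : ℂ) (A B C : ℤ), DiagThue.IsAssociatedQuadratic α β γ δ χ A B C) ∧
    ∀ (χ : ℂ) (A B C : ℤ), DiagThue.IsAssociatedQuadratic α β γ δ χ A B C →
      (DiagThue.quadDisc A B C < 0 →
        DiagThue.numLargeSolutions F r m h (α * δ - β * γ) ≤ ((r * m : ℕ) : ℕ∞)) ∧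
      (0 < DiagThue.quadDisc A B C → Even r → DiagThue.IsIndefinite F →
        DiagThue.numLargeSolutions F r m h (α * δ - β * γ) ≤ ((2 * m : ℕ) : ℕ∞)) ∧
      (0 < DiagThue.quadDisc A B C → Odd r → DiagThue.IsIndefinite F →
        DiagThue.numLargeSolutions F r m h (α * δ - β * γ) ≤ (m : ℕ∞)) ∧
      (0 < DiagThue.quadDisc A B C → DiagThue.IsDefinite F →
        DiagThue.numLargeSolutions F r m h (α * δ - β * γ) ≤ 1) := by
  refine ⟨DiagThue.exists_associatedQuadratic hr hF, fun χ A B C hq => ?_⟩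
  obtain ⟨χ', A', B', C', S, hprim, g, hg, hD⟩ :=
    DiagThue.Setting.exists_primitive (⟨hF, hq, hr⟩ : DiagThue.Setting F r α β γ δ χ A B C)
  rw [hD]
  refine ⟨fun h1 => ?_, fun h1 _ _ => ?_, fun h1 hodd _ => ?_, fun h1 hdef => ?_⟩
  · exact S.numLargeSolutions_le_of_disc_neg hprim hm (neg_of_mul_neg_right h1 hg.le)
  · exact S.numLargeSolutions_le_of_disc_pos hprim hm (pos_of_mul_pos_right h1 hg.le)
  · exact S.numLargeSolutions_le_of_disc_pos_of_odd hprim hm (pos_of_mul_pos_right h1 hg.le) hodd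
  · rw [DiagThue.numLargeSolutions, S.largeSolutions_eq_empty (pos_of_mul_pos_right h1 hg.le) hdef,
      DiagThue.countUpToSign_empty]
    exact zero_le_one
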